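/- Let $\Omega\subset\mathbb R^2$ be a bounded open set (for instance a bounded domain with Lipschitz boundary), let $\lambda_0>0$ be its smallest Dirichlet eigenvalue, $$\lambda_0=\inf\Big\{\frac{\int_\Omega|\nabla f|^2\,\mathrm dx}{\int_\Omega |f|^2\,\mathrm dx}\ :\ f\in W^{1,2}_0(\Omega),\ f\neq 0\Big\},$$ and for $\kappa>0$ and $Q\ge 1$ put $$\alpha(Q,\kappa)=\frac{2\kappa^2}{\sqrt{(Q-1)^2+4\lambda_0\kappa^2}+(Q-1)}.$$ Write $m=(m',m_3)$ with $m'=(m_1,m_2)$ for maps $m$ into $\mathbb S^2\subset\mathbb R^3$ and $e_3=(0,0,1)$, and set $$\mathcal E(m)=\int_\Omega\big(|\nabla m|^2-2\kappa\, m'\cdot\nabla m_3+(Q-1)|m'|^2\big)\,\mathrm dx,\qquad \mathcal N(m)=\frac1{4\pi}\int_\Omega m\cdot(\partial_1m\times\partial_2m)\,\mathrm dx.$$ For $d\in\mathbb Z$ let $\mathcal A_d$ be the set of all $m\in H^1(\Omega;\mathbb S^2)$ with $m=-e_3$ on $\partial\Omega$ (that is, $m+e_3\in W^{1,2}_0(\Omega;\mathbb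 R^3)$) and $\mathcal N(m)=d$. **Lemma 3.3.** There exists a universal constant $\varepsilon>0$, independent of $\Omega,\kappa,Q,d$ and $m$, with the following property. Let $\kappa>0$ and $Q\ge1$ satisfy $\alpha(Q,\kappa)\le\frac12$, and let $d\in\mathbb N\cup\{0\}$. If $m\in\mathcal A_d$ satisfies, for some $x\in\Omega$ and all $r>0$ with $B_r(x)\subset\Omega$, $$\frac1{\pi r^2}\int_{B_r(x)}\big(|\nabla m|^2+\max\{\lambda_0,Q-1\}\,|m+e_3|^2\big)\,\mathrm dy\le\varepsilon\kappa^2,$$ then there exists $\bar m\in\mathcal A_{d+1}$ with $$\mathcal E(\bar m)<\mathcal E(m)+8\pi.$$ -/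

import Mathlib

open MeasureTheory Filter Topology
open scoped ContDiff Matrix

noncomputable section

namespace Skyrmion

/-- The plane `ℝ²` with its Euclidean norm. -/
abbrev Plane : Type := EuclideanSpace ℝ (Fin 2)

/-- The space `ℝ³` with its Euclidean norm. -/
abbrev Space : Type := EuclideanSpace ℝ (Fin 3)

/-- The third standard basis vector `e₃` of `ℝ³`. -/
def e₃ : Space := EuclideanSpace.single 2 1

section Sobolev

variable {F : Type*} [NormedAddCommGroup F] [NormedSpace ℝ F]

/-- The classical partial derivative `∂ᵢ φ`. -/
def partialDeriv (i : Fin 2) (φ : Plane → F) (x : Plane) : F :=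
  fderiv ℝ φ x (EuclideanSpace.single i 1)

/-- `φ ∈ C_c^∞(Ω; F)`. -/
structure IsTestFunction (Ω : Set Plane) (φ : Plane → F) : Prop where
  smooth : ContDiff ℝ ∞ φ
  compact : HasCompactSupport φ
  support_subset : tsupport φ ⊆ Ω

/-- `g` is a weak `i`-th partial derivative of `f` in the open set `Ω`. -/
structure IsWeakPartial (Ω : Set Plane) (i : Fin 2) (f g : Plane → F) : Prop where
  locInt : LocallyIntegrableOn f Ω
  locInt_deriv : LocallyIntegrableOn g Ω
  integral_eq : ∀ φ : Plane → ℝ, IsTestFunction Ω φ →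
    ∫ x in Ω, partialDeriv i φ x • f x = -∫ x in Ω, φ x • g x

open Classical in
/-- The weak `i`-th partial derivative of `f` in `Ω`. It is determined up to equality almost
everywhere in `Ω` whenever it exists, and is set to `0` when it does not exist. -/
def weakPartial (Ω : Set Plane) (i : Fin 2) (f : Plane → F) : Plane → F :=
  if h : ∃ g, IsWeakPartial Ω i f g then h.choose else 0

/-- `f ∈ H¹(Ω; F) = W^{1,2}(Ω; F)`. -/
structure MemH1 (Ω : Set Plane) (f : Plane → F) : Prop where
  memLp : MemLp f 2 (volume.restrict Ω)
  exists_deriv : ∀ i : Fin 2, ∃ g : Plane → F,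
    IsWeakPartial Ω i f g ∧ MemLp g 2 (volume.restrict Ω)

/-- `f ∈ H¹₀(Ω; F) = W₀^{1,2}(Ω; F)`, the closure of `C_c^∞(Ω; F)` in `H¹(Ω; F)`. -/
structure MemH1Zero (Ω : Set Plane) (f : Plane → F) : Prop where
  memH1 : MemH1 Ω f
  exists_approx : ∃ φ : ℕ → Plane → F, (∀ n, IsTestFunction Ω (φ n)) ∧
    Tendsto (fun n => eLpNorm (fun x => φ n x - f x) 2 (volume.restrict Ω)) atTop (𝓝 0) ∧
    ∀ i : Fin 2, Tendsto
      (fun n => eLpNorm (fun x => partialDeriv i (φ n) x - weakPartial Ω i f x) 2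
        (volume.restrict Ω)) atTop (𝓝 0)

/-- The squared length `|∇ f|² = |∂₁ f|² + |∂₂ f|²` of the weak gradient in `Ω`. -/
def gradSq (Ω : Set Plane) (f : Plane → F) (x : Plane) : ℝ :=
  ∑ i : Fin 2, ‖weakPartial Ω i f x‖ ^ 2

end Sobolev

/-- The smallest Dirichlet eigenvalue `λ₀` of `Ω`: the infimum of the Rayleigh quotients
`∫_Ω |∇ f|² / ∫_Ω |f|²` over the non-zero `f ∈ W₀^{1,2}(Ω)`, that is, the largest constant with
`∫_Ω |f|² ≤ λ₀⁻¹ ∫_Ω |∇ f|²` for all such `f`. -/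
def dirichletEigenvalue (Ω : Set Plane) : ℝ :=
  sInf {R : ℝ | ∃ f : Plane → ℝ, MemH1Zero Ω f ∧ (∫ x in Ω, f x ^ 2) ≠ 0 ∧
    R = (∫ x in Ω, gradSq Ω f x) / ∫ x in Ω, f x ^ 2}

/-- The quantity `α(Q, κ)`, which depends on `Ω` through `λ₀`. -/
def alpha (Ω : Set Plane) (Q κ : ℝ) : ℝ :=
  2 * κ ^ 2 / (√((Q - 1) ^ 2 + 4 * dirichletEigenvalue Ω * κ ^ 2) + (Q - 1))

/-- The topological degree `𝒩(m) = (4π)⁻¹ ∫_Ω m · (∂₁ m × ∂₂ m)`. The extension of `m` by `-e₃`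
outside `Ω` contributes nothing to it. -/
def degree (Ω : Set Plane) (m : Plane → Space) : ℝ :=
  1 / (4 * Real.pi) * ∫ x in Ω,
    (m x).ofLp ⬝ᵥ ((weakPartial Ω 0 m x).ofLp ⨯₃ (weakPartial Ω 1 m x).ofLp)

/-- The admissible class `𝒜_d` of all `m ∈ H¹(Ω; 𝕊²)` with `m = -e₃` on `∂Ω` (in the sense
`m + e₃ ∈ H¹₀(Ω; ℝ³)`) and degree `d`. Only the values of `m` in `Ω` matter. -/
def admissible (Ω : Set Plane) (d : ℤ) : Set (Plane → Space) :=
  {m | MemH1 Ω m ∧ (∀ᵐ x ∂(volume.restrict Ω), ‖m x‖ = 1) ∧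
    MemH1Zero Ω (fun x => m x + e₃) ∧ degree Ω m = d}

/-- `m' · ∇ m₃ = m₁ ∂₁ m₃ + m₂ ∂₂ m₃`. -/
def dmiDensity (Ω : Set Plane) (m : Plane → Space) (x : Plane) : ℝ :=
  m x 0 * weakPartial Ω 0 m x 2 + m x 1 * weakPartial Ω 1 m x 2

/-- The energy `ℰ(m) = ∫_Ω (|∇ m|² - 2 κ m' · ∇ m₃ + (Q - 1) |m'|²)`. -/
def energy (Ω : Set Plane) (Q κ : ℝ) (m : Plane → Space) : ℝ :=
  ∫ x in Ω, (gradSq Ω m x - 2 * κ * dmiDensity Ω m x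
    + (Q - 1) * ((m x 0) ^ 2 + (m x 1) ^ 2))

end Skyrmion

end

/-!
A map `m` in the admissible class is represented by `u = m + e₃`, extended by zero to the whole
plane, together with a gradient `g`; the predicate `W0` says that `u` is a limit of test functions
with derivatives converging to `g`. Put `M = max {λ₀, Q - 1}`. The hypothesis `α ≤ 1 / 2`
enters only through `κ² ≤ M` (`sq_le_max_of_alpha_le`), where `λ₀ > 0` comes from the Poincaré
inequality.

The new map is `m` with a small bubble inserted near `x`. On a disc of small radius `R` around `x`
the hypothesis bounds `∫ |∇ m|² + M |m + e₃|²` by a multiple of `ε κ² R²`. Three facts are combined.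

* `exists_flatten`: if the Dirichlet energy in the disc is small, then `u` can be replaced there
  by a map that is constant, equal to some `p`, in the disc of radius `R / 4`. Both
  `∫ |∇ m|²` and `∫ |m + e₃|²` over the disc grow at most by a constant factor, so that the energy
  changes by at most a multiple of `ε κ² R²`; moreover `|p|²` is at most `16 ε`, since `κ² ≤ M`.
  The new map is made from averages of `u` over discs with a variable radius `ρ(z)`, which vanishes
  outside the large disc, interpolated with the average over the whole disc and retracted to the
  sphere. By the Poincaré inequality averages over discs of small energy stay close to the sphere.
  This replaces Fubini arguments on circles, and traces, by estimates on discs.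
* The degree does not change in this step. Two maps that are nowhere more than a right angle apart
  have the same degree (`degInt_eq_of_inner_nonneg`), because the difference of the two densities
  is an explicit curl. Averages over the radii `ρ` and `ρ / 2` are close to each other, so that the
  degree of the retracted averages is the same for all radii `2⁻ᵏ ρ`, and as `k` tends to
  infinity these maps converge to `u` in `W^{1,2}` (`SphereMap.degInt_retract_average`).
* `SphereMap.add_bubble` and `exists_integral_enDens_add_bubble_le`: into the disc of radius
  `R / 4` one inserts a stereographic projection of size `l`, cut off at that radius and rotated so
  that it tends to `p - e₃` at the rim. This raises the degree by one. It costs `8π + O(l² / R²)` of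
  Dirichlet energy and `O(l R + |p|² R²)` times `Q - 1`, and gains a fixed multiple of `κ l` from
  the interaction term `-2 κ m' · ∇ m₃`, since `|p|` is small.

With `l = c κ R²` the gain is a multiple of `c κ² R²`, which exceeds the cost `O(c² κ² R²)` of the
cutoff for small `c`, the cost of the flattening for small `ε`, and the rest for small `R`
(`energy_budget`).
-/

open scoped ENNReal NNReal

noncomputable section

namespace Skyrmion

/-! ### Functions in `W₀^{1,2}` with their gradients -/

section SobolevZero

variable {F : Type*} [NormedAddCommGroup F] [NormedSpace ℝ F]
variable {G : Type*} [NormedAddCommGroup G] [NormedSpace ℝ G]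

/-- `f` belongs to `W₀^{1,2}(Ω)`, extended by zero to the plane, with gradient `g`: both are `L²`
limits over the whole plane of test functions on `Ω` and of their derivatives. The gradient is part
of the data, which avoids the choice of weak derivatives, and both functions are defined and
measurable everywhere, so that they can be composed with other maps. -/
structure W0 (Ω : Set Plane) (f : Plane → F) (g : Plane → Plane →L[ℝ] F) : Prop where
  meas : StronglyMeasurable f
  meas_deriv : StronglyMeasurable g
  exists_approx : ∃ φ : ℕ → Plane → F, (∀ n, IsTestFunction Ω (φ n)) ∧
    Tendsto (fun n => eLpNorm (φ n - f) 2 volume) atTop (𝓝 0) ∧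
    Tendsto (fun n => eLpNorm (fderiv ℝ (φ n) - g) 2 volume) atTop (𝓝 0)

theorem IsTestFunction.contDiff_one {Ω : Set Plane} {φ : Plane → F} (h : IsTestFunction Ω φ) :
    ContDiff ℝ 1 φ := h.smooth.of_le (by exact_mod_cast le_top)

theorem continuous_fderiv_of_C1 {φ : Plane → F} (h : ContDiff ℝ 1 φ) :
    Continuous (fderiv ℝ φ) := h.continuous_fderiv (by simp)

theorem memLp_of_C1 {φ : Plane → F} (h : ContDiff ℝ 1 φ) (hc : HasCompactSupport φ) :
    MemLp φ 2 volume := h.continuous.memLp_of_hasCompactSupport hc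

theorem memLp_fderiv_of_C1 {φ : Plane → F} (h : ContDiff ℝ 1 φ) (hc : HasCompactSupport φ) :
    MemLp (fderiv ℝ φ) 2 volume :=
  (continuous_fderiv_of_C1 h).memLp_of_hasCompactSupport (hc.fderiv ℝ)

theorem memLp_of_tendsto {E : Type*} [NormedAddCommGroup E] {μ : Measure Plane}
    {φ : ℕ → Plane → E} {f : Plane → E} (hφ : ∀ n, MemLp (φ n) 2 μ)
    (hf : AEStronglyMeasurable f μ)
    (h : Tendsto (fun n => eLpNorm (φ n - f) 2 μ) atTop (𝓝 0)) : MemLp f 2 μ := by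
  obtain ⟨n, hn⟩ := (h.eventually (gt_mem_nhds (zero_lt_one' ℝ≥0∞))).exists
  have h1 : MemLp (φ n - f) 2 μ := ⟨(hφ n).1.sub hf, hn.trans ENNReal.one_lt_top⟩
  have := (hφ n).sub h1
  simpa using this

theorem W0.memLp {Ω : Set Plane} {f : Plane → F} {g : Plane → Plane →L[ℝ] F} (h : W0 Ω f g) :
    MemLp f 2 volume := by
  obtain ⟨φ, hφ, h1, h2⟩ := h.exists_approx
  exact memLp_of_tendsto (fun n => memLp_of_C1 (hφ n).contDiff_one (hφ n).compact)
    h.meas.aestronglyMeasurable h1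

theorem W0.memLp_deriv {Ω : Set Plane} {f : Plane → F} {g : Plane → Plane →L[ℝ] F}
    (h : W0 Ω f g) : MemLp g 2 volume := by
  obtain ⟨φ, hφ, h1, h2⟩ := h.exists_approx
  exact memLp_of_tendsto (fun n => memLp_fderiv_of_C1 (hφ n).contDiff_one (hφ n).compact)
    h.meas_deriv.aestronglyMeasurable h2

theorem tendsto_eLpNorm_add {α E : Type*} [MeasurableSpace α] [NormedAddCommGroup E]
    {μ : Measure α} {u v w : ℕ → α → E} (hu : ∀ n, AEStronglyMeasurable (u n) μ)
    (hv : ∀ n, AEStronglyMeasurable (v n) μ)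
    (h1 : Tendsto (fun n => eLpNorm (u n) 2 μ) atTop (𝓝 0))
    (h2 : Tendsto (fun n => eLpNorm (v n) 2 μ) atTop (𝓝 0)) (hw : ∀ n, w n = u n + v n) :
    Tendsto (fun n => eLpNorm (w n) 2 μ) atTop (𝓝 0) := by
  refine tendsto_of_tendsto_of_tendsto_of_le_of_le tendsto_const_nhds
    (by simpa using h1.add h2) (fun _ => zero_le) fun n => ?_
  simp only [hw]
  exact eLpNorm_add_le (hu n) (hv n) (by norm_num)

/-- `W₀^{1,2}` is closed, by a diagonal sequence of test functions. -/
theorem W0.of_tendsto {Ω : Set Plane} {f : Plane → F} {g : Plane → Plane →L[ℝ] F}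
    (hf : StronglyMeasurable f) (hg : StronglyMeasurable g)
    {fn : ℕ → Plane → F} {gn : ℕ → Plane → Plane →L[ℝ] F}
    (h : ∀ n, W0 Ω (fn n) (gn n))
    (h1 : Tendsto (fun n => eLpNorm (fn n - f) 2 volume) atTop (𝓝 0))
    (h2 : Tendsto (fun n => eLpNorm (gn n - g) 2 volume) atTop (𝓝 0)) : W0 Ω f g := by
  have key : ∀ n : ℕ, ∃ φ : Plane → F, IsTestFunction Ω φ ∧
      eLpNorm (φ - fn n) 2 volume ≤ (n : ℝ≥0∞)⁻¹ ∧
      eLpNorm (fderiv ℝ φ - gn n) 2 volume ≤ (n : ℝ≥0∞)⁻¹ := by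
    intro n
    obtain ⟨φ, hφ, h3, h4⟩ := (h n).exists_approx
    have hpos : (0 : ℝ≥0∞) < (n : ℝ≥0∞)⁻¹ := by simp
    obtain ⟨k, hk⟩ := ((h3.eventually (gt_mem_nhds hpos)).and
      (h4.eventually (gt_mem_nhds hpos))).exists
    exact ⟨φ k, hφ k, hk.1.le, hk.2.le⟩
  choose φ hφ h3 h4 using key
  have hsq : ∀ {E : Type _} [NormedAddCommGroup E] (u : ℕ → Plane → E),
      (∀ n, eLpNorm (u n) 2 volume ≤ (n : ℝ≥0∞)⁻¹) →
      Tendsto (fun n => eLpNorm (u n) 2 volume) atTop (𝓝 0) := fun u hu =>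
    tendsto_of_tendsto_of_tendsto_of_le_of_le tendsto_const_nhds
      ENNReal.tendsto_inv_nat_nhds_zero (fun _ => zero_le) hu
  refine ⟨hf, hg, φ, hφ, ?_, ?_⟩
  · exact tendsto_eLpNorm_add (u := fun n => φ n - fn n) (v := fun n => fn n - f)
      (fun n => (hφ n).smooth.continuous.aestronglyMeasurable.sub
        (h n).meas.aestronglyMeasurable)
      (fun n => (h n).meas.aestronglyMeasurable.sub hf.aestronglyMeasurable)
      (hsq _ h3) h1 (fun n => by simp)
  · exact tendsto_eLpNorm_add (u := fun n => fderiv ℝ (φ n) - gn n) (v := fun n => gn n - g)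
      (fun n => (continuous_fderiv_of_C1 (hφ n).contDiff_one).aestronglyMeasurable.sub
        (h n).meas_deriv.aestronglyMeasurable)
      (fun n => (h n).meas_deriv.aestronglyMeasurable.sub hg.aestronglyMeasurable)
      (hsq _ h4) h2 (fun n => by simp)

theorem IsTestFunction.add {Ω : Set Plane} {φ ψ : Plane → F} (h : IsTestFunction Ω φ)
    (h' : IsTestFunction Ω ψ) : IsTestFunction Ω (φ + ψ) :=
  ⟨h.smooth.add h'.smooth, h.compact.add h'.compact,
    (tsupport_add φ ψ).trans (Set.union_subset h.support_subset h'.support_subset)⟩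

theorem W0.add {Ω : Set Plane} {f f' : Plane → F} {g g' : Plane → Plane →L[ℝ] F}
    (h : W0 Ω f g) (h' : W0 Ω f' g') : W0 Ω (f + f') (g + g') := by
  obtain ⟨φ, hφ, h1, h2⟩ := h.exists_approx
  obtain ⟨φ', hφ', h1', h2'⟩ := h'.exists_approx
  refine ⟨h.meas.add h'.meas, h.meas_deriv.add h'.meas_deriv, fun n => φ n + φ' n,
    fun n => (hφ n).add (hφ' n), ?_, ?_⟩
  · exact tendsto_eLpNorm_add (u := fun n => φ n - f) (v := fun n => φ' n - f')
      (fun n => (hφ n).smooth.continuous.aestronglyMeasurable.sub h.meas.aestronglyMeasurable)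
      (fun n => (hφ' n).smooth.continuous.aestronglyMeasurable.sub h'.meas.aestronglyMeasurable)
      h1 h1' (fun n => add_sub_add_comm _ _ _ _)
  · have hadd : ∀ n, fderiv ℝ (φ n + φ' n) = fderiv ℝ (φ n) + fderiv ℝ (φ' n) := by
      intro n
      ext1 x
      exact fderiv_add ((hφ n).contDiff_one.differentiable (by simp) x)
        ((hφ' n).contDiff_one.differentiable (by simp) x)
    exact tendsto_eLpNorm_add (u := fun n => fderiv ℝ (φ n) - g)
      (v := fun n => fderiv ℝ (φ' n) - g')
      (fun n => (continuous_fderiv_of_C1 (hφ n).contDiff_one).aestronglyMeasurable.sub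
        h.meas_deriv.aestronglyMeasurable)
      (fun n => (continuous_fderiv_of_C1 (hφ' n).contDiff_one).aestronglyMeasurable.sub
        h'.meas_deriv.aestronglyMeasurable)
      h2 h2' (fun n => by rw [hadd]; exact add_sub_add_comm _ _ _ _)

theorem eLpNorm_le_of_support_subset {E : Type*} [NormedAddCommGroup E] {f : Plane → E}
    {K : Set Plane}
    (hf : Function.support f ⊆ K) {c : ℝ≥0} (hc : ∀ x, ‖f x‖ ≤ c) :
    eLpNorm f 2 volume ≤ volume K ^ (1 / 2 : ℝ) * c := by
  rw [← eLpNorm_restrict_eq_of_support_subset hf]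
  have := eLpNorm_le_of_ae_bound (p := 2) (μ := volume.restrict K) (f := f) (C := c)
    (Eventually.of_forall hc)
  simpa [ENNReal.ofReal_coe_nnreal] using this

/-- Compactly supported `C¹` functions belong to `W₀^{1,2}`, by mollification. -/
theorem W0.of_contDiff [FiniteDimensional ℝ F] {Ω : Set Plane} (hΩ : IsOpen Ω) {f : Plane → F}
    (hf : ContDiff ℝ 1 f) (hc : HasCompactSupport f) (hs : tsupport f ⊆ Ω) :
    W0 Ω f (fderiv ℝ f) := by
  have hcf := continuous_fderiv_of_C1 hf
  obtain ⟨δ, hδ, hδΩ⟩ := hc.isCompact.exists_cthickening_subset_open hΩ hs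
  set K := Metric.cthickening δ (tsupport f) with hKdef
  have hK : IsCompact K := hc.isCompact.cthickening
  have key : ∀ c : ℝ≥0, 0 < c → ∃ φ : Plane → F, IsTestFunction Ω φ ∧ tsupport φ ⊆ K ∧
      (∀ x, ‖φ x - f x‖ ≤ c) ∧ ∀ x, ‖fderiv ℝ φ x - fderiv ℝ f x‖ ≤ c := by
    intro c hcpos
    obtain ⟨δ₁, hδ₁, h1⟩ := Metric.uniformContinuous_iff.1
      (hc.uniformContinuous_of_continuous hf.continuous) c hcpos
    obtain ⟨δ₂, hδ₂, h2⟩ := Metric.uniformContinuous_iff.1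
      ((hc.fderiv ℝ).uniformContinuous_of_continuous hcf) c hcpos
    have hr : 0 < min δ (min δ₁ δ₂) := by positivity
    let b : ContDiffBump (0 : Plane) := ⟨min δ (min δ₁ δ₂) / 2, min δ (min δ₁ δ₂), by positivity,
      by linarith⟩
    have hb : b.rOut = min δ (min δ₁ δ₂) := rfl
    let φ : Plane → F :=
      MeasureTheory.convolution (b.normed volume) f (ContinuousLinearMap.lsmul ℝ ℝ) volume
    have hsupp : Function.support φ ⊆ K := by
      intro x hx
      by_contra hxK
      apply hx
      have hz : ∀ y ∈ Metric.ball x b.rOut, f y = 0 := by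
        intro y hy
        by_contra hy0
        apply hxK
        refine Metric.mem_cthickening_of_dist_le x y δ _ (subset_tsupport _ hy0) ?_
        rw [dist_comm]
        exact (Metric.mem_ball.1 hy).le.trans (hb ▸ min_le_left _ _)
      have h0 : f x = 0 := hz x (Metric.mem_ball_self b.rOut_pos)
      have := b.normed_convolution_eq_right (μ := volume) (g := f) (x₀ := x)
        (fun y hy => by rw [hz y hy, h0])
      exact this.trans h0
    have hts : tsupport φ ⊆ K := closure_minimal hsupp hK.isClosed
    have hloc : LocallyIntegrable (b.normed volume) volume :=
      b.continuous_normed.locallyIntegrable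
    refine ⟨φ, ⟨?_, hK.of_isClosed_subset (isClosed_tsupport _) hts, hts.trans hδΩ⟩, hts, ?_, ?_⟩
    · exact b.hasCompactSupport_normed.contDiff_convolution_left _ b.contDiff_normed
        hf.continuous.locallyIntegrable
    · intro x
      rw [← dist_eq_norm]
      refine b.dist_normed_convolution_le hf.continuous.aestronglyMeasurable fun y hy => ?_
      refine (h1 ?_).le
      exact (Metric.mem_ball.1 hy).trans_le (hb ▸ (min_le_right _ _).trans (min_le_left _ _))
    · intro x
      have hd := hc.hasFDerivAt_convolution_right (ContinuousLinearMap.lsmul ℝ ℝ) hloc hf x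
      have heq : fderiv ℝ φ x = MeasureTheory.convolution (b.normed volume) (fderiv ℝ f)
          (ContinuousLinearMap.lsmul ℝ ℝ) volume x := by
        rw [show fderiv ℝ φ x = _ from hd.fderiv]
        simp only [MeasureTheory.convolution]
        congr 1
      rw [heq, ← dist_eq_norm]
      refine b.dist_normed_convolution_le hcf.aestronglyMeasurable fun y hy => ?_
      refine (h2 ?_).le
      exact (Metric.mem_ball.1 hy).trans_le (hb ▸ (min_le_right _ _).trans (min_le_right _ _))
  have hpos : ∀ n : ℕ, (0 : ℝ≥0) < ((n : ℝ≥0) + 1)⁻¹ := fun n => by positivity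
  choose φ hφ hφK h1 h2 using fun n : ℕ => key _ (hpos n)
  have hlim : Tendsto (fun n : ℕ => volume K ^ (1 / 2 : ℝ) * ((((n : ℝ≥0) + 1)⁻¹ : ℝ≥0) : ℝ≥0∞))
      atTop (𝓝 0) := by
    have h0 : Tendsto (fun n : ℕ => ((((n : ℝ≥0) + 1)⁻¹ : ℝ≥0) : ℝ≥0∞)) atTop (𝓝 0) := by
      rw [← ENNReal.coe_zero, ENNReal.tendsto_coe]
      have := tendsto_one_div_add_atTop_nhds_zero_nat (𝕜 := ℝ≥0)
      simpa using this
    have := ENNReal.Tendsto.const_mul (a := volume K ^ (1 / 2 : ℝ)) h0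
      (Or.inr (ENNReal.rpow_ne_top_of_nonneg (by norm_num) hK.measure_lt_top.ne))
    simpa using this
  have hfK : tsupport f ⊆ K := Metric.self_subset_cthickening _
  refine ⟨hf.continuous.stronglyMeasurable, hcf.stronglyMeasurable, φ, hφ, ?_, ?_⟩
  · refine tendsto_of_tendsto_of_tendsto_of_le_of_le tendsto_const_nhds hlim
      (fun _ => zero_le) fun n => eLpNorm_le_of_support_subset ?_ (h1 n)
    intro x hx
    by_contra hxK
    apply hx
    rw [Pi.sub_apply, image_eq_zero_of_notMem_tsupport fun h => hxK (hφK n h),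
      image_eq_zero_of_notMem_tsupport fun h => hxK (hfK h), sub_zero]
  · refine tendsto_of_tendsto_of_tendsto_of_le_of_le tendsto_const_nhds hlim
      (fun _ => zero_le) fun n => eLpNorm_le_of_support_subset ?_ (h2 n)
    intro x hx
    by_contra hxK
    apply hx
    rw [Pi.sub_apply, image_eq_zero_of_notMem_tsupport
        fun h => hxK (hφK n (tsupport_fderiv_subset ℝ h)),
      image_eq_zero_of_notMem_tsupport fun h => hxK (hfK (tsupport_fderiv_subset ℝ h)), sub_zero]

theorem exists_seq_ae_tendsto {E : Type*} [NormedAddCommGroup E] {μ : Measure Plane}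
    {φ : ℕ → Plane → E} {f : Plane → E} (hφ : ∀ n, AEStronglyMeasurable (φ n) μ)
    (hf : AEStronglyMeasurable f μ)
    (h : Tendsto (fun n => eLpNorm (φ n - f) 2 μ) atTop (𝓝 0)) :
    ∃ ns : ℕ → ℕ, StrictMono ns ∧ ∀ᵐ x ∂μ, Tendsto (fun i => φ (ns i) x) atTop (𝓝 (f x)) :=
  (tendstoInMeasure_of_tendsto_eLpNorm (by norm_num) hφ hf h).exists_seq_tendsto_ae

theorem W0.exists_approx_ae {Ω : Set Plane} {f : Plane → F} {g : Plane → Plane →L[ℝ] F}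
    (h : W0 Ω f g) : ∃ φ : ℕ → Plane → F, (∀ n, IsTestFunction Ω (φ n)) ∧
    Tendsto (fun n => eLpNorm (φ n - f) 2 volume) atTop (𝓝 0) ∧
    Tendsto (fun n => eLpNorm (fderiv ℝ (φ n) - g) 2 volume) atTop (𝓝 0) ∧
    ∀ᵐ x, Tendsto (fun n => φ n x) atTop (𝓝 (f x)) := by
  obtain ⟨φ, hφ, h1, h2⟩ := h.exists_approx
  obtain ⟨ns, hns, hae⟩ := exists_seq_ae_tendsto
    (fun n => (hφ n).smooth.continuous.aestronglyMeasurable) h.meas.aestronglyMeasurable h1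
  exact ⟨fun n => φ (ns n), fun n => hφ _, h1.comp hns.tendsto_atTop,
    h2.comp hns.tendsto_atTop, hae⟩

theorem eLpNorm_two_sq {α E : Type*} [MeasurableSpace α] [NormedAddCommGroup E] (μ : Measure α)
    (f : α → E) : eLpNorm f 2 μ ^ 2 = ∫⁻ x, ‖f x‖ₑ ^ 2 ∂μ := by
  have := eLpNorm_nnreal_pow_eq_lintegral (μ := μ) (f := f) (p := 2) (by norm_num)
  simpa using this

theorem tendsto_eLpNorm_two_iff {α E : Type*} [MeasurableSpace α] [NormedAddCommGroup E]
    {μ : Measure α} {f : ℕ → α → E} :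
    Tendsto (fun n => eLpNorm (f n) 2 μ) atTop (𝓝 0) ↔
      Tendsto (fun n => ∫⁻ x, ‖f n x‖ₑ ^ 2 ∂μ) atTop (𝓝 0) := by
  simp only [← eLpNorm_two_sq]
  constructor
  · intro h
    have := ENNReal.Tendsto.pow (n := 2) h
    simpa using this
  · intro h
    have := (ENNReal.continuous_rpow_const (y := (1 / 2 : ℝ))).tendsto 0 |>.comp h
    have h2 : ((fun a : ℝ≥0∞ => a ^ (1 / 2 : ℝ)) ∘ fun n => eLpNorm (f n) 2 μ ^ 2)
        = fun n => eLpNorm (f n) 2 μ := by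
      ext n
      simp only [Function.comp]
      rw [← ENNReal.rpow_natCast, ← ENNReal.rpow_mul]
      norm_num
    rw [h2] at this
    simpa using this

theorem tendsto_eLpNorm_zero_of_dominated {α E E' : Type*} [MeasurableSpace α]
    [NormedAddCommGroup E] [NormedAddCommGroup E'] {μ : Measure α}
    {h : ℕ → α → E} {g : α → E'} (hg : MemLp g 2 μ) (hm : ∀ n, AEStronglyMeasurable (h n) μ)
    {c : ℝ≥0} (hle : ∀ n, ∀ᵐ x ∂μ, ‖h n x‖ ≤ c * ‖g x‖)
    (hlim : ∀ᵐ x ∂μ, Tendsto (fun n => h n x) atTop (𝓝 0)) :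
    Tendsto (fun n => eLpNorm (h n) 2 μ) atTop (𝓝 0) := by
  rw [tendsto_eLpNorm_two_iff]
  have hfin : ∫⁻ x, ((c : ℝ≥0∞) * ‖g x‖ₑ) ^ 2 ∂μ ≠ ⊤ := by
    simp only [mul_pow]
    rw [lintegral_const_mul' _ _ (by simp), ← eLpNorm_two_sq]
    exact ENNReal.mul_ne_top (by simp) (ENNReal.pow_ne_top hg.2.ne)
  have := tendsto_lintegral_of_dominated_convergence' (μ := μ)
    (F := fun n x => ‖h n x‖ₑ ^ 2) (f := fun _ => 0) (fun x => ((c : ℝ≥0∞) * ‖g x‖ₑ) ^ 2)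
    (fun n => (hm n).enorm.pow_const 2) (fun n => (hle n).mono fun x hx => ?_) hfin ?_
  · simpa using this
  · refine pow_le_pow_left' ?_ 2
    rw [← ofReal_norm, ← ofReal_norm, ← ENNReal.ofReal_coe_nnreal,
      ← ENNReal.ofReal_mul (by positivity)]
    exact ENNReal.ofReal_le_ofReal hx
  · filter_upwards [hlim] with x hx
    have := ENNReal.Tendsto.pow (n := 2) (hx.enorm)
    simpa using this

end SobolevZero

/-! ### Chain rules and integration by parts in `W₀^{1,2}` -/

section Calculus

variable {F : Type*} [NormedAddCommGroup F] [NormedSpace ℝ F]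
variable {G : Type*} [NormedAddCommGroup G] [NormedSpace ℝ G]
variable {H : Type*} [NormedAddCommGroup H] [NormedSpace ℝ H]

theorem aestronglyMeasurable_clm_comp {μ : Measure Plane} {a : Plane → F →L[ℝ] G}
    {b : Plane → Plane →L[ℝ] F} (ha : AEStronglyMeasurable a μ) (hb : AEStronglyMeasurable b μ) :
    AEStronglyMeasurable (fun x => (a x).comp (b x)) μ := by
  have hc : Continuous (fun p : (F →L[ℝ] G) × (Plane →L[ℝ] F) => p.1.comp p.2) := by fun_prop
  exact hc.comp_aestronglyMeasurable (ha.prodMk hb)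

theorem stronglyMeasurable_clm_comp {a : Plane → F →L[ℝ] G}
    {b : Plane → Plane →L[ℝ] F} (ha : StronglyMeasurable a) (hb : StronglyMeasurable b) :
    StronglyMeasurable (fun x => (a x).comp (b x)) := by
  have hc : Continuous (fun p : (F →L[ℝ] G) × (Plane →L[ℝ] F) => p.1.comp p.2) := by fun_prop
  exact hc.comp_stronglyMeasurable (ha.prodMk hb)

/-- Convergence of the gradients in the chain rule: the outer derivatives are bounded and converge
almost everywhere, the inner ones converge in `L²`. -/
theorem tendsto_eLpNorm_fderiv_comp {Ψ : F → G} (hΨ : ContDiff ℝ 1 Ψ) {C : ℝ≥0}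
    (hC : ∀ x, ‖fderiv ℝ Ψ x‖ ≤ C) {fn : ℕ → Plane → F} {f : Plane → F}
    {gn : ℕ → Plane → Plane →L[ℝ] F} {g : Plane → Plane →L[ℝ] F}
    (hfn : ∀ n, AEStronglyMeasurable (fn n) volume) (hf : AEStronglyMeasurable f volume)
    (hgn : ∀ n, AEStronglyMeasurable (gn n) volume) (hg : MemLp g 2 volume)
    (h1 : ∀ᵐ x, Tendsto (fun n => fn n x) atTop (𝓝 (f x)))
    (h2 : Tendsto (fun n => eLpNorm (gn n - g) 2 volume) atTop (𝓝 0)) :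
    Tendsto (fun n => eLpNorm ((fun x => (fderiv ℝ Ψ (fn n x)).comp (gn n x)) -
      fun x => (fderiv ℝ Ψ (f x)).comp (g x)) 2 volume) atTop (𝓝 0) := by
  have hΨ' : Continuous (fderiv ℝ Ψ) := hΨ.continuous_fderiv (by simp)
  have m1 : ∀ n, AEStronglyMeasurable (fun x => fderiv ℝ Ψ (fn n x)) volume := fun n =>
    hΨ'.comp_aestronglyMeasurable (hfn n)
  have m2 : AEStronglyMeasurable (fun x => fderiv ℝ Ψ (f x)) volume :=
    hΨ'.comp_aestronglyMeasurable hf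
  refine tendsto_eLpNorm_add
    (u := fun n x => (fderiv ℝ Ψ (fn n x)).comp (gn n x - g x))
    (v := fun n x => (fderiv ℝ Ψ (fn n x) - fderiv ℝ Ψ (f x)).comp (g x))
    (fun n => aestronglyMeasurable_clm_comp (m1 n) ((hgn n).sub hg.1))
    (fun n => aestronglyMeasurable_clm_comp ((m1 n).sub m2) hg.1) ?_ ?_ ?_
  · have hlim : Tendsto (fun n => (C : ℝ≥0∞) * eLpNorm (gn n - g) 2 volume) atTop (𝓝 0) := by
      simpa using ENNReal.Tendsto.const_mul (a := (C : ℝ≥0∞)) h2 (Or.inr ENNReal.coe_ne_top)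
    refine tendsto_of_tendsto_of_tendsto_of_le_of_le tendsto_const_nhds hlim
      (fun _ => zero_le) fun n => ?_
    refine eLpNorm_le_nnreal_smul_eLpNorm_of_ae_le_mul (c := C) (Eventually.of_forall fun x => ?_) 2
    refine NNReal.coe_le_coe.1 ?_
    push_cast
    exact (ContinuousLinearMap.opNorm_comp_le _ _).trans (by
      simp only [Pi.sub_apply]; gcongr; exact hC _)
  · refine tendsto_eLpNorm_zero_of_dominated hg (c := 2 * C)
      (fun n => aestronglyMeasurable_clm_comp ((m1 n).sub m2) hg.1)
      (fun n => Eventually.of_forall fun x => ?_) ?_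
    · refine (ContinuousLinearMap.opNorm_comp_le _ _).trans ?_
      gcongr
      refine (norm_sub_le _ _).trans ?_
      push_cast
      linarith [hC (fn n x), hC (f x)]
    · filter_upwards [h1] with x hx
      have h3 : Tendsto (fun n => fderiv ℝ Ψ (fn n x) - fderiv ℝ Ψ (f x)) atTop (𝓝 0) := by
        have := ((hΨ'.tendsto (f x)).comp hx).sub_const (fderiv ℝ Ψ (f x))
        simpa using this
      have hc : Continuous (fun a : F →L[ℝ] G => a.comp (g x)) := by fun_prop
      have := (hc.tendsto 0).comp h3
      simpa [Function.comp_def] using this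
  · intro n
    ext x v
    simp

theorem lipschitzWith_of_fderiv_le {Ψ : F → G} (hΨ : ContDiff ℝ 1 Ψ) {C : ℝ≥0}
    (hC : ∀ x, ‖fderiv ℝ Ψ x‖ ≤ C) : LipschitzWith C Ψ :=
  lipschitzWith_of_nnnorm_fderiv_le (hΨ.differentiable (by simp)) fun x =>
    NNReal.coe_le_coe.1 (by simpa using hC x)

theorem tendsto_eLpNorm_comp {F G : Type*} [NormedAddCommGroup F] [NormedAddCommGroup G]
    {Ψ : F → G} {C : ℝ≥0} (hΨ : LipschitzWith C Ψ)
    {fn : ℕ → Plane → F} {f : Plane → F}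
    (h : Tendsto (fun n => eLpNorm (fn n - f) 2 volume) atTop (𝓝 0)) :
    Tendsto (fun n => eLpNorm (Ψ ∘ fn n - Ψ ∘ f) 2 volume) atTop (𝓝 0) := by
  have hlim : Tendsto (fun n => (C : ℝ≥0∞) * eLpNorm (fn n - f) 2 volume) atTop (𝓝 0) := by
    simpa using ENNReal.Tendsto.const_mul (a := (C : ℝ≥0∞)) h (Or.inr ENNReal.coe_ne_top)
  refine tendsto_of_tendsto_of_tendsto_of_le_of_le tendsto_const_nhds hlim
    (fun _ => zero_le) fun n => ?_
  refine eLpNorm_le_nnreal_smul_eLpNorm_of_ae_le_mul (c := C) (Eventually.of_forall fun x => ?_) 2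
  refine NNReal.coe_le_coe.1 ?_
  have := hΨ.dist_le_mul (fn n x) (f x)
  simpa [dist_eq_norm] using this

/-- Chain rule in `W₀^{1,2}` for a `C¹` map with bounded derivative. -/
theorem W0.comp [FiniteDimensional ℝ G] {Ω : Set Plane} (hΩ : IsOpen Ω) {f : Plane → F}
    {g : Plane → Plane →L[ℝ] F} (h : W0 Ω f g) {Ψ : F → G} (hΨ : ContDiff ℝ 1 Ψ) {C : ℝ≥0}
    (hC : ∀ x, ‖fderiv ℝ Ψ x‖ ≤ C) (h0 : Ψ 0 = 0) :
    W0 Ω (Ψ ∘ f) (fun x => (fderiv ℝ Ψ (f x)).comp (g x)) := by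
  obtain ⟨φ, hφ, h1, h2, h3⟩ := h.exists_approx_ae
  have hsub : ∀ n, tsupport (Ψ ∘ φ n) ⊆ tsupport (φ n) := fun n =>
    closure_mono (Function.support_comp_subset h0 _)
  have hn : ∀ n, W0 Ω (Ψ ∘ φ n) (fun x => (fderiv ℝ Ψ (φ n x)).comp (fderiv ℝ (φ n) x)) := by
    intro n
    have := W0.of_contDiff hΩ (hΨ.comp (hφ n).contDiff_one) ((hφ n).compact.comp_left h0)
      ((hsub n).trans (hφ n).support_subset)
    convert this using 1
    ext1 x
    exact (fderiv_comp x (hΨ.differentiable (by simp) _)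
      ((hφ n).contDiff_one.differentiable (by simp) x)).symm
  exact W0.of_tendsto (hΨ.continuous.comp_stronglyMeasurable h.meas)
    (stronglyMeasurable_clm_comp
      ((hΨ.continuous_fderiv (by simp)).comp_stronglyMeasurable h.meas) h.meas_deriv) hn
    (tendsto_eLpNorm_comp (lipschitzWith_of_fderiv_le hΨ hC) h1)
    (tendsto_eLpNorm_fderiv_comp hΨ hC
      (fun n => (hφ n).smooth.continuous.aestronglyMeasurable) h.meas.aestronglyMeasurable
      (fun n => (continuous_fderiv_of_C1 (hφ n).contDiff_one).aestronglyMeasurable)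
      h.memLp_deriv h3 h2)

theorem W0.clm_comp [FiniteDimensional ℝ G] {Ω : Set Plane} (hΩ : IsOpen Ω) {f : Plane → F}
    {g : Plane → Plane →L[ℝ] F} (h : W0 Ω f g) (L : F →L[ℝ] G) :
    W0 Ω (fun x => L (f x)) (fun x => L.comp (g x)) := by
  have := h.comp hΩ (Ψ := L) L.contDiff (C := ‖L‖₊) (fun x => by simp) (map_zero L)
  simpa [Function.comp_def] using this

theorem W0.prodMk [FiniteDimensional ℝ F] [FiniteDimensional ℝ G] {Ω : Set Plane}
    (hΩ : IsOpen Ω) {f : Plane → F}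
    {g : Plane → Plane →L[ℝ] F} (h : W0 Ω f g) {f' : Plane → G}
    {g' : Plane → Plane →L[ℝ] G} (h' : W0 Ω f' g') :
    W0 Ω (fun x => (f x, f' x)) (fun x => (g x).prod (g' x)) := by
  have := (h.clm_comp hΩ (ContinuousLinearMap.inl ℝ F G)).add
    (h'.clm_comp hΩ (ContinuousLinearMap.inr ℝ F G))
  convert this using 1
  · ext x <;> simp
  · ext x v <;> simp

/-- A `C¹` map on a neighbourhood of a compact set can be modified away from it so as to become a
compactly supported `C¹` map on the whole space. -/
theorem exists_contDiff_extension [FiniteDimensional ℝ F] {K V : Set F} (hK : IsCompact K)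
    (hV : IsOpen V) (hKV : K ⊆ V) {Φ : F → G} (hΦ : ContDiffOn ℝ 1 Φ V) :
    ∃ Ψ : F → G, ContDiff ℝ 1 Ψ ∧ HasCompactSupport Ψ ∧ ∀ x ∈ K, Ψ =ᶠ[𝓝 x] Φ := by
  obtain ⟨K₁, hK₁, hKK₁, hK₁V⟩ := exists_compact_between hK hV hKV
  obtain ⟨χ, h0, h1, -⟩ := exists_contMDiffMap_zero_one_nhds_of_isClosed
    (modelWithCornersSelf ℝ F) (n := 1) (s := (interior K₁)ᶜ) (t := K)
    isOpen_interior.isClosed_compl hK.isClosed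
    (Set.disjoint_left.2 fun x hx hxK => hx (hKK₁ hxK))
  have hχ : ContDiff ℝ 1 χ := χ.contMDiff.contDiff
  have hts : tsupport χ ⊆ K₁ := by
    refine closure_minimal ?_ hK₁.isClosed
    intro x hx
    by_contra hxK
    refine hx (h0.self_of_nhdsSet x ?_)
    exact fun h => hxK (interior_subset h)
  have hts' : tsupport (fun x => χ x • Φ x) ⊆ tsupport χ := tsupport_smul_subset_left _ _
  refine ⟨fun x => χ x • Φ x, ?_, ?_, ?_⟩
  · rw [contDiff_iff_contDiffAt]
    intro x
    by_cases hx : x ∈ tsupport χ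
    · exact hχ.contDiffAt.smul (hΦ.contDiffAt (hV.mem_nhds (hK₁V (hts hx))))
    · have hx' : x ∉ tsupport (fun x => χ x • Φ x) := fun h => hx (hts' h)
      rw [notMem_tsupport_iff_eventuallyEq] at hx'
      exact contDiffAt_const.congr_of_eventuallyEq hx'
  · exact HasCompactSupport.of_support_subset_isCompact hK₁
      ((subset_tsupport _).trans (hts'.trans hts))
  · intro x hx
    have := h1.filter_mono (nhds_le_nhdsSet hx)
    filter_upwards [this] with y hy
    simp [hy]

theorem exists_bound_fderiv {Ψ : F → G} (hΨ : ContDiff ℝ 1 Ψ) (hc : HasCompactSupport Ψ) :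
    ∃ C : ℝ≥0, ∀ x, ‖fderiv ℝ Ψ x‖ ≤ C := by
  obtain ⟨C, hC⟩ := (hΨ.continuous_fderiv (by simp)).bounded_above_of_compact_support (hc.fderiv ℝ)
  exact ⟨⟨max C 0, le_max_right _ _⟩, fun x => (hC x).trans (le_max_left _ _)⟩

/-- Chain rule in `W₀^{1,2}` for a map `Φ` that is `C¹` near a compact set containing all values. -/
theorem W0.comp_of_mem [FiniteDimensional ℝ F] [FiniteDimensional ℝ G] {Ω : Set Plane}
    (hΩ : IsOpen Ω) {f : Plane → F}
    {g : Plane → Plane →L[ℝ] F} (h : W0 Ω f g) {K V : Set F} (hK : IsCompact K)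
    (hV : IsOpen V) (hKV : K ⊆ V) {Φ : F → G} (hΦ : ContDiffOn ℝ 1 Φ V)
    (hf : ∀ x, f x ∈ K) (h0K : 0 ∈ K) (h0 : Φ 0 = 0) :
    W0 Ω (fun x => Φ (f x)) (fun x => (fderiv ℝ Φ (f x)).comp (g x)) := by
  obtain ⟨Ψ, h1, h2, h3⟩ := exists_contDiff_extension hK hV hKV hΦ
  obtain ⟨C, hC⟩ := exists_bound_fderiv h1 h2
  have := h.comp hΩ h1 hC ((h3 0 h0K).self_of_nhds.trans h0)
  convert this using 1
  · ext1 x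
    exact (h3 _ (hf x)).self_of_nhds.symm
  · ext1 x
    rw [(h3 _ (hf x)).fderiv_eq]

theorem memLp_bilin_integrable {μ : Measure Plane} {a : Plane → F} {b : Plane → G}
    (B : F →L[ℝ] G →L[ℝ] H) (ha : MemLp a 2 μ) (hb : MemLp b 2 μ) :
    Integrable (fun x => B (a x) (b x)) μ :=
  memLp_one_iff_integrable.1 (B.memLp_of_bilin 1 ha hb)

theorem tendsto_integral_bilin {α : Type*} [MeasurableSpace α] {μ : Measure α}
    (B : F →L[ℝ] G →L[ℝ] H)
    {an : ℕ → α → F} {bn : ℕ → α → G} {a : α → F} {b : α → G}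
    (han : ∀ n, MemLp (an n) 2 μ) (hbn : ∀ n, MemLp (bn n) 2 μ) (ha : MemLp a 2 μ)
    (hb : MemLp b 2 μ) (h1 : Tendsto (fun n => eLpNorm (an n - a) 2 μ) atTop (𝓝 0))
    (h2 : Tendsto (fun n => eLpNorm (bn n - b) 2 μ) atTop (𝓝 0)) :
    Tendsto (fun n => ∫ x, B (an n x) (bn n x) ∂μ) atTop (𝓝 (∫ x, B (a x) (b x) ∂μ)) := by
  have hint : ∀ {a : α → F} {b : α → G}, MemLp a 2 μ → MemLp b 2 μ →
      Integrable (fun x => B (a x) (b x)) μ := fun ha hb =>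
    memLp_one_iff_integrable.1 (B.memLp_of_bilin 1 ha hb)
  have hle : ∀ {a : α → F} {b : α → G}, MemLp a 2 μ → MemLp b 2 μ →
      eLpNorm (fun x => B (a x) (b x)) 1 μ ≤ ‖B‖₊ * eLpNorm a 2 μ * eLpNorm b 2 μ := fun ha hb =>
    eLpNorm_le_eLpNorm_mul_eLpNorm_of_nnnorm ha.1 hb.1 (fun x y => B x y) ‖B‖₊
      (Eventually.of_forall fun x => B.le_opNorm₂ _ _)
  refine tendsto_integral_of_L1' _ (hint ha hb).1
    (Eventually.of_forall fun n => hint (han n) (hbn n)) ?_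
  have hb' : eLpNorm b 2 μ ≠ ⊤ := hb.2.ne
  have ha' : eLpNorm a 2 μ ≠ ⊤ := ha.2.ne
  have hlim : Tendsto (fun n => ‖B‖₊ * eLpNorm (an n - a) 2 μ * eLpNorm (bn n - b) 2 μ
      + (‖B‖₊ * eLpNorm (an n - a) 2 μ * eLpNorm b 2 μ
      + ‖B‖₊ * eLpNorm a 2 μ * eLpNorm (bn n - b) 2 μ)) atTop (𝓝 0) := by
    have e1 := ENNReal.Tendsto.const_mul (a := (‖B‖₊ : ℝ≥0∞)) h1 (Or.inr ENNReal.coe_ne_top)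
    have e2 := ENNReal.Tendsto.mul e1 (Or.inr (by simp)) h2 (Or.inr (by simp))
    have e3 := ENNReal.Tendsto.mul_const e1 (Or.inr hb')
    have e4 := ENNReal.Tendsto.const_mul (a := (‖B‖₊ : ℝ≥0∞) * eLpNorm a 2 μ) h2
      (Or.inr (ENNReal.mul_ne_top ENNReal.coe_ne_top ha'))
    simpa using e2.add (e3.add e4)
  refine tendsto_of_tendsto_of_tendsto_of_le_of_le tendsto_const_nhds hlim
    (fun _ => zero_le) fun n => ?_
  have e : (fun x => B (an n x) (bn n x)) - (fun x => B (a x) (b x)) =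
      (fun x => B ((an n - a) x) ((bn n - b) x)) + ((fun x => B ((an n - a) x) (b x))
        + fun x => B (a x) ((bn n - b) x)) := by
    ext x
    simp
  have d1 := (han n).sub ha
  have d2 := (hbn n).sub hb
  rw [e]
  refine (eLpNorm_add_le (hint d1 d2).1 ((hint d1 hb).1.add (hint ha d2).1) le_rfl).trans ?_
  refine add_le_add (hle d1 d2) ?_
  refine (eLpNorm_add_le (hint d1 hb).1 (hint ha d2).1 le_rfl).trans ?_
  exact add_le_add (hle d1 hb) (hle ha d2)

theorem tendsto_eLpNorm_clm {α : Type*} [MeasurableSpace α] {μ : Measure α} (L : F →L[ℝ] G)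
    {an : ℕ → α → F} {a : α → F} (h : Tendsto (fun n => eLpNorm (an n - a) 2 μ) atTop (𝓝 0)) :
    Tendsto (fun n => eLpNorm ((fun x => L (an n x)) - fun x => L (a x)) 2 μ) atTop (𝓝 0) := by
  have hlim : Tendsto (fun n => (‖L‖₊ : ℝ≥0∞) * eLpNorm (an n - a) 2 μ) atTop (𝓝 0) := by
    simpa using ENNReal.Tendsto.const_mul (a := (‖L‖₊ : ℝ≥0∞)) h (Or.inr ENNReal.coe_ne_top)
  refine tendsto_of_tendsto_of_tendsto_of_le_of_le tendsto_const_nhds hlim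
    (fun _ => zero_le) fun n => ?_
  refine eLpNorm_le_nnreal_smul_eLpNorm_of_ae_le_mul (Eventually.of_forall fun x => ?_) 2
  have := L.le_opNNNorm (an n x - a x)
  simpa using this

theorem memLp_clm {α : Type*} [MeasurableSpace α] {μ : Measure α} (L : F →L[ℝ] G)
    {a : α → F} (h : MemLp a 2 μ) : MemLp (fun x => L (a x)) 2 μ := L.comp_memLp' h

/-- The weak gradient of a `W₀^{1,2}` function, tested against `C¹_c` functions. -/
theorem W0.integral_fderiv_smul {Ω : Set Plane} {f : Plane → F} {g : Plane → Plane →L[ℝ] F}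
    (h : W0 Ω f g) {φ : Plane → ℝ} (hφ : ContDiff ℝ 1 φ) (hc : HasCompactSupport φ) (v : Plane) :
    ∫ x, fderiv ℝ φ x v • f x = -∫ x, φ x • g x v := by
  obtain ⟨ψ, hψ, h1, h2⟩ := h.exists_approx
  let ev : (Plane →L[ℝ] F) →L[ℝ] F := ContinuousLinearMap.apply ℝ F v
  have mφ := memLp_of_C1 hφ hc
  have mφ' : MemLp (fun x => fderiv ℝ φ x v) 2 volume :=
    memLp_clm (ContinuousLinearMap.apply ℝ ℝ v) (memLp_fderiv_of_C1 hφ hc)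
  have mψ := fun n => memLp_of_C1 (hψ n).contDiff_one (hψ n).compact
  have mψ' := fun n => memLp_fderiv_of_C1 (hψ n).contDiff_one (hψ n).compact
  have l1 := tendsto_integral_bilin (ContinuousLinearMap.lsmul ℝ ℝ : ℝ →L[ℝ] F →L[ℝ] F)
    (fun _ => mφ') mψ mφ' h.memLp (by simp) h1
  have l2 := tendsto_integral_bilin (ContinuousLinearMap.lsmul ℝ ℝ : ℝ →L[ℝ] F →L[ℝ] F)
    (fun _ => mφ) (fun n => memLp_clm ev (mψ' n)) mφ (memLp_clm ev h.memLp_deriv) (by simp)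
    (tendsto_eLpNorm_clm ev h2)
  refine tendsto_nhds_unique l1 (l2.neg.congr fun n => ?_)
  have hi : ∀ {a : Plane → ℝ} {b : Plane → F}, MemLp a 2 volume → MemLp b 2 volume →
      Integrable (fun x => a x • b x) volume := fun ha hb =>
    memLp_bilin_integrable (ContinuousLinearMap.lsmul ℝ ℝ : ℝ →L[ℝ] F →L[ℝ] F) ha hb
  have := integral_smul_fderiv_eq_neg_fderiv_smul_of_integrable (μ := volume) (f := φ) (g := ψ n)
    (v := v) (hi mφ' (mψ n)) (hi mφ (memLp_clm ev (mψ' n))) (hi mφ (mψ n))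
    (fun x _ => hφ.differentiable (by simp) x)
    (fun x _ => (hψ n).contDiff_one.differentiable (by simp) x)
  simp only [ContinuousLinearMap.lsmul_apply, ev, ContinuousLinearMap.apply_apply]
  rw [this, neg_neg]

theorem clm_ext_single {a b : Plane →L[ℝ] F}
    (h : ∀ i : Fin 2, a (EuclideanSpace.single i 1) = b (EuclideanSpace.single i 1)) : a = b := by
  refine ContinuousLinearMap.coe_injective
    ((EuclideanSpace.basisFun (Fin 2) ℝ).toBasis.ext fun i => ?_)
  simpa using h i

/-- The gradient in `W₀^{1,2}` is determined almost everywhere by the function. -/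
theorem W0.deriv_unique [CompleteSpace F] {Ω : Set Plane} {f : Plane → F}
    {g g' : Plane → Plane →L[ℝ] F}
    (h : W0 Ω f g) (h' : W0 Ω f g') : g =ᵐ[volume] g' := by
  have key : ∀ i : Fin 2, ∀ᵐ x,
      g x (EuclideanSpace.single i 1) = g' x (EuclideanSpace.single i 1) := by
    intro i
    have hl : ∀ {k : Plane → Plane →L[ℝ] F}, W0 Ω f k →
        LocallyIntegrable (fun x => k x (EuclideanSpace.single i 1)) volume := fun hk =>
      (memLp_clm (ContinuousLinearMap.apply ℝ F (EuclideanSpace.single i (1 : ℝ)))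
        hk.memLp_deriv).locallyIntegrable (by norm_num)
    refine ae_eq_of_integral_contDiff_smul_eq (hl h) (hl h') fun φ hφ hc => ?_
    have hφ1 : ContDiff ℝ 1 φ := hφ.of_le (by exact_mod_cast le_top)
    have e1 := h.integral_fderiv_smul hφ1 hc (EuclideanSpace.single i 1)
    have e2 := h'.integral_fderiv_smul hφ1 hc (EuclideanSpace.single i 1)
    rw [e1] at e2
    exact neg_injective e2
  filter_upwards [key 0, key 1] with x h0 h1
  refine clm_ext_single fun i => ?_
  fin_cases i
  · exact h0
  · exact h1

/-- The Jacobian of two scalar `W₀^{1,2}` functions integrates to zero. -/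
theorem W0.integral_jacobian {Ω : Set Plane} {b c : Plane → ℝ} {b' c' : Plane → Plane →L[ℝ] ℝ}
    (hb : W0 Ω b b') (hc : W0 Ω c c') (v w : Plane) :
    ∫ x, (b' x v * c' x w - b' x w * c' x v) = 0 := by
  obtain ⟨β, hβ, -, h2⟩ := hb.exists_approx
  obtain ⟨γ, hγ, -, h2'⟩ := hc.exists_approx
  let ev : Plane → (Plane →L[ℝ] ℝ) →L[ℝ] ℝ := fun v => ContinuousLinearMap.apply ℝ ℝ v
  have mβ := fun n => memLp_fderiv_of_C1 (hβ n).contDiff_one (hβ n).compact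
  have mγ := fun n => memLp_fderiv_of_C1 (hγ n).contDiff_one (hγ n).compact
  have lim : ∀ v w, Tendsto (fun n => ∫ x, fderiv ℝ (β n) x v * fderiv ℝ (γ n) x w) atTop
      (𝓝 (∫ x, b' x v * c' x w)) := fun v w =>
    tendsto_integral_bilin (ContinuousLinearMap.mul ℝ ℝ)
      (fun n => memLp_clm (ev v) (mβ n)) (fun n => memLp_clm (ev w) (mγ n))
      (memLp_clm (ev v) hb.memLp_deriv) (memLp_clm (ev w) hc.memLp_deriv)
      (tendsto_eLpNorm_clm (ev v) h2) (tendsto_eLpNorm_clm (ev w) h2')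
  have hint : ∀ v w, Integrable (fun x => b' x v * c' x w) volume := fun v w =>
    memLp_bilin_integrable (ContinuousLinearMap.mul ℝ ℝ)
      (memLp_clm (ev v) hb.memLp_deriv) (memLp_clm (ev w) hc.memLp_deriv)
  rw [integral_sub (hint v w) (hint w v), sub_eq_zero]
  refine tendsto_nhds_unique (lim v w) ((lim w v).congr fun n => ?_)
  have hdd : ∀ w, ContDiff ℝ 1 (fun x => fderiv ℝ (γ n) x w) := fun w =>
    ((hγ n).smooth.fderiv_right (m := 1) (by norm_cast)).clm_apply contDiff_const
  have hcs : ∀ w, HasCompactSupport (fun x => fderiv ℝ (γ n) x w) := fun w =>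
    (((hγ n).compact.fderiv ℝ).comp_left
      (g := fun a : Plane →L[ℝ] ℝ => a w) (by simp))
  have mb := memLp_of_C1 (hβ n).contDiff_one (hβ n).compact
  -- By integration by parts the claim reduces to the symmetry of the second derivative of `γ n`.
  have ibp : ∀ v w, ∫ x, fderiv ℝ (β n) x v * fderiv ℝ (γ n) x w =
      - ∫ x, β n x * fderiv ℝ (fun y => fderiv ℝ (γ n) y w) x v := by
    intro v w
    have := integral_mul_fderiv_eq_neg_fderiv_mul_of_integrable (μ := volume) (f := β n)
      (g := fun x => fderiv ℝ (γ n) x w) (v := v)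
      (memLp_bilin_integrable (ContinuousLinearMap.mul ℝ ℝ) (memLp_clm (ev v) (mβ n))
        (memLp_of_C1 (hdd w) (hcs w)))
      (memLp_bilin_integrable (ContinuousLinearMap.mul ℝ ℝ) mb
        (memLp_clm (ev v) (memLp_fderiv_of_C1 (hdd w) (hcs w))))
      (memLp_bilin_integrable (ContinuousLinearMap.mul ℝ ℝ) mb (memLp_of_C1 (hdd w) (hcs w)))
      (fun x _ => (hβ n).contDiff_one.differentiable (by simp) x)
      (fun x _ => (hdd w).differentiable (by simp) x)
    rw [this, neg_neg]
  rw [ibp, ibp]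
  congr 2
  ext x
  congr 1
  have hdiff : DifferentiableAt ℝ (fderiv ℝ (γ n)) x :=
    (((hγ n).smooth.fderiv_right (m := 1) (by norm_cast)).differentiable (by simp)) x
  have hsym : IsSymmSndFDerivAt ℝ (γ n) x :=
    (hγ n).smooth.contDiffAt.isSymmSndFDerivAt
      (by simp only [minSmoothness_of_isRCLikeNormedField]
          exact WithTop.coe_le_coe.2 (le_top : (2 : ℕ∞) ≤ ⊤))
  have e : ∀ v w, fderiv ℝ (fun y => fderiv ℝ (γ n) y w) x v
      = fderiv ℝ (fderiv ℝ (γ n)) x v w := by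
    intro v w
    rw [fderiv_clm_apply hdiff (differentiableAt_const w)]
    simp
  rw [e, e]
  exact hsym _ _

/-- Product rule in `W₀^{1,2}` for a bounded `C¹` factor with bounded derivative. -/
theorem W0.smul_contDiff [FiniteDimensional ℝ F] {Ω : Set Plane} (hΩ : IsOpen Ω) {f : Plane → F}
    {g : Plane → Plane →L[ℝ] F} (h : W0 Ω f g) {η : Plane → ℝ} (hη : ContDiff ℝ 1 η)
    {C : ℝ≥0} (hC : ∀ x, ‖η x‖ ≤ C) (hC' : ∀ x, ‖fderiv ℝ η x‖ ≤ C) :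
    W0 Ω (fun x => η x • f x) (fun x => η x • g x + (fderiv ℝ η x).smulRight (f x)) := by
  obtain ⟨φ, hφ, h1, h2⟩ := h.exists_approx
  have hη' := continuous_fderiv_of_C1 hη
  have hn : ∀ n, W0 Ω (fun x => η x • φ n x)
      (fun x => η x • fderiv ℝ (φ n) x + (fderiv ℝ η x).smulRight (φ n x)) := by
    intro n
    have e : fderiv ℝ (fun x => η x • φ n x) =
        fun x => η x • fderiv ℝ (φ n) x + (fderiv ℝ η x).smulRight (φ n x) := by
      ext1 x
      exact fderiv_fun_smul (hη.differentiable (by simp) _)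
        ((hφ n).contDiff_one.differentiable (by simp) x)
    rw [← e]
    exact W0.of_contDiff hΩ (hη.smul (hφ n).contDiff_one) ((hφ n).compact.smul_left)
      ((tsupport_smul_subset_right _ _).trans (hφ n).support_subset)
  have msm : ∀ {u : Plane → F}, StronglyMeasurable u →
      StronglyMeasurable (fun x => (fderiv ℝ η x).smulRight (u x)) := by
    intro u hu
    have hc : Continuous (fun p : (Plane →L[ℝ] ℝ) × F => p.1.smulRight p.2) := by fun_prop
    exact hc.comp_stronglyMeasurable (hη'.stronglyMeasurable.prodMk hu)
  have hlim : ∀ {E : Type _} [NormedAddCommGroup E] {u : ℕ → Plane → E},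
      Tendsto (fun n => eLpNorm (u n) 2 volume) atTop (𝓝 0) →
      Tendsto (fun n => (C : ℝ≥0∞) * eLpNorm (u n) 2 volume) atTop (𝓝 0) := by
    intro E _ u hu
    simpa using ENNReal.Tendsto.const_mul (a := (C : ℝ≥0∞)) hu (Or.inr ENNReal.coe_ne_top)
  have hsq : ∀ {E E' : Type _} [NormedAddCommGroup E] [NormedAddCommGroup E']
      {u : ℕ → Plane → E} {w : ℕ → Plane → E'},
      Tendsto (fun n => eLpNorm (u n) 2 volume) atTop (𝓝 0) →
      (∀ n x, ‖w n x‖ ≤ C * ‖u n x‖) →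
      Tendsto (fun n => eLpNorm (w n) 2 volume) atTop (𝓝 0) := by
    intro E E' _ _ u w hu hw
    exact tendsto_of_tendsto_of_tendsto_of_le_of_le tendsto_const_nhds (hlim hu)
      (fun _ => zero_le) fun n => eLpNorm_le_nnreal_smul_eLpNorm_of_ae_le_mul
        (Eventually.of_forall fun x => NNReal.coe_le_coe.1 (by simpa using hw n x)) 2
  refine W0.of_tendsto (hη.continuous.stronglyMeasurable.smul h.meas)
    ((hη.continuous.stronglyMeasurable.smul h.meas_deriv).add (msm h.meas)) hn ?_ ?_
  · refine hsq h1 fun n x => ?_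
    simp only [Pi.sub_apply, ← smul_sub, norm_smul]
    gcongr
    exact hC x
  · refine tendsto_eLpNorm_add (u := fun n x => η x • (fderiv ℝ (φ n) - g) x)
      (v := fun n x => (fderiv ℝ η x).smulRight ((φ n - f) x)) (fun n => ?_) (fun n => ?_)
      (hsq h2 fun n x => ?_) (hsq h1 fun n x => ?_) fun n => ?_
    · exact (hη.continuous.stronglyMeasurable.smul
        ((continuous_fderiv_of_C1 (hφ n).contDiff_one).stronglyMeasurable.sub
        h.meas_deriv)).aestronglyMeasurable
    · exact (msm ((hφ n).smooth.continuous.stronglyMeasurable.sub h.meas)).aestronglyMeasurable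
    · rw [norm_smul]
      gcongr
      exact hC x
    · rw [ContinuousLinearMap.norm_smulRight_apply]
      gcongr
      exact hC' x
    · ext x v
      simp only [Pi.sub_apply, Pi.add_apply, sub_apply, add_apply, smul_apply,
        ContinuousLinearMap.smulRight_apply, smul_sub]
      abel

end Calculus

/-! ### Weak derivatives and the space `H¹₀` -/

section Interface

variable {F : Type*} [NormedAddCommGroup F] [NormedSpace ℝ F]

/-- The `i`-th standard basis vector of the plane. -/
def bx (i : Fin 2) : Plane := EuclideanSpace.single i 1

theorem norm_bx (i : Fin 2) : ‖bx i‖ = 1 := by simp [bx]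

theorem IsWeakPartial.ae_unique [CompleteSpace F] {Ω : Set Plane} (hΩ : IsOpen Ω) {i : Fin 2}
    {f g g' : Plane → F}
    (h : IsWeakPartial Ω i f g) (h' : IsWeakPartial Ω i f g') :
    ∀ᵐ x ∂(volume.restrict Ω), g x = g' x := by
  rw [ae_restrict_iff' hΩ.measurableSet]
  have key := hΩ.ae_eq_zero_of_integral_contDiff_smul_eq_zero (μ := volume)
    (f := fun x => g x - g' x) (h.locInt_deriv.sub h'.locInt_deriv) fun φ hφ hc hs => ?_
  · filter_upwards [key] with x hx hxΩ
    exact sub_eq_zero.1 (hx hxΩ)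
  · have ht : IsTestFunction Ω φ := ⟨hφ, hc, hs⟩
    have e : ∀ {k : Plane → F}, ∫ x, φ x • k x = ∫ x in Ω, φ x • k x := by
      intro k
      rw [setIntegral_eq_integral_of_forall_compl_eq_zero]
      intro x hx
      rw [image_eq_zero_of_notMem_tsupport fun h => hx (hs h), zero_smul]
    have hint : ∀ {k : Plane → F}, LocallyIntegrableOn k Ω →
        IntegrableOn (fun x => φ x • k x) Ω := by
      intro k hk
      have hk' : IntegrableOn k (tsupport φ) := hk.integrableOn_compact_subset hs hc.isCompact
      have h1 : IntegrableOn (fun x => φ x • k x) (tsupport φ) :=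
        hk'.continuousOn_smul hφ.continuous.continuousOn hc.isCompact
      have h2 : Integrable (fun x => φ x • k x) volume := by
        rw [← integrableOn_iff_integrable_of_support_subset (s := tsupport φ)]
        · exact h1
        · exact (Function.support_smul_subset_left _ _).trans (subset_tsupport _)
      exact h2.integrableOn
    rw [e]
    simp only [smul_sub]
    rw [integral_sub (hint h.locInt_deriv) (hint h'.locInt_deriv), sub_eq_zero]
    have e1 := h.integral_eq φ ht
    rw [h'.integral_eq φ ht] at e1
    exact (neg_injective e1).symm

theorem IsWeakPartial.weakPartial {Ω : Set Plane} {i : Fin 2} {f g : Plane → F}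
    (h : IsWeakPartial Ω i f g) : IsWeakPartial Ω i f (weakPartial Ω i f) := by
  have he : ∃ g, IsWeakPartial Ω i f g := ⟨g, h⟩
  unfold Skyrmion.weakPartial
  rw [dif_pos he]
  exact he.choose_spec

theorem fderiv_eq_sum (φ : Plane → F) (x : Plane) : fderiv ℝ φ x =
    ContinuousLinearMap.smulRightL ℝ Plane F (EuclideanSpace.proj 0) (partialDeriv 0 φ x) +
    ContinuousLinearMap.smulRightL ℝ Plane F (EuclideanSpace.proj 1) (partialDeriv 1 φ x) := by
  refine clm_ext_single fun i => ?_
  fin_cases i <;> simp [partialDeriv]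

/-- A function in `H¹₀(Ω)` has a representative in the sense of `W0` that vanishes, along with its
gradient, everywhere outside `Ω`. -/
theorem MemH1Zero.exists_W0 {Ω : Set Plane} (hΩ : IsOpen Ω) {f : Plane → F}
    (h : MemH1Zero Ω f) : ∃ (u : Plane → F) (g : Plane → Plane →L[ℝ] F), W0 Ω u g ∧
      (∀ᵐ x ∂(volume.restrict Ω), u x = f x) ∧
      (∀ i, ∀ᵐ x ∂(volume.restrict Ω), g x (bx i) = weakPartial Ω i f x) ∧
      (∀ x ∉ Ω, u x = 0) ∧ ∀ x ∉ Ω, g x = 0 := by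
  obtain ⟨φ, hφ, h1, h2⟩ := h.exists_approx
  have hw : ∀ i, AEStronglyMeasurable (weakPartial Ω i f) (volume.restrict Ω) := fun i => by
    obtain ⟨g, hg, -⟩ := h.memH1.exists_deriv i
    exact hg.weakPartial.locInt_deriv.aestronglyMeasurable
  have hf := h.memH1.memLp.1
  set f' := hf.mk f with hf'
  set w : Fin 2 → Plane → F := fun i => (hw i).mk _ with hw'
  have hff' : f =ᵐ[volume.restrict Ω] f' := hf.ae_eq_mk
  have hww' : ∀ i, weakPartial Ω i f =ᵐ[volume.restrict Ω] w i := fun i => (hw i).ae_eq_mk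
  have hmw : ∀ i, StronglyMeasurable (Ω.indicator (w i)) := fun i =>
    (hw i).stronglyMeasurable_mk.indicator hΩ.measurableSet
  let L : Fin 2 → F →L[ℝ] (Plane →L[ℝ] F) := fun i =>
    ContinuousLinearMap.smulRightL ℝ Plane F (EuclideanSpace.proj i)
  have conv : ∀ {a : ℕ → Plane → F} {b b' : Plane → F}, (∀ n, ∀ x ∉ Ω, a n x = 0) →
      b =ᵐ[volume.restrict Ω] b' →
      Tendsto (fun n => eLpNorm (fun x => a n x - b x) 2 (volume.restrict Ω)) atTop (𝓝 0) →
      Tendsto (fun n => eLpNorm (a n - Ω.indicator b') 2 volume) atTop (𝓝 0) := by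
    intro a b b' ha hb ht
    refine ht.congr fun n => ?_
    have e : a n - Ω.indicator b' = Ω.indicator (a n - b') := by
      ext x
      by_cases hx : x ∈ Ω
      · simp [hx]
      · simp [hx, ha n x hx]
    rw [e, eLpNorm_indicator_eq_eLpNorm_restrict hΩ.measurableSet]
    refine eLpNorm_congr_ae ?_
    filter_upwards [hb] with x hx
    simp [hx]
  have hz : ∀ n, ∀ x ∉ Ω, x ∉ tsupport (φ n) := fun n x hx h => hx ((hφ n).support_subset h)
  refine ⟨Ω.indicator f', fun x => L 0 (Ω.indicator (w 0) x) + L 1 (Ω.indicator (w 1) x),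
    ⟨hf.stronglyMeasurable_mk.indicator hΩ.measurableSet,
      ((L 0).continuous.comp_stronglyMeasurable (hmw 0)).add
      ((L 1).continuous.comp_stronglyMeasurable (hmw 1)), φ, hφ,
      conv (fun n x hx => image_eq_zero_of_notMem_tsupport (hz n x hx)) hff' h1, ?_⟩, ?_, ?_, ?_, ?_⟩
  · have hp : ∀ i, Tendsto (fun n => eLpNorm (partialDeriv i (φ n) - Ω.indicator (w i)) 2 volume)
        atTop (𝓝 0) := fun i => conv (fun n x hx => by
          simp only [partialDeriv]
          rw [image_eq_zero_of_notMem_tsupport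
            (fun h => hz n x hx (tsupport_fderiv_subset ℝ h))]
          simp) (hww' i) (h2 i)
    have hc : ∀ i n, Continuous (partialDeriv i (φ n)) := fun i n =>
      (continuous_fderiv_of_C1 (hφ n).contDiff_one).clm_apply continuous_const
    refine tendsto_eLpNorm_add (fun n => ?_) (fun n => ?_) (tendsto_eLpNorm_clm (L 0) (hp 0))
      (tendsto_eLpNorm_clm (L 1) (hp 1)) fun n => ?_
    · exact (((L 0).continuous.comp (hc 0 n)).aestronglyMeasurable).sub
        ((L 0).continuous.comp_stronglyMeasurable (hmw 0)).aestronglyMeasurable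
    · exact (((L 1).continuous.comp (hc 1 n)).aestronglyMeasurable).sub
        ((L 1).continuous.comp_stronglyMeasurable (hmw 1)).aestronglyMeasurable
    · ext1 x
      simp only [Pi.sub_apply, Pi.add_apply, fderiv_eq_sum (φ n) x, L]
      abel
  · filter_upwards [hff', ae_restrict_mem hΩ.measurableSet] with x hx hxΩ
    simp [hxΩ, hx]
  · intro i
    filter_upwards [hww' 0, hww' 1, ae_restrict_mem hΩ.measurableSet] with x h0 h1 hxΩ
    fin_cases i <;> simp [L, bx, hxΩ, h0, h1]
  · intro x hx
    simp [hx]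
  · intro x hx
    simp [hx]

/-- Almost everywhere outside `Ω` both the function and the gradient vanish, since this holds for
test functions. -/
theorem W0.ae_eq_zero_compl {Ω : Set Plane} {f : Plane → F}
    {g : Plane → Plane →L[ℝ] F} (h : W0 Ω f g) : ∀ᵐ x, x ∉ Ω → f x = 0 ∧ g x = 0 := by
  obtain ⟨φ, hφ, h1, h2⟩ := h.exists_approx
  obtain ⟨ns, hns, hae⟩ := exists_seq_ae_tendsto
    (fun n => (hφ n).smooth.continuous.aestronglyMeasurable) h.meas.aestronglyMeasurable h1
  obtain ⟨ns', hns', hae'⟩ := exists_seq_ae_tendsto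
    (fun n => (continuous_fderiv_of_C1 (hφ n).contDiff_one).aestronglyMeasurable)
    h.meas_deriv.aestronglyMeasurable h2
  filter_upwards [hae, hae'] with x hx hx' hxΩ
  have hz : ∀ n, x ∉ tsupport (φ n) := fun n h => hxΩ ((hφ n).support_subset h)
  constructor
  · refine tendsto_nhds_unique hx (tendsto_const_nhds.congr fun n => ?_)
    exact (image_eq_zero_of_notMem_tsupport (hz _)).symm
  · refine tendsto_nhds_unique hx' (tendsto_const_nhds.congr fun n => ?_)
    exact (image_eq_zero_of_notMem_tsupport (fun h => hz _ (tsupport_fderiv_subset ℝ h))).symm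

theorem W0.isWeakPartial {Ω : Set Plane} {f : Plane → F}
    {g : Plane → Plane →L[ℝ] F} (h : W0 Ω f g) (i : Fin 2) :
    IsWeakPartial Ω i f (fun x => g x (bx i)) := by
  have hg : MemLp (fun x => g x (bx i)) 2 volume :=
    memLp_clm (ContinuousLinearMap.apply ℝ F (bx i)) h.memLp_deriv
  refine ⟨(h.memLp.locallyIntegrable (by norm_num)).locallyIntegrableOn _,
    (hg.locallyIntegrable (by norm_num)).locallyIntegrableOn _, fun φ hφ => ?_⟩
  have hz : ∀ x ∉ Ω, x ∉ tsupport φ := fun x hx h => hx (hφ.support_subset h)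
  rw [setIntegral_eq_integral_of_forall_compl_eq_zero,
    setIntegral_eq_integral_of_forall_compl_eq_zero]
  · exact h.integral_fderiv_smul hφ.contDiff_one hφ.compact (bx i)
  · intro x hx
    rw [image_eq_zero_of_notMem_tsupport (hz x hx), zero_smul]
  · intro x hx
    simp only [partialDeriv]
    rw [image_eq_zero_of_notMem_tsupport (fun h => hz x hx (tsupport_fderiv_subset ℝ h))]
    simp

theorem IsWeakPartial.add_const [CompleteSpace F] {Ω : Set Plane} {i : Fin 2} {f g : Plane → F}
    (h : IsWeakPartial Ω i f g) (c : F) : IsWeakPartial Ω i (fun x => f x + c) g := by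
  refine ⟨h.locInt.add (locallyIntegrable_const c |>.locallyIntegrableOn Ω), h.locInt_deriv,
    fun φ hφ => ?_⟩
  rw [← h.integral_eq φ hφ]
  have hz : ∀ x ∉ Ω, partialDeriv i φ x = 0 := fun x hx => by
    have hx' : x ∉ tsupport φ := fun h => hx (hφ.support_subset h)
    simp only [partialDeriv]
    rw [image_eq_zero_of_notMem_tsupport (fun h => hx' (tsupport_fderiv_subset ℝ h))]
    simp
  have hcont : Continuous (partialDeriv i φ) :=
    (continuous_fderiv_of_C1 hφ.contDiff_one).clm_apply continuous_const
  have hcs : HasCompactSupport (partialDeriv i φ) :=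
    (hφ.compact.fderiv ℝ).comp_left (g := fun a : Plane →L[ℝ] ℝ => a (bx i)) (by simp)
  have hint : ∀ {k : Plane → F}, LocallyIntegrableOn k Ω →
      IntegrableOn (fun x => partialDeriv i φ x • k x) Ω := by
    intro k hk
    have hs : tsupport (partialDeriv i φ) ⊆ tsupport φ := by
      refine closure_minimal (fun x hx => ?_) (isClosed_tsupport _)
      by_contra hx'
      refine hx ?_
      simp only [partialDeriv]
      rw [image_eq_zero_of_notMem_tsupport (fun h => hx' (tsupport_fderiv_subset ℝ h))]
      simp
    have hk' : IntegrableOn k (tsupport (partialDeriv i φ)) :=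
      hk.integrableOn_compact_subset (hs.trans hφ.support_subset) hcs.isCompact
    have h1 : IntegrableOn (fun x => partialDeriv i φ x • k x) (tsupport (partialDeriv i φ)) :=
      hk'.continuousOn_smul hcont.continuousOn hcs.isCompact
    have h2 : Integrable (fun x => partialDeriv i φ x • k x) volume := by
      rw [← integrableOn_iff_integrable_of_support_subset (s := tsupport (partialDeriv i φ))]
      · exact h1
      · exact (Function.support_smul_subset_left _ _).trans (subset_tsupport _)
    exact h2.integrableOn
  simp only [smul_add]
  rw [integral_add (hint h.locInt) (hint (locallyIntegrable_const c |>.locallyIntegrableOn Ω))]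
  have h0 : ∫ x in Ω, partialDeriv i φ x • c = 0 := by
    rw [setIntegral_eq_integral_of_forall_compl_eq_zero (fun x hx => by rw [hz x hx, zero_smul]),
      integral_smul_const]
    have := integral_mul_fderiv_eq_neg_fderiv_mul_of_integrable (μ := volume)
      (f := fun _ : Plane => (1 : ℝ))
      (g := φ) (v := bx i) (by simp) (by
        simp only [one_mul]; exact hcont.integrable_of_hasCompactSupport hcs)
      (by simpa using hφ.smooth.continuous.integrable_of_hasCompactSupport hφ.compact)
      (fun x _ => by fun_prop) (fun x _ => hφ.contDiff_one.differentiable (by simp) x)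
    have h2 : ∫ x, partialDeriv i φ x = 0 := by simpa [bx, partialDeriv] using this
    rw [h2, zero_smul]
  rw [h0, add_zero]

theorem W0.memH1Zero [CompleteSpace F] {Ω : Set Plane} (hΩ : IsOpen Ω) {f : Plane → F}
    {g : Plane → Plane →L[ℝ] F} (h : W0 Ω f g) : MemH1Zero Ω f := by
  obtain ⟨φ, hφ, h1, h2⟩ := h.exists_approx
  have hg : ∀ i, MemLp (fun x => g x (bx i)) 2 volume := fun i =>
    memLp_clm (ContinuousLinearMap.apply ℝ F (bx i)) h.memLp_deriv
  refine ⟨⟨h.memLp.restrict _, fun i => ⟨_, h.isWeakPartial i, (hg i).restrict _⟩⟩, φ, hφ, ?_,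
    fun i => ?_⟩
  · exact tendsto_of_tendsto_of_tendsto_of_le_of_le tendsto_const_nhds h1
      (fun _ => zero_le) fun n => eLpNorm_restrict_le _ _ _ _
  · have hw := (h.isWeakPartial i).ae_unique hΩ (h.isWeakPartial i).weakPartial
    have h3 := tendsto_eLpNorm_clm (ContinuousLinearMap.apply ℝ F (bx i)) h2
    refine tendsto_of_tendsto_of_tendsto_of_le_of_le tendsto_const_nhds h3
      (fun _ => zero_le) fun n => ?_
    refine le_trans (le_of_eq ?_) (eLpNorm_restrict_le _ _ _ Ω)
    refine eLpNorm_congr_ae ?_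
    filter_upwards [hw] with x hx
    simp [← hx, partialDeriv, bx]

end Interface

/-! ### Positivity of the Dirichlet eigenvalue -/

section Eigenvalue

theorem eLpNorm_restrict_eq_of_forall_notMem {E : Type*} [NormedAddCommGroup E] {f : Plane → E}
    {s : Set Plane} {p : ℝ≥0∞} (h : ∀ x ∉ s, f x = 0) :
    eLpNorm f p (volume.restrict s) = eLpNorm f p volume :=
  eLpNorm_restrict_eq_of_support_subset fun x hx => by
    by_contra hxs
    exact hx (h x hxs)

theorem eLpNorm_le_sub_add {α E : Type*} [MeasurableSpace α] [NormedAddCommGroup E]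
    {μ : Measure α} {a b : α → E} (ha : AEStronglyMeasurable a μ) (hb : AEStronglyMeasurable b μ) :
    eLpNorm a 2 μ ≤ eLpNorm (a - b) 2 μ + eLpNorm b 2 μ := by
  have := eLpNorm_add_le (p := 2) (ha.sub hb) hb (by norm_num)
  simpa using this

/-- The Poincaré inequality in `W₀^{1,2}` of a bounded set, from the embedding of `W₀^{1,1}` into
`L²` and the Cauchy–Schwarz inequality. -/
theorem exists_poincare {Ω : Set Plane} (hb : Bornology.IsBounded Ω) :
    ∃ C : ℝ≥0, ∀ (u : Plane → ℝ) (g : Plane → Plane →L[ℝ] ℝ), W0 Ω u g →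
      eLpNorm u 2 volume ≤ C * eLpNorm g 2 volume := by
  have hvol : volume Ω ≠ ⊤ := hb.measure_lt_top.ne
  refine ⟨eLpNormLESNormFDerivOfLeConst ℝ (volume : Measure Plane) Ω 1 2 *
    (volume Ω ^ (1 / 2 : ℝ)).toNNReal, fun u g h => ?_⟩
  obtain ⟨φ, hφ, h1, h2⟩ := h.exists_approx
  set c := eLpNormLESNormFDerivOfLeConst ℝ (volume : Measure Plane) Ω 1 2
  have hcoe : ((volume Ω ^ (1 / 2 : ℝ)).toNNReal : ℝ≥0∞) = volume Ω ^ (1 / 2 : ℝ) :=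
    ENNReal.coe_toNNReal (ENNReal.rpow_ne_top_of_nonneg (by norm_num) hvol)
  have key : ∀ n, eLpNorm (φ n) 2 volume ≤
      (c * (volume Ω ^ (1 / 2 : ℝ)).toNNReal : ℝ≥0) * eLpNorm (fderiv ℝ (φ n)) 2 volume := by
    intro n
    have e1 := eLpNorm_le_eLpNorm_fderiv_of_le (volume : Measure Plane) (hφ n).contDiff_one
      ((subset_tsupport _).trans (hφ n).support_subset) (p := 1) (q := 2) le_rfl
      (by simp) (by simp; norm_num) hb
    have hsupp : ∀ x ∉ Ω, fderiv ℝ (φ n) x = 0 := fun x hx =>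
      image_eq_zero_of_notMem_tsupport
        fun h => hx ((hφ n).support_subset (tsupport_fderiv_subset ℝ h))
    have e2 : eLpNorm (fderiv ℝ (φ n)) 1 volume ≤
        eLpNorm (fderiv ℝ (φ n)) 2 volume * volume Ω ^ (1 / 2 : ℝ) := by
      rw [← eLpNorm_restrict_eq_of_forall_notMem hsupp]
      refine (eLpNorm_le_eLpNorm_mul_rpow_measure_univ (p := 1) (q := 2) (by norm_num)
        (continuous_fderiv_of_C1 (hφ n).contDiff_one).aestronglyMeasurable).trans ?_
      rw [eLpNorm_restrict_eq_of_forall_notMem hsupp]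
      simp
      norm_num
    push_cast
    rw [hcoe, mul_assoc, mul_comm (volume Ω ^ (1 / 2 : ℝ))]
    refine le_trans (by simpa using e1) ?_
    gcongr
  have t1 : eLpNorm u 2 volume ≤ (c * (volume Ω ^ (1 / 2 : ℝ)).toNNReal : ℝ≥0) *
      eLpNorm g 2 volume := by
    set D : ℝ≥0 := c * (volume Ω ^ (1 / 2 : ℝ)).toNNReal
    have hlim : Tendsto (fun n => eLpNorm (φ n - u) 2 volume +
        D * (eLpNorm (fderiv ℝ (φ n) - g) 2 volume + eLpNorm g 2 volume)) atTop
        (𝓝 (D * eLpNorm g 2 volume)) := by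
      have := h1.add (ENNReal.Tendsto.const_mul (a := (D : ℝ≥0∞))
        (h2.add_const (eLpNorm g 2 volume)) (Or.inr ENNReal.coe_ne_top))
      simpa using this
    refine ge_of_tendsto' hlim fun n => ?_
    have mφ := memLp_of_C1 (hφ n).contDiff_one (hφ n).compact
    have mφ' := memLp_fderiv_of_C1 (hφ n).contDiff_one (hφ n).compact
    refine (eLpNorm_le_sub_add h.memLp.1 mφ.1).trans ?_
    rw [eLpNorm_sub_comm]
    gcongr
    refine (key n).trans ?_
    gcongr
    exact eLpNorm_le_sub_add mφ'.1 h.memLp_deriv.1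
  exact t1

theorem integral_norm_sq_eq {α E : Type*} [MeasurableSpace α] [NormedAddCommGroup E]
    {μ : Measure α} {f : α → E} (hf : AEStronglyMeasurable f μ) :
    ∫ x, ‖f x‖ ^ 2 ∂μ = (eLpNorm f 2 μ ^ 2).toReal := by
  have hm : AEStronglyMeasurable (fun x => ‖f x‖ ^ 2) μ := hf.norm.pow 2
  rw [eLpNorm_two_sq,
    integral_eq_lintegral_of_nonneg_ae (Eventually.of_forall fun x => by positivity) hm]
  congr 1
  refine lintegral_congr fun x => ?_
  rw [ENNReal.ofReal_pow (norm_nonneg _), ofReal_norm]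

theorem norm_sq_le_sum {F : Type*} [NormedAddCommGroup F] [NormedSpace ℝ F]
    (a : Plane →L[ℝ] F) : ‖a‖ ^ 2 ≤ ∑ i : Fin 2, ‖a (bx i)‖ ^ 2 := by
  have h : ‖a‖ ≤ √(∑ i : Fin 2, ‖a (bx i)‖ ^ 2) := by
    refine a.opNorm_le_bound (Real.sqrt_nonneg _) fun x => ?_
    have hx : a x = x 0 • a (bx 0) + x 1 • a (bx 1) := by
      have : x = x 0 • bx 0 + x 1 • bx 1 := by
        ext i
        fin_cases i <;> simp [bx]
      conv_lhs => rw [this]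
      simp
    rw [EuclideanSpace.norm_eq, ← Real.sqrt_mul (by positivity)]
    refine Real.le_sqrt_of_sq_le ?_
    have h1 : ‖a x‖ ≤ |x 0| * ‖a (bx 0)‖ + |x 1| * ‖a (bx 1)‖ := by
      rw [hx]
      refine (norm_add_le _ _).trans ?_
      rw [norm_smul, norm_smul]
      rfl
    have h2 : ‖a x‖ ^ 2 ≤ (|x 0| * ‖a (bx 0)‖ + |x 1| * ‖a (bx 1)‖) ^ 2 := by gcongr
    refine h2.trans ?_
    simp only [Fin.sum_univ_two, Real.norm_eq_abs]
    nlinarith [sq_nonneg (|x 0| * ‖a (bx 1)‖ - |x 1| * ‖a (bx 0)‖)]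
  calc ‖a‖ ^ 2 ≤ √(∑ i : Fin 2, ‖a (bx i)‖ ^ 2) ^ 2 := by gcongr
    _ = _ := Real.sq_sqrt (by positivity)

theorem dirichletEigenvalue_pos {Ω : Set Plane} (hΩ : IsOpen Ω) (hb : Bornology.IsBounded Ω)
    (hne : Ω.Nonempty) : 0 < dirichletEigenvalue Ω := by
  obtain ⟨C, hC⟩ := exists_poincare hb
  have hlow : ∀ R ∈ {R : ℝ | ∃ f : Plane → ℝ, MemH1Zero Ω f ∧ (∫ x in Ω, f x ^ 2) ≠ 0 ∧
      R = (∫ x in Ω, gradSq Ω f x) / ∫ x in Ω, f x ^ 2}, ((C : ℝ) ^ 2 + 1)⁻¹ ≤ R := by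
    rintro R ⟨f, hf, hne, rfl⟩
    obtain ⟨u, g, hu, h1, h2, h3, h4⟩ := hf.exists_W0 hΩ
    have e1 : ∫ x in Ω, f x ^ 2 = ∫ x, ‖u x‖ ^ 2 := by
      rw [show ∫ x, ‖u x‖ ^ 2 = ∫ x in Ω, ‖u x‖ ^ 2 from
        (setIntegral_eq_integral_of_forall_compl_eq_zero fun x hx => by simp [h3 x hx]).symm]
      refine integral_congr_ae ?_
      filter_upwards [h1] with x hx
      simp [hx]
    have hgs : Integrable (fun x => ∑ i : Fin 2, ‖g x (bx i)‖ ^ 2) volume :=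
      integrable_finsetSum _ fun i _ =>
        (memLp_clm (ContinuousLinearMap.apply ℝ ℝ (bx i)) hu.memLp_deriv).integrable_norm_pow
          (by norm_num)
    have e2 : ∫ x in Ω, gradSq Ω f x = ∫ x, ∑ i : Fin 2, ‖g x (bx i)‖ ^ 2 := by
      rw [show ∫ x, ∑ i : Fin 2, ‖g x (bx i)‖ ^ 2 = ∫ x in Ω, ∑ i : Fin 2, ‖g x (bx i)‖ ^ 2 from
        (setIntegral_eq_integral_of_forall_compl_eq_zero fun x hx => by simp [h4 x hx]).symm]
      refine integral_congr_ae ?_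
      filter_upwards [h2 0, h2 1] with x h0 h1
      simp [gradSq, Fin.sum_univ_two, h0, h1]
    have e3 : ∫ x, ‖g x‖ ^ 2 ≤ ∫ x, ∑ i : Fin 2, ‖g x (bx i)‖ ^ 2 :=
      integral_mono (hu.memLp_deriv.integrable_norm_pow (by norm_num)) hgs
        fun x => norm_sq_le_sum _
    have e4 : ∫ x, ‖u x‖ ^ 2 ≤ C ^ 2 * ∫ x, ‖g x‖ ^ 2 := by
      rw [integral_norm_sq_eq hu.memLp.1, integral_norm_sq_eq hu.memLp_deriv.1]
      have := pow_le_pow_left' (hC u g hu) 2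
      have h5 := ENNReal.toReal_mono (ENNReal.pow_ne_top
        (ENNReal.mul_ne_top ENNReal.coe_ne_top hu.memLp_deriv.2.ne)) this
      refine h5.trans (le_of_eq ?_)
      simp [mul_pow]
    have hpos : 0 < ∫ x, ‖u x‖ ^ 2 :=
      lt_of_le_of_ne (integral_nonneg fun x => by positivity) (by rw [← e1]; exact hne.symm)
    rw [e1, e2, le_div_iff₀ hpos, inv_mul_le_iff₀ (by positivity)]
    have hg0 : 0 ≤ ∫ x, ‖g x‖ ^ 2 := integral_nonneg fun x => by positivity
    calc _ ≤ _ := e4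
      _ ≤ (C : ℝ) ^ 2 * ∫ x, ∑ i : Fin 2, ‖g x (bx i)‖ ^ 2 := by gcongr
      _ ≤ _ := by nlinarith
  have hnonempty : {R : ℝ | ∃ f : Plane → ℝ, MemH1Zero Ω f ∧ (∫ x in Ω, f x ^ 2) ≠ 0 ∧
      R = (∫ x in Ω, gradSq Ω f x) / ∫ x in Ω, f x ^ 2}.Nonempty := by
    obtain ⟨x, hx⟩ := hne
    obtain ⟨f, hf1, hf2, hf3, -, hf5⟩ := exists_contDiff_tsupport_subset (n := 1) (hΩ.mem_nhds hx)
    have hW := W0.of_contDiff hΩ hf3 hf2 hf1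
    refine ⟨_, f, hW.memH1Zero hΩ, ?_, rfl⟩
    rw [setIntegral_eq_integral_of_forall_compl_eq_zero (fun y hy => by
      rw [image_eq_zero_of_notMem_tsupport fun h => hy (hf1 h)]; simp)]
    have hc : Continuous fun y => f y ^ 2 := hf3.continuous.pow 2
    refine (hc.integral_pos_of_hasCompactSupport_nonneg_nonzero (x := x) ?_
      (fun y => by positivity) ?_).ne'
    · exact hf2.comp_left (g := fun t : ℝ => t ^ 2) (by simp)
    · simp [hf5]
  exact lt_of_lt_of_le (by positivity) (le_csInf hnonempty hlow)

end Eigenvalue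

/-! ### The curl identity for two maps into the sphere -/

section CurlIdentity

/-- The triple product `m · (a × b)`. -/
def jac (m a b : Space) : ℝ := m.ofLp ⬝ᵥ (a.ofLp ⨯₃ b.ofLp)

theorem jac_eq (m a b : Space) : jac m a b = m 0 * (a 1 * b 2 - a 2 * b 1) +
    m 1 * (a 2 * b 0 - a 0 * b 2) + m 2 * (a 0 * b 1 - a 1 * b 0) := by
  simp [jac, cross_apply, dotProduct, Fin.sum_univ_three]

theorem inner_eq_sum (a b : Space) : inner ℝ a b = a 0 * b 0 + a 1 * b 1 + a 2 * b 2 := by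
  simp only [PiLp.inner_apply, Fin.sum_univ_three, RCLike.inner_apply, conj_trivial]
  ring

theorem norm_sq_eq_sum (a : Space) : ‖a‖ ^ 2 = a 0 ^ 2 + a 1 ^ 2 + a 2 ^ 2 := by
  rw [← real_inner_self_eq_norm_sq, inner_eq_sum]
  ring

theorem norm_e₃ : ‖e₃‖ = 1 := by simp [e₃]

/-- Two vectors tangent to the sphere at `m` have a cross product parallel to `m`. -/
theorem cross_of_tangent {m1 m2 m3 a1 a2 a3 b1 b2 b3 : ℝ} (hm : m1 ^ 2 + m2 ^ 2 + m3 ^ 2 = 1)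
    (ha : m1 * a1 + m2 * a2 + m3 * a3 = 0) (hb : m1 * b1 + m2 * b2 + m3 * b3 = 0) :
    a2 * b3 - a3 * b2 = (m1 * (a2 * b3 - a3 * b2) + m2 * (a3 * b1 - a1 * b3) +
      m3 * (a1 * b2 - a2 * b1)) * m1 := by
  linear_combination (-(a2 * b3 - a3 * b2)) * hm + (m2 * b3 - m3 * b2) * ha -
      (m2 * a3 - m3 * a2) * hb

/-- The part of the curl in `curl_identity` that contains one derivative of `m` and one of `n`. Here
`a` is tangent to the sphere at `m`, and `q` at `n`. -/
theorem mixed_tangent_identity {m1 m2 m3 n1 n2 n3 a1 a2 a3 q1 q2 q3 : ℝ}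
    (hm : m1 ^ 2 + m2 ^ 2 + m3 ^ 2 = 1) (hn : n1 ^ 2 + n2 ^ 2 + n3 ^ 2 = 1)
    (ha : m1 * a1 + m2 * a2 + m3 * a3 = 0) (hq : n1 * q1 + n2 * q2 + n3 * q3 = 0) :
    (1 + (m1 * n1 + m2 * n2 + m3 * n3)) *
      (a1 * ((n2 - m2) * q3 - (n3 - m3) * q2) + a2 * ((n3 - m3) * q1 - (n1 - m1) * q3) +
        a3 * ((n1 - m1) * q2 - (n2 - m2) * q1)) =
    ((m2 * n3 - m3 * n2) * q1 + (m3 * n1 - m1 * n3) * q2 + (m1 * n2 - m2 * n1) * q3) *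
      (a1 * n1 + a2 * n2 + a3 * n3) -
    ((m2 * n3 - m3 * n2) * a1 + (m3 * n1 - m1 * n3) * a2 + (m1 * n2 - m2 * n1) * a3) *
      (m1 * q1 + m2 * q2 + m3 * q3) := by
  have h1 : (n2 + m2) * (m1 * n2 - m2 * n1) - (n3 + m3) * (m3 * n1 - m1 * n3) =
      (1 + (m1 * n1 + m2 * n2 + m3 * n3)) * (m1 - n1) := by
    linear_combination m1 * hn - n1 * hm
  have h2 : (n3 + m3) * (m2 * n3 - m3 * n2) - (n1 + m1) * (m1 * n2 - m2 * n1) =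
      (1 + (m1 * n1 + m2 * n2 + m3 * n3)) * (m2 - n2) := by
    linear_combination m2 * hn - n2 * hm
  have h3 : (n1 + m1) * (m3 * n1 - m1 * n3) - (n2 + m2) * (m2 * n3 - m3 * n2) =
      (1 + (m1 * n1 + m2 * n2 + m3 * n3)) * (m3 - n3) := by
    linear_combination m3 * hn - n3 * hm
  linear_combination -(a2 * q3 - a3 * q2) * h1 - (a3 * q1 - a1 * q3) * h2 -
    (a1 * q2 - a2 * q1) * h3
    + ((m2 * n3 - m3 * n2) * q1 + (m3 * n1 - m1 * n3) * q2 + (m1 * n2 - m2 * n1) * q3) * ha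
    - ((m2 * n3 - m3 * n2) * a1 + (m3 * n1 - m1 * n3) * a2 + (m1 * n2 - m2 * n1) * a3) * hq

/-- The pointwise identity behind the homotopy invariance of the degree: with `c = 1 + m · n`, the
curl of `(m × n) · (∇ m + ∇ n) / c` is `n · (∂₁ n × ∂₂ n) - m · (∂₁ m × ∂₂ m)`. Here `a, b` are the
partial derivatives of `m`, and `p, q` those of `n`. -/
theorem curl_identity {m1 m2 m3 n1 n2 n3 a1 a2 a3 b1 b2 b3 p1 p2 p3 q1 q2 q3 c : ℝ}
    (hm : m1 ^ 2 + m2 ^ 2 + m3 ^ 2 = 1) (hn : n1 ^ 2 + n2 ^ 2 + n3 ^ 2 = 1)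
    (ha : m1 * a1 + m2 * a2 + m3 * a3 = 0) (hb : m1 * b1 + m2 * b2 + m3 * b3 = 0)
    (hp : n1 * p1 + n2 * p2 + n3 * p3 = 0) (hq : n1 * q1 + n2 * q2 + n3 * q3 = 0)
    (hc : c = 1 + (m1 * n1 + m2 * n2 + m3 * n3)) (hc0 : c ≠ 0) :
    (((a2 * n3 + m2 * p3 - (a3 * n2 + m3 * p2)) * c - (m2 * n3 - m3 * n2) *
        (a1 * n1 + m1 * p1 + (a2 * n2 + m2 * p2) + (a3 * n3 + m3 * p3))) / c ^ 2 * (b1 + q1) -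
      ((b2 * n3 + m2 * q3 - (b3 * n2 + m3 * q2)) * c - (m2 * n3 - m3 * n2) *
        (b1 * n1 + m1 * q1 + (b2 * n2 + m2 * q2) + (b3 * n3 + m3 * q3))) / c ^ 2 * (a1 + p1)) +
    (((a3 * n1 + m3 * p1 - (a1 * n3 + m1 * p3)) * c - (m3 * n1 - m1 * n3) *
        (a1 * n1 + m1 * p1 + (a2 * n2 + m2 * p2) + (a3 * n3 + m3 * p3))) / c ^ 2 * (b2 + q2) -
      ((b3 * n1 + m3 * q1 - (b1 * n3 + m1 * q3)) * c - (m3 * n1 - m1 * n3) *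
        (b1 * n1 + m1 * q1 + (b2 * n2 + m2 * q2) + (b3 * n3 + m3 * q3))) / c ^ 2 * (a2 + p2)) +
    (((a1 * n2 + m1 * p2 - (a2 * n1 + m2 * p1)) * c - (m1 * n2 - m2 * n1) *
        (a1 * n1 + m1 * p1 + (a2 * n2 + m2 * p2) + (a3 * n3 + m3 * p3))) / c ^ 2 * (b3 + q3) -
      ((b1 * n2 + m1 * q2 - (b2 * n1 + m2 * q1)) * c - (m1 * n2 - m2 * n1) *
        (b1 * n1 + m1 * q1 + (b2 * n2 + m2 * q2) + (b3 * n3 + m3 * q3))) / c ^ 2 * (a3 + p3)) =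
    (n1 * (p2 * q3 - p3 * q2) + n2 * (p3 * q1 - p1 * q3) + n3 * (p1 * q2 - p2 * q1)) -
      (m1 * (a2 * b3 - a3 * b2) + m2 * (a3 * b1 - a1 * b3) + m3 * (a1 * b2 - a2 * b1)) := by
  have e1 := mixed_tangent_identity hm hn ha hq
  have e2 := mixed_tangent_identity hm hn hb hp
  obtain ⟨J, hJ⟩ : ∃ J, J = m1 * (a2 * b3 - a3 * b2) + m2 * (a3 * b1 - a1 * b3) +
      m3 * (a1 * b2 - a2 * b1) := ⟨_, rfl⟩
  obtain ⟨I, hI⟩ : ∃ I, I = n1 * (p2 * q3 - p3 * q2) + n2 * (p3 * q1 - p1 * q3) +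
      n3 * (p1 * q2 - p2 * q1) := ⟨_, rfl⟩
  have A1 : a2 * b3 - a3 * b2 = J * m1 := by rw [hJ]; exact cross_of_tangent hm ha hb
  have A2 : a3 * b1 - a1 * b3 = J * m2 := by
    have := cross_of_tangent (m1 := m2) (m2 := m3) (m3 := m1) (a1 := a2) (a2 := a3) (a3 := a1)
      (b1 := b2) (b2 := b3) (b3 := b1) (by linarith) (by linarith) (by linarith)
    rw [hJ]; linear_combination this
  have A3 : a1 * b2 - a2 * b1 = J * m3 := by
    have := cross_of_tangent (m1 := m3) (m2 := m1) (m3 := m2) (a1 := a3) (a2 := a1) (a3 := a2)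
      (b1 := b3) (b2 := b1) (b3 := b2) (by linarith) (by linarith) (by linarith)
    rw [hJ]; linear_combination this
  have B1 : p2 * q3 - p3 * q2 = I * n1 := by rw [hI]; exact cross_of_tangent hn hp hq
  have B2 : p3 * q1 - p1 * q3 = I * n2 := by
    have := cross_of_tangent (m1 := n2) (m2 := n3) (m3 := n1) (a1 := p2) (a2 := p3) (a3 := p1)
      (b1 := q2) (b2 := q3) (b3 := q1) (by linarith) (by linarith) (by linarith)
    rw [hI]; linear_combination this
  have B3 : p1 * q2 - p2 * q1 = I * n3 := by
    have := cross_of_tangent (m1 := n3) (m2 := n1) (m3 := n2) (a1 := p3) (a2 := p1) (a3 := p2)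
      (b1 := q3) (b2 := q1) (b3 := q2) (by linarith) (by linarith) (by linarith)
    rw [hI]; linear_combination this
  rw [← hJ, ← hI]
  rw [← hc] at e1 e2
  obtain ⟨s, hs⟩ : ∃ s, s = m1 * n1 + m2 * n2 + m3 * n3 := ⟨_, rfl⟩
  have hcs : c = 1 + s := by rw [hc, hs]
  -- the four parts of the curl, according to which of `∇ m`, `∇ n` enter
  have P1 : (a2 * n3 - a3 * n2) * b1 - (b2 * n3 - b3 * n2) * a1 +
      ((a3 * n1 - a1 * n3) * b2 - (b3 * n1 - b1 * n3) * a2) +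
      ((a1 * n2 - a2 * n1) * b3 - (b1 * n2 - b2 * n1) * a3) = -2 * s * J := by
    rw [hs]
    linear_combination (-2 * n1) * A1 + (-2 * n2) * A2 + (-2 * n3) * A3
  have P2 : (m2 * p3 - m3 * p2) * q1 - (m2 * q3 - m3 * q2) * p1 +
      ((m3 * p1 - m1 * p3) * q2 - (m3 * q1 - m1 * q3) * p2) +
      ((m1 * p2 - m2 * p1) * q3 - (m1 * q2 - m2 * q1) * p3) = 2 * s * I := by
    rw [hs]
    linear_combination (2 * m1) * B1 + (2 * m2) * B2 + (2 * m3) * B3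
  have P3 : ((m2 * n3 - m3 * n2) * b1 + (m3 * n1 - m1 * n3) * b2 + (m1 * n2 - m2 * n1) * b3) *
      (a1 * n1 + a2 * n2 + a3 * n3) -
      ((m2 * n3 - m3 * n2) * a1 + (m3 * n1 - m1 * n3) * a2 + (m1 * n2 - m2 * n1) * a3) *
      (b1 * n1 + b2 * n2 + b3 * n3) = (1 - s ^ 2) * J := by
    rw [hs]
    linear_combination (n2 * (m1 * n2 - m2 * n1) - n3 * (m3 * n1 - m1 * n3)) * A1 +
      (n3 * (m2 * n3 - m3 * n2) - n1 * (m1 * n2 - m2 * n1)) * A2 +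
      (n1 * (m3 * n1 - m1 * n3) - n2 * (m2 * n3 - m3 * n2)) * A3 +
      J * (m1 ^ 2 + m2 ^ 2 + m3 ^ 2) * hn + J * hm
  have P4 : ((m2 * n3 - m3 * n2) * q1 + (m3 * n1 - m1 * n3) * q2 + (m1 * n2 - m2 * n1) * q3) *
      (m1 * p1 + m2 * p2 + m3 * p3) -
      ((m2 * n3 - m3 * n2) * p1 + (m3 * n1 - m1 * n3) * p2 + (m1 * n2 - m2 * n1) * p3) *
      (m1 * q1 + m2 * q2 + m3 * q3) = -(1 - s ^ 2) * I := by
    rw [hs]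
    linear_combination (m2 * (m1 * n2 - m2 * n1) - m3 * (m3 * n1 - m1 * n3)) * B1 +
      (m3 * (m2 * n3 - m3 * n2) - m1 * (m1 * n2 - m2 * n1)) * B2 +
      (m1 * (m3 * n1 - m1 * n3) - m2 * (m2 * n3 - m3 * n2)) * B3 -
      I * (m1 ^ 2 + m2 ^ 2 + m3 ^ 2) * hn - I * hm
  have hc2 : c ^ 2 ≠ 0 := pow_ne_zero 2 hc0
  simp only [div_mul_eq_mul_div, ← sub_div, ← add_div]
  rw [div_eq_iff hc2]
  linear_combination c * P1 + c * P2 - P3 - P4 + e1 - e2 - (I - J) * (c + 1 - s) * hcs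

end CurlIdentity

/-! ### The degree of maps at most a right angle apart -/

section Degree

theorem fderiv_apply_of_hasDerivAt {E F : Type*} [NormedAddCommGroup E] [NormedSpace ℝ E]
    [NormedAddCommGroup F] [NormedSpace ℝ F] {Φ : E → F} {x v : E} {L : F}
    (hΦ : DifferentiableAt ℝ Φ x) (h : HasDerivAt (fun t : ℝ => Φ (x + t • v)) L 0) :
    fderiv ℝ Φ x v = L := by
  rw [← hΦ.lineDeriv_eq_fderiv]
  exact h.deriv

theorem W0.congr_ae {F : Type*} [NormedAddCommGroup F] [NormedSpace ℝ F] {Ω : Set Plane}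
    {f f' : Plane → F} {g : Plane → Plane →L[ℝ] F}
    (h : W0 Ω f g) (hf' : StronglyMeasurable f') (he : f =ᵐ[volume] f') : W0 Ω f' g := by
  obtain ⟨φ, hφ, h1, h2⟩ := h.exists_approx
  refine ⟨hf', h.meas_deriv, φ, hφ, h1.congr fun n => eLpNorm_congr_ae ?_, h2⟩
  filter_upwards [he] with x hx
  simp [hx]

/-- The gradient of a sphere-valued map is tangent to the sphere, by the chain rule for
`y ↦ |y - e₃|² - 1`. -/
theorem W0.tangent {Ω : Set Plane} (hΩ : IsOpen Ω) {u : Plane → Space}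
    {g : Plane → Plane →L[ℝ] Space} (h : W0 Ω u g) (hu : ∀ x, ‖u x - e₃‖ = 1) :
    ∀ᵐ x, ∀ v, inner ℝ (u x - e₃) (g x v) = 0 := by
  let Φ : Space → ℝ := fun y => ‖y - e₃‖ ^ 2 - 1
  have hΦ : ContDiff ℝ 1 Φ := ((contDiff_id.sub contDiff_const).norm_sq ℝ).sub contDiff_const
  have hK : IsCompact (Metric.sphere e₃ 1) := isCompact_sphere _ _
  have h1 := h.comp_of_mem hΩ hK isOpen_univ (Set.subset_univ _) (Φ := Φ) hΦ.contDiffOn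
    (fun x => by simpa [dist_eq_norm] using hu x) (by simp [norm_e₃])
    (by simp [Φ, norm_e₃])
  have h2 : W0 Ω (fun x => Φ (u x)) (fun _ => 0) := by
    have : (fun x => Φ (u x)) = fun _ => 0 := by
      ext x
      simp [Φ, hu]
    rw [this]
    have := W0.of_contDiff hΩ (f := fun _ : Plane => (0 : ℝ)) contDiff_const
      HasCompactSupport.zero (by simp [tsupport])
    convert this using 1
    ext1 x
    simp
  filter_upwards [h1.deriv_unique h2] with x hx v
  have e : HasFDerivAt Φ (2 • innerSL ℝ (u x - e₃)) (u x) := by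
    have := ((hasFDerivAt_id (𝕜 := ℝ) (u x)).sub_const e₃).norm_sq.sub_const (1 : ℝ)
    simpa [Φ] using this
  have := DFunLike.congr_fun hx v
  rw [e.fderiv] at this
  simpa [inner_sub_left] using this

/-- The coordinate `(m × n)_j / (1 + m · n)` of the homotopy one-form, with
`m = p.1 - e₃`, `n = p.2 - e₃` and `(i, k)` the two indices following `j` cyclically. -/
def homotopyCoeff (i k : Fin 3) (p : Space × Space) : ℝ :=
  ((p.1 - e₃) i * (p.2 - e₃) k - (p.1 - e₃) k * (p.2 - e₃) i) /
    (1 + ((p.1 - e₃) 0 * (p.2 - e₃) 0 + (p.1 - e₃) 1 * (p.2 - e₃) 1 +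
      (p.1 - e₃) 2 * (p.2 - e₃) 2))

theorem contDiffOn_homotopyCoeff (i k : Fin 3) : ContDiffOn ℝ 1 (homotopyCoeff i k)
    {p | 0 < 1 + inner ℝ (p.1 - e₃) (p.2 - e₃)} := by
  have hc : ∀ j, ContDiff ℝ 1 (fun p : Space × Space => (p.1 - e₃) j) := fun j =>
    (EuclideanSpace.proj (𝕜 := ℝ) j).contDiff.comp (contDiff_fst.sub contDiff_const)
  have hc' : ∀ j, ContDiff ℝ 1 (fun p : Space × Space => (p.2 - e₃) j) := fun j =>
    (EuclideanSpace.proj (𝕜 := ℝ) j).contDiff.comp (contDiff_snd.sub contDiff_const)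
  refine ContDiffOn.div (((hc i).mul (hc' k)).sub ((hc k).mul (hc' i))).contDiffOn
    (contDiff_const.add ((((hc 0).mul (hc' 0)).add ((hc 1).mul (hc' 1))).add
      ((hc 2).mul (hc' 2)))).contDiffOn fun p hp => ?_
  have : 0 < 1 + inner ℝ (p.1 - e₃) (p.2 - e₃) := hp
  rw [inner_eq_sum] at this
  exact this.ne'

theorem isOpen_inner_pos :
    IsOpen {p : Space × Space | 0 < 1 + inner ℝ (p.1 - e₃) (p.2 - e₃)} :=
  isOpen_lt continuous_const (by fun_prop)

theorem fderiv_homotopyCoeff (i k : Fin 3) {p : Space × Space}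
    (hp : 0 < 1 + inner ℝ (p.1 - e₃) (p.2 - e₃)) (m n : Space) (hm : m = p.1 - e₃)
    (hn : n = p.2 - e₃) (a q : Space) {c : ℝ} (hc : c = 1 + (m 0 * n 0 + m 1 * n 1 + m 2 * n 2)) :
    fderiv ℝ (homotopyCoeff i k) p (a, q) =
      ((a i * n k + m i * q k - (a k * n i + m k * q i)) * c - (m i * n k - m k * n i) *
        (a 0 * n 0 + m 0 * q 0 + (a 1 * n 1 + m 1 * q 1) + (a 2 * n 2 + m 2 * q 2))) / c ^ 2 := by
  have hd : DifferentiableAt ℝ (homotopyCoeff i k) p :=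
    ((contDiffOn_homotopyCoeff i k).contDiffAt (isOpen_inner_pos.mem_nhds hp)).differentiableAt
      (by simp)
  refine fderiv_apply_of_hasDerivAt hd ?_
  have hm' : ∀ j, HasDerivAt (fun t : ℝ => m j + t * a j) (a j) 0 := fun j => by
    simpa using ((hasDerivAt_id (0 : ℝ)).mul_const (a j)).const_add (m j)
  have hn' : ∀ j, HasDerivAt (fun t : ℝ => n j + t * q j) (q j) 0 := fun j => by
    simpa using ((hasDerivAt_id (0 : ℝ)).mul_const (q j)).const_add (n j)
  have hpos : 1 + ((m 0 + 0 * a 0) * (n 0 + 0 * q 0) + (m 1 + 0 * a 1) * (n 1 + 0 * q 1) +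
      (m 2 + 0 * a 2) * (n 2 + 0 * q 2)) ≠ 0 := by
    rw [inner_eq_sum, ← hm, ← hn] at hp
    simpa using hp.ne'
  have h1 := (((hm' i).mul (hn' k)).sub ((hm' k).mul (hn' i))).div
    (((((hm' 0).mul (hn' 0)).add ((hm' 1).mul (hn' 1))).add ((hm' 2).mul (hn' 2))).const_add 1)
    hpos
  refine (h1.congr_deriv ?_).congr_of_eventuallyEq (Eventually.of_forall fun t => ?_)
  · rw [hc]
    simp
  · simp only [homotopyCoeff, Prod.fst_add, Prod.snd_add, Prod.smul_fst, Prod.smul_snd, hm, hn,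
      PiLp.sub_apply, PiLp.add_apply, PiLp.smul_apply, smul_eq_mul, Pi.mul_apply, Pi.sub_apply,
      Pi.add_apply, Pi.div_apply]
    congr 1 <;> ring

/-- The integral `∫ m · (∂₁ m × ∂₂ m)` for `m = u - e₃`, where `g` is the gradient of `u`. -/
def degInt (u : Plane → Space) (g : Plane → Plane →L[ℝ] Space) : ℝ :=
  ∫ x, jac (u x - e₃) (g x (bx 0)) (g x (bx 1))

theorem aestronglyMeasurable_jac {μ : Measure Plane} {a b c : Plane → Space}
    (ha : AEStronglyMeasurable a μ) (hb : AEStronglyMeasurable b μ)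
    (hc : AEStronglyMeasurable c μ) : AEStronglyMeasurable (fun x => jac (a x) (b x) (c x)) μ := by
  have hcont : Continuous (fun p : Space × Space × Space => jac p.1 p.2.1 p.2.2) := by
    simp only [jac_eq]
    fun_prop
  exact hcont.comp_aestronglyMeasurable (ha.prodMk (hb.prodMk hc))

theorem abs_coord_le (a : Space) (i : Fin 3) : |a i| ≤ ‖a‖ := by
  simpa using PiLp.norm_apply_le a i

theorem abs_jac_le (m a b : Space) : |jac m a b| ≤ 6 * ‖m‖ * (‖a‖ * ‖b‖) := by
  rw [jac_eq]
  have hp : ∀ i j k, |m i * (a j * b k)| ≤ ‖m‖ * (‖a‖ * ‖b‖) := fun i j k => by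
    rw [abs_mul, abs_mul]
    gcongr <;> exact abs_coord_le _ _
  have h1 := hp 0 1 2
  have h2 := hp 0 2 1
  have h3 := hp 1 2 0
  have h4 := hp 1 0 2
  have h5 := hp 2 0 1
  have h6 := hp 2 1 0
  rw [abs_le] at *
  constructor <;> nlinarith

theorem memLp_deriv_apply {Ω : Set Plane} {F : Type*} [NormedAddCommGroup F] [NormedSpace ℝ F]
    {u : Plane → F} {g : Plane → Plane →L[ℝ] F} (h : W0 Ω u g) (v : Plane) :
    MemLp (fun x => g x v) 2 volume :=
  memLp_clm (ContinuousLinearMap.apply ℝ F v) h.memLp_deriv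

theorem integrable_jac {Ω : Set Plane} {u : Plane → Space} {g : Plane → Plane →L[ℝ] Space}
    (h : W0 Ω u g) (hu : ∀ x, ‖u x - e₃‖ = 1) :
    Integrable (fun x => jac (u x - e₃) (g x (bx 0)) (g x (bx 1))) volume := by
  have h0 := memLp_deriv_apply h (bx 0)
  have h1 := memLp_deriv_apply h (bx 1)
  have hint : Integrable (fun x => ‖g x (bx 0)‖ * ‖g x (bx 1)‖) volume :=
    memLp_bilin_integrable (ContinuousLinearMap.mul ℝ ℝ) h0.norm h1.norm
  refine (hint.const_mul 6).mono' (aestronglyMeasurable_jac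
    (h.meas.aestronglyMeasurable.sub aestronglyMeasurable_const) h0.1 h1.1)
    (Eventually.of_forall fun x => ?_)
  have := abs_jac_le (u x - e₃) (g x (bx 0)) (g x (bx 1))
  rw [hu] at this
  simpa using this

/-- Two sphere-valued `W^{1,2}` maps with the same boundary values have the same degree as soon as
they are nowhere more than a right angle apart. By `curl_identity` the difference of the degree
densities is a sum of Jacobians of scalar functions. -/
theorem degInt_eq_of_inner_nonneg {Ω : Set Plane} (hΩ : IsOpen Ω) {u v : Plane → Space}
    {g k : Plane → Plane →L[ℝ] Space} (hu : W0 Ω u g) (hv : W0 Ω v k)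
    (hu1 : ∀ x, ‖u x - e₃‖ = 1) (hv1 : ∀ x, ‖v x - e₃‖ = 1)
    (huv : ∀ x, 0 ≤ inner ℝ (u x - e₃) (v x - e₃)) : degInt u g = degInt v k := by
  -- On this compact set `1 + m · n ≥ 1`, so the coefficients of the one-form are smooth near it.
  let K : Set (Space × Space) := (Metric.sphere e₃ 1 ×ˢ Metric.sphere e₃ 1) ∩
    {p | 0 ≤ inner ℝ (p.1 - e₃) (p.2 - e₃)}
  have hK : IsCompact K := ((isCompact_sphere _ _).prod (isCompact_sphere _ _)).inter_right
    (isClosed_le continuous_const (by fun_prop))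
  have hKV : K ⊆ {p : Space × Space | 0 < 1 + inner ℝ (p.1 - e₃) (p.2 - e₃)} := fun p hp => by
    have := hp.2
    simp only [Set.mem_ofPred_eq] at this ⊢
    linarith
  have hmem : ∀ x, (u x, v x) ∈ K := fun x =>
    ⟨⟨by simpa [dist_eq_norm] using hu1 x, by simpa [dist_eq_norm] using hv1 x⟩, huv x⟩
  have h0K : (0 : Space × Space) ∈ K := by
    refine ⟨by simp [norm_e₃], ?_⟩
    simp only [Set.mem_ofPred_eq, Prod.fst_zero, Prod.snd_zero]
    exact real_inner_self_nonneg
  have hβ : ∀ i j, W0 Ω (fun x => homotopyCoeff i j (u x, v x))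
      (fun x => (fderiv ℝ (homotopyCoeff i j) (u x, v x)).comp ((g x).prod (k x))) := fun i j =>
    (hu.prodMk hΩ hv).comp_of_mem hΩ hK isOpen_inner_pos hKV (contDiffOn_homotopyCoeff i j) hmem
      h0K (by simp [homotopyCoeff, mul_comm])
  have hγ : ∀ i : Fin 3, W0 Ω (fun x => EuclideanSpace.proj (𝕜 := ℝ) i (u x + v x))
      (fun x => (EuclideanSpace.proj (𝕜 := ℝ) i).comp (g x + k x)) := fun i =>
    (hu.add hv).clm_comp hΩ _
  have hint : ∀ {b c : Plane → ℝ} {b' c' : Plane → Plane →L[ℝ] ℝ}, W0 Ω b b' → W0 Ω c c' →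
      Integrable (fun x => b' x (bx 0) * c' x (bx 1) - b' x (bx 1) * c' x (bx 0)) volume :=
    fun hb hc => (memLp_bilin_integrable (ContinuousLinearMap.mul ℝ ℝ)
      (memLp_deriv_apply hb _) (memLp_deriv_apply hc _)).sub
      (memLp_bilin_integrable (ContinuousLinearMap.mul ℝ ℝ)
      (memLp_deriv_apply hb _) (memLp_deriv_apply hc _))
  have hsum := integral_add ((hint (hβ 1 2) (hγ 0)).add (hint (hβ 2 0) (hγ 1)))
    (hint (hβ 0 1) (hγ 2))
  have hsum' := integral_add (hint (hβ 1 2) (hγ 0)) (hint (hβ 2 0) (hγ 1))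
  simp only [Pi.add_apply] at hsum hsum'
  rw [hsum', (hβ 1 2).integral_jacobian (hγ 0), (hβ 2 0).integral_jacobian (hγ 1),
    (hβ 0 1).integral_jacobian (hγ 2)] at hsum
  have hz : ∫ x, (jac (v x - e₃) (k x (bx 0)) (k x (bx 1)) -
      jac (u x - e₃) (g x (bx 0)) (g x (bx 1))) = 0 := by
    refine (integral_congr_ae ?_).trans (hsum.trans (by simp))
    filter_upwards [hu.tangent hΩ hu1, hv.tangent hΩ hv1] with x h1 h2
    have n1 := hu1 x
    have n2 := hv1 x
    have i1 := hKV (hmem x)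
    have a0 := h1 (bx 0)
    have a1 := h1 (bx 1)
    have b0 := h2 (bx 0)
    have b1 := h2 (bx 1)
    rw [inner_eq_sum] at a0 a1 b0 b1
    have n1' : (u x - e₃) 0 ^ 2 + (u x - e₃) 1 ^ 2 + (u x - e₃) 2 ^ 2 = 1 := by
      rw [← norm_sq_eq_sum, n1, one_pow]
    have n2' : (v x - e₃) 0 ^ 2 + (v x - e₃) 1 ^ 2 + (v x - e₃) 2 ^ 2 = 1 := by
      rw [← norm_sq_eq_sum, n2, one_pow]
    have hpos : 0 < 1 + inner ℝ (u x - e₃) (v x - e₃) := i1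
    rw [jac_eq, jac_eq]
    refine Eq.trans (curl_identity n1' n2' a0 a1 b0 b1 rfl
      (by rw [inner_eq_sum] at hpos; exact hpos.ne')).symm ?_
    have pr : ∀ (i : Fin 3) (y : Space), EuclideanSpace.proj (𝕜 := ℝ) i y = y i := fun _ _ => rfl
    simp only [ContinuousLinearMap.comp_apply, ContinuousLinearMap.prod_apply,
      add_apply, pr, PiLp.add_apply]
    rw [fderiv_homotopyCoeff 1 2 i1 _ _ rfl rfl _ _ rfl,
      fderiv_homotopyCoeff 2 0 i1 _ _ rfl rfl _ _ rfl,
      fderiv_homotopyCoeff 0 1 i1 _ _ rfl rfl _ _ rfl,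
      fderiv_homotopyCoeff 1 2 i1 _ _ rfl rfl _ _ rfl,
      fderiv_homotopyCoeff 2 0 i1 _ _ rfl rfl _ _ rfl,
      fderiv_homotopyCoeff 0 1 i1 _ _ rfl rfl _ _ rfl]
  rw [integral_sub (integrable_jac hv hv1) (integrable_jac hu hu1)] at hz
  unfold degInt
  linarith

end Degree

/-! ### Admissible maps on the whole plane -/

section Reduction

/-- The energy density in terms of `u = m + e₃` at a point and its gradient `a` there. -/
def enDens (κ Q : ℝ) (u : Space) (a : Plane →L[ℝ] Space) : ℝ :=
  ∑ i : Fin 2, ‖a (bx i)‖ ^ 2 - 2 * κ * (u 0 * a (bx 0) 2 + u 1 * a (bx 1) 2) +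
    (Q - 1) * (u 0 ^ 2 + u 1 ^ 2)

theorem MemLp.coord {μ : Measure Plane} {f : Plane → Space} (h : MemLp f 2 μ) (i : Fin 3) :
    MemLp (fun x => f x i) 2 μ := memLp_clm (EuclideanSpace.proj (𝕜 := ℝ) i) h

theorem integrable_enDens {Ω : Set Plane} {u : Plane → Space} {g : Plane → Plane →L[ℝ] Space}
    (h : W0 Ω u g) (κ Q : ℝ) : Integrable (fun x => enDens κ Q (u x) (g x)) volume := by
  have hu := h.memLp
  have hg := fun i => memLp_deriv_apply h (bx i)
  have i1 : Integrable (fun x => ∑ i : Fin 2, ‖g x (bx i)‖ ^ 2) volume :=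
    integrable_finsetSum _ fun i _ => (hg i).integrable_norm_pow (by norm_num)
  have i2 : ∀ i : Fin 3, ∀ j : Fin 2, Integrable (fun x => u x i * g x (bx j) 2) volume :=
    fun i j => memLp_bilin_integrable (ContinuousLinearMap.mul ℝ ℝ) (MemLp.coord hu i)
      (MemLp.coord (hg j) 2)
  have i3 : ∀ i : Fin 3, Integrable (fun x => u x i ^ 2) volume := fun i => by
    simpa using (MemLp.coord hu i).integrable_norm_pow (p := 2) (by norm_num)
  exact (i1.sub (((i2 0 0).add (i2 1 1)).const_mul _)).add (((i3 0).add (i3 1)).const_mul _)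

/-- An admissible map is represented by a function in `W₀^{1,2}` with `|u - e₃| = 1` everywhere, not
just almost everywhere. -/
theorem exists_of_mem_admissible {Ω : Set Plane} (hΩ : IsOpen Ω) {d : ℤ} {m : Plane → Space}
    (hm : m ∈ admissible Ω d) :
    ∃ (u : Plane → Space) (g : Plane → Plane →L[ℝ] Space), W0 Ω u g ∧ (∀ x, ‖u x - e₃‖ = 1) ∧
      (∀ᵐ x ∂(volume.restrict Ω), u x = m x + e₃) ∧
      (∀ i, ∀ᵐ x ∂(volume.restrict Ω), g x (bx i) = weakPartial Ω i m x) := by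
  obtain ⟨h1, h2, h3, h4⟩ := hm
  obtain ⟨u, g, hu, e1, e2, z1, z2⟩ := h3.exists_W0 hΩ
  have hae : ∀ᵐ x, ‖u x - e₃‖ = 1 := by
    have e3 : ∀ᵐ x ∂(volume.restrict Ω), ‖u x - e₃‖ = 1 := by
      filter_upwards [h2, e1] with x hx hx'
      rw [hx']
      simpa using hx
    rw [ae_restrict_iff' hΩ.measurableSet] at e3
    filter_upwards [e3] with x hx
    by_cases hxΩ : x ∈ Ω
    · exact hx hxΩ
    · simp [z1 x hxΩ, norm_e₃]
  have hS : MeasurableSet {x | ‖u x - e₃‖ = 1} :=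
    ((hu.meas.sub stronglyMeasurable_const).norm.measurable) (measurableSet_singleton 1)
  set S := {x | ‖u x - e₃‖ = 1} with hSdef
  have hSu : u =ᵐ[volume] S.indicator u := by
    filter_upwards [hae] with x hx
    exact (Set.indicator_of_mem (show x ∈ S from hx) u).symm
  refine ⟨S.indicator u, g, hu.congr_ae (hu.meas.indicator hS) hSu, fun x => ?_, ?_, fun i => ?_⟩
  · by_cases hx : x ∈ S
    · rw [Set.indicator_of_mem hx]; exact hx
    · rw [Set.indicator_of_notMem hx]; simp [norm_e₃]
  · filter_upwards [e1, ae_restrict_of_ae hSu] with x hx hx'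
    rw [← hx', hx]
  · obtain ⟨k, hk, -⟩ := h1.exists_deriv i
    have hw := hk.weakPartial.add_const e₃
    filter_upwards [e2 i, hw.ae_unique hΩ hw.weakPartial] with x hx hx'
    rw [hx, hx']

/-- A sphere-valued map given by `u = m + e₃` on the whole plane, `u` in `W₀^{1,2}(Ω)` with
gradient `g`. -/
structure SphereMap (Ω : Set Plane) (u : Plane → Space) (g : Plane → Plane →L[ℝ] Space) :
    Prop where
  w0 : W0 Ω u g
  unit : ∀ x, ‖u x - e₃‖ = 1

theorem integral_eq_setIntegral_of_W0 {Ω : Set Plane} {u : Plane → Space}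
    {g : Plane → Plane →L[ℝ] Space} (h : W0 Ω u g) {Θ : Space → (Plane →L[ℝ] Space) → ℝ}
    (h0 : Θ 0 0 = 0) : ∫ x, Θ (u x) (g x) = ∫ x in Ω, Θ (u x) (g x) := by
  symm
  refine setIntegral_eq_integral_of_ae_compl_eq_zero ?_
  filter_upwards [h.ae_eq_zero_compl] with x hx hxΩ
  rw [(hx hxΩ).1, (hx hxΩ).2, h0]

/-- Degree and energy of a map in `Ω` as integrals over the plane. The integrands vanish
outside `Ω`, because `u` and `g` do. -/
theorem degInt_and_energy_of_ae {Ω : Set Plane} {m u : Plane → Space}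
    {g : Plane → Plane →L[ℝ] Space} (h : W0 Ω u g)
    (h1 : ∀ᵐ x ∂(volume.restrict Ω), u x = m x + e₃)
    (h2 : ∀ i, ∀ᵐ x ∂(volume.restrict Ω), g x (bx i) = weakPartial Ω i m x) :
    degree Ω m = 1 / (4 * Real.pi) * degInt u g ∧
      ∀ κ Q, energy Ω Q κ m = ∫ x, enDens κ Q (u x) (g x) := by
  constructor
  · unfold degree degInt
    rw [integral_eq_setIntegral_of_W0 h
      (Θ := fun y a => jac (y - e₃) (a (bx 0)) (a (bx 1))) (by simp [jac])]
    congr 1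
    refine integral_congr_ae ?_
    filter_upwards [h1, h2 0, h2 1] with x e1 e2 e3
    rw [e1, e2, e3]
    simp [jac]
  · intro κ Q
    unfold energy
    rw [integral_eq_setIntegral_of_W0 h (Θ := fun y a => enDens κ Q y a) (by simp [enDens])]
    refine integral_congr_ae ?_
    filter_upwards [h1, h2 0, h2 1] with x e1 e2 e3
    simp only [enDens, gradSq, dmiDensity, Fin.sum_univ_two]
    rw [e1, e2, e3]
    simp [e₃]

/-- Sphere-valued maps on the plane of the right degree restrict to admissible ones. -/
theorem SphereMap.mem_admissible {Ω : Set Plane} (hΩ : IsOpen Ω) (hb : Bornology.IsBounded Ω)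
    {u : Plane → Space}
    {g : Plane → Plane →L[ℝ] Space} (h : SphereMap Ω u g) {d : ℤ}
    (hd : degInt u g = 4 * Real.pi * d) :
    (fun x => u x - e₃) ∈ admissible Ω d ∧
      ∀ κ Q, energy Ω Q κ (fun x => u x - e₃) = ∫ x, enDens κ Q (u x) (g x) := by
  have hw : ∀ i, IsWeakPartial Ω i (fun x => u x - e₃) (fun x => g x (bx i)) := fun i => by
    simpa [sub_eq_add_neg] using (h.w0.isWeakPartial i).add_const (-e₃)
  have e2 : ∀ i, ∀ᵐ x ∂(volume.restrict Ω), g x (bx i) = weakPartial Ω i (fun x => u x - e₃) x :=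
    fun i => (hw i).ae_unique hΩ (hw i).weakPartial
  have hfin : IsFiniteMeasure (volume.restrict Ω) :=
    ⟨by rw [Measure.restrict_apply_univ]; exact hb.measure_lt_top⟩
  obtain ⟨r1, r2⟩ := degInt_and_energy_of_ae (m := fun x => u x - e₃) h.w0
    (Eventually.of_forall fun x => by simp) e2
  refine ⟨⟨⟨(h.w0.memLp.restrict Ω).sub (memLp_const e₃), fun i => ⟨_, hw i,
    (memLp_deriv_apply h.w0 (bx i)).restrict Ω⟩⟩, Eventually.of_forall h.unit, ?_, ?_⟩, r2⟩
  · simpa using h.w0.memH1Zero hΩ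
  · rw [r1, hd]
    field_simp

end Reduction

/-! ### The uniform measure on the unit disc -/

section Averages

variable {E E' : Type*} [NormedAddCommGroup E] [NormedSpace ℝ E]
  [NormedAddCommGroup E'] [NormedSpace ℝ E']

/-- The uniform probability measure on the unit disc. -/
def unifBall : Measure Plane :=
  (volume (Metric.ball (0 : Plane) 1))⁻¹ • volume.restrict (Metric.ball 0 1)

instance : IsProbabilityMeasure unifBall := ⟨by
  simp only [unifBall, Measure.smul_apply, Measure.restrict_apply_univ, smul_eq_mul]
  exact ENNReal.inv_mul_cancel (Metric.measure_ball_pos _ _ one_pos).ne' measure_ball_lt_top.ne⟩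

theorem ae_unifBall : ∀ᵐ w ∂unifBall, w ∈ Metric.ball (0 : Plane) 1 :=
  Measure.ae_smul_measure (ae_restrict_mem Metric.isOpen_ball.measurableSet) _

theorem inv_volume_ball_le_one : (volume (Metric.ball (0 : Plane) 1))⁻¹ ≤ 1 := by
  rw [ENNReal.inv_le_one, EuclideanSpace.volume_ball_fin_two]
  simp only [ENNReal.ofReal_one, one_pow, one_mul]
  have h : (1 : ℝ) ≤ Real.pi := by linarith [Real.pi_gt_three]
  simpa using h

theorem lintegral_ball_comp (F : Plane → ℝ≥0∞) (z : Plane) {t : ℝ} (ht : 0 < t) :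
    ∫⁻ y in Metric.ball z t, F y =
      ENNReal.ofReal (t ^ 2) * ∫⁻ w in Metric.ball (0 : Plane) 1, F (z + t • w) := by
  have him : (fun w : Plane => z + t • w) '' Metric.ball 0 1 = Metric.ball z t := by
    rw [← affinity_unitBall ht z]
    ext y
    simp [Set.mem_image, Set.mem_vadd_set, Set.mem_smul_set]
  have hd : ∀ w ∈ Metric.ball (0 : Plane) 1, HasFDerivWithinAt (fun w : Plane => z + t • w)
      (t • ContinuousLinearMap.id ℝ Plane) (Metric.ball 0 1) w := fun w _ =>
    (((hasFDerivAt_id w).const_smul t).const_add z).hasFDerivWithinAt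
  have hinj : Set.InjOn (fun w : Plane => z + t • w) (Metric.ball 0 1) := fun a _ b _ hab => by
    have : t • a = t • b := add_left_cancel hab
    exact smul_right_injective _ ht.ne' this
  rw [← him, lintegral_image_eq_lintegral_abs_det_fderiv_mul volume
    Metric.isOpen_ball.measurableSet hd hinj]
  have hdet : (t • ContinuousLinearMap.id ℝ Plane).det = t ^ 2 := by
    rw [ContinuousLinearMap.det, ContinuousLinearMap.toLinearMap_smul, LinearMap.det_smul]
    simp
  simp only [hdet]
  rw [lintegral_const_mul' _ _ ENNReal.ofReal_ne_top, abs_of_nonneg (by positivity)]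

theorem lintegral_unifBall (F : Plane → ℝ≥0∞) :
    ∫⁻ w, F w ∂unifBall =
      (volume (Metric.ball (0 : Plane) 1))⁻¹ * ∫⁻ w in Metric.ball (0 : Plane) 1, F w := by
  rw [unifBall, lintegral_smul_measure, smul_eq_mul]

theorem lintegral_unifBall_comp (F : Plane → ℝ≥0∞) (z : Plane) {t : ℝ} (ht : 0 < t) :
    ENNReal.ofReal (t ^ 2) * ∫⁻ w, F (z + t • w) ∂unifBall =
      (volume (Metric.ball (0 : Plane) 1))⁻¹ * ∫⁻ y in Metric.ball z t, F y := by
  rw [lintegral_unifBall, lintegral_ball_comp F z ht]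
  ring

theorem lintegral_unifBall_comp_le (F : Plane → ℝ≥0∞) (z : Plane) {t : ℝ} (ht : 0 < t) :
    ENNReal.ofReal (t ^ 2) * ∫⁻ w, F (z + t • w) ∂unifBall ≤ ∫⁻ y in Metric.ball z t, F y := by
  rw [lintegral_unifBall_comp F z ht]
  exact mul_le_of_le_one_left' inv_volume_ball_le_one

/-- Averages over a disc in terms of averages over a larger disc. -/
theorem lintegral_unifBall_mono (F : Plane → ℝ≥0∞) {z x : Plane} {t R : ℝ} (ht : 0 < t)
    (hR : 0 < R) (hs : Metric.ball z t ⊆ Metric.ball x R) :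
    ∫⁻ w, F (z + t • w) ∂unifBall ≤
      ENNReal.ofReal ((R / t) ^ 2) * ∫⁻ w, F (x + R • w) ∂unifBall := by
  have h1 : ENNReal.ofReal (t ^ 2) * ∫⁻ w, F (z + t • w) ∂unifBall ≤
      ENNReal.ofReal (R ^ 2) * ∫⁻ w, F (x + R • w) ∂unifBall := by
    rw [lintegral_unifBall_comp F z ht, lintegral_unifBall_comp F x hR]
    gcongr
  have h2 : ENNReal.ofReal ((R / t) ^ 2) = (ENNReal.ofReal (t ^ 2))⁻¹ * ENNReal.ofReal (R ^ 2) := by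
    rw [← ENNReal.ofReal_inv_of_pos (by positivity), ← ENNReal.ofReal_mul (by positivity)]
    congr 1
    field_simp
  have h3 : ENNReal.ofReal (t ^ 2) ≠ 0 := by
    rw [Ne, ENNReal.ofReal_eq_zero, not_le]; positivity
  rw [h2, mul_assoc]
  calc ∫⁻ w, F (z + t • w) ∂unifBall
      = (ENNReal.ofReal (t ^ 2))⁻¹ * (ENNReal.ofReal (t ^ 2) *
        ∫⁻ w, F (z + t • w) ∂unifBall) := by
        rw [← mul_assoc, ENNReal.inv_mul_cancel h3 ENNReal.ofReal_ne_top, one_mul]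
    _ ≤ _ := by gcongr

theorem quasiMeasurePreserving_unifBall (z : Plane) {t : ℝ} (ht : t ≠ 0) :
    Measure.QuasiMeasurePreserving (fun w : Plane => z + t • w) unifBall volume := by
  have h1 : Measure.QuasiMeasurePreserving (fun w : Plane => t • w) volume volume :=
    ⟨by fun_prop, by
      rw [Measure.map_addHaar_smul _ ht]
      exact Measure.AbsolutelyContinuous.rfl.smul_left _⟩
  have h2 : Measure.QuasiMeasurePreserving (fun w : Plane => z + w) volume volume :=
    (measurePreserving_add_left volume z).quasiMeasurePreserving
  refine (h2.comp h1).mono_left ?_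
  exact (Measure.AbsolutelyContinuous.smul_left Measure.absolutelyContinuous_restrict _)

theorem enorm_integral_sq_le {α : Type*} [MeasurableSpace α] {μ : Measure α}
    [IsProbabilityMeasure μ] {a : α → E} (ha : AEStronglyMeasurable a μ) :
    ‖∫ w, a w ∂μ‖ₑ ^ 2 ≤ ∫⁻ w, ‖a w‖ₑ ^ 2 ∂μ := by
  rw [← eLpNorm_two_sq]
  gcongr
  refine (enorm_integral_le_lintegral_enorm a).trans ?_
  rw [← eLpNorm_one_eq_lintegral_enorm]
  exact eLpNorm_le_eLpNorm_of_exponent_le (by norm_num) ha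

theorem enorm_integral_sub_sq_le [CompleteSpace E] {α : Type*} [MeasurableSpace α] {μ : Measure α}
    [IsProbabilityMeasure μ] {a b : α → E} (ha : Integrable a μ) (hb : Integrable b μ) :
    ‖(∫ w, a w ∂μ) - ∫ w, b w ∂μ‖ₑ ^ 2 ≤ ∫⁻ p, ‖a p.1 - b p.2‖ₑ ^ 2 ∂(μ.prod μ) := by
  have h : (∫ w, a w ∂μ) - ∫ w, b w ∂μ = ∫ p, (a p.1 - b p.2) ∂(μ.prod μ) := by
    rw [integral_sub (ha.comp_fst μ) (hb.comp_snd μ), integral_fun_fst, integral_fun_snd]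
    simp
  rw [h]
  exact enorm_integral_sq_le ((ha.comp_fst μ).sub (hb.comp_snd μ)).aestronglyMeasurable

/-- Functions that are square integrable in the plane are square integrable over all discs,
including the degenerate ones. -/
theorem memLp_unifBall {E : Type*} [NormedAddCommGroup E] {f : Plane → E}
    (hf : StronglyMeasurable f) (h2 : MemLp f 2 volume)
    (z : Plane) {t : ℝ} (ht : 0 ≤ t) : MemLp (fun w => f (z + t • w)) 2 unifBall := by
  rcases ht.eq_or_lt with rfl | ht
  · simpa using memLp_const (f z)
  have hm : AEStronglyMeasurable (fun w => f (z + t • w)) unifBall :=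
    (hf.comp_measurable (by fun_prop)).aestronglyMeasurable
  refine ⟨hm, ?_⟩
  have h3 : eLpNorm (fun w => f (z + t • w)) 2 unifBall ^ 2 < ⊤ := by
    rw [eLpNorm_two_sq]
    have h4 := lintegral_unifBall_comp_le (fun y => ‖f y‖ₑ ^ 2) z ht
    have h5 : ∫⁻ y in Metric.ball z t, ‖f y‖ₑ ^ 2 < ⊤ := by
      refine (setLIntegral_le_lintegral _ _).trans_lt ?_
      rw [← eLpNorm_two_sq]
      exact ENNReal.pow_lt_top h2.2
    by_contra hcon
    rw [not_lt, top_le_iff] at hcon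
    rw [hcon, ENNReal.mul_top (by rw [Ne, ENNReal.ofReal_eq_zero, not_le]; positivity)] at h4
    exact absurd (h4.trans_lt h5) (lt_irrefl _)
  by_contra hcon
  rw [not_lt, top_le_iff] at hcon
  rw [hcon] at h3
  simp at h3

theorem integrable_unifBall {E : Type*} [NormedAddCommGroup E] {f : Plane → E} (hf : StronglyMeasurable f) (h2 : MemLp f 2 volume)
    (z : Plane) {t : ℝ} (ht : 0 ≤ t) : Integrable (fun w => f (z + t • w)) unifBall :=
  (memLp_unifBall hf h2 z ht).integrable (by norm_num)

theorem tendsto_lintegral_enorm_sq {α G : Type*} [MeasurableSpace α] [NormedAddCommGroup G]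
    {μ : Measure α} {φ : ℕ → α → G} {g : α → G} (hφ : ∀ n, AEStronglyMeasurable (φ n) μ)
    (hg : MemLp g 2 μ) (h : Tendsto (fun n => eLpNorm (φ n - g) 2 μ) atTop (𝓝 0)) :
    Tendsto (fun n => ∫⁻ x, ‖φ n x‖ₑ ^ 2 ∂μ) atTop (𝓝 (∫⁻ x, ‖g x‖ₑ ^ 2 ∂μ)) := by
  simp_rw [← eLpNorm_two_sq]
  refine ENNReal.Tendsto.pow ?_
  refine tendsto_of_tendsto_of_tendsto_of_le_of_le
    (g := fun n => eLpNorm g 2 μ - eLpNorm (φ n - g) 2 μ)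
    (h := fun n => eLpNorm g 2 μ + eLpNorm (φ n - g) 2 μ) ?_ ?_ (fun n => ?_) (fun n => ?_)
  · simpa using ENNReal.Tendsto.sub (tendsto_const_nhds (x := eLpNorm g 2 μ)) h (Or.inl hg.2.ne)
  · simpa using (tendsto_const_nhds (x := eLpNorm g 2 μ)).add h
  · rw [tsub_le_iff_right, eLpNorm_sub_comm (φ n) g 2 μ]
    have := eLpNorm_add_le (p := 2) (hφ n) (hg.1.sub (hφ n)) (by norm_num)
    rwa [add_sub_cancel] at this
  · have := eLpNorm_add_le (p := 2) hg.1 ((hφ n).sub hg.1) (by norm_num)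
    rwa [add_sub_cancel] at this

end Averages

/-! ### The Poincaré inequality on discs -/

section Poincare

variable {E : Type*} [NormedAddCommGroup E] [NormedSpace ℝ E] [CompleteSpace E]

/-- A mean value inequality along a segment. -/
theorem enorm_sub_sq_le_lintegral {φ : Plane → E} (hφ : ContDiff ℝ 1 φ) (a b : Plane) :
    ‖φ a - φ b‖ₑ ^ 2 ≤ ∫⁻ t in Set.Icc (0 : ℝ) 1,
      ‖fderiv ℝ φ (b + t • (a - b))‖ₑ ^ 2 * ‖a - b‖ₑ ^ 2 := by
  have hd : ∀ t : ℝ, HasDerivAt (fun t : ℝ => φ (b + t • (a - b)))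
      (fderiv ℝ φ (b + t • (a - b)) (a - b)) t := fun t => by
    have h1 : HasDerivAt (fun t : ℝ => b + t • (a - b)) (a - b) t := by
      simpa using ((hasDerivAt_id t).smul_const (a - b)).const_add b
    exact ((hφ.differentiable (by norm_num)) _).hasFDerivAt.comp_hasDerivAt t h1
  have hc : Continuous fun t : ℝ => fderiv ℝ φ (b + t • (a - b)) (a - b) :=
    ((continuous_fderiv_of_C1 hφ).comp (by fun_prop)).clm_apply continuous_const
  have h0 := intervalIntegral.integral_eq_sub_of_hasDerivAt (a := 0) (b := 1) (fun t _ => hd t)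
    (hc.intervalIntegrable _ _)
  simp only [one_smul, add_sub_cancel, zero_smul, add_zero] at h0
  rw [intervalIntegral.integral_of_le zero_le_one, ← integral_Icc_eq_integral_Ioc] at h0
  have : IsProbabilityMeasure (volume.restrict (Set.Icc (0 : ℝ) 1)) := ⟨by simp⟩
  rw [← h0]
  refine (enorm_integral_sq_le hc.aestronglyMeasurable).trans ?_
  refine lintegral_mono fun t => ?_
  rw [← mul_pow]
  gcongr
  exact ContinuousLinearMap.le_opENorm _ _

/-- Contracting the unit disc towards a point `w'` by a factor `t ≥ 1 / 2` distorts averages by at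
most `t⁻² ≤ 4`. -/
theorem lintegral_unifBall_segment_le (F : Plane → ℝ≥0∞) {t : ℝ} (ht : 1 / 2 ≤ t) (ht1 : t ≤ 1)
    {w' : Plane} (hw : w' ∈ Metric.ball (0 : Plane) 1) :
    ∫⁻ w, F ((1 - t) • w' + t • w) ∂unifBall ≤ 4 * ∫⁻ w, F w ∂unifBall := by
  have h := lintegral_unifBall_mono F (z := (1 - t) • w') (x := 0) (t := t) (R := 1)
    (by linarith) one_pos (by
      intro y hy
      rw [Metric.mem_ball, dist_eq_norm] at *
      rw [sub_zero] at *
      have h1 : ‖y‖ ≤ ‖y - (1 - t) • w'‖ + ‖(1 - t) • w'‖ := by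
        simpa using norm_add_le (y - (1 - t) • w') ((1 - t) • w')
      rw [norm_smul, Real.norm_eq_abs, abs_of_nonneg (by linarith : (0 : ℝ) ≤ 1 - t)] at h1
      nlinarith [norm_nonneg w'])
  simp only [one_smul, zero_add] at h
  refine h.trans ?_
  gcongr
  have : (4 : ℝ≥0∞) = ENNReal.ofReal 4 := by norm_num
  rw [this]
  apply ENNReal.ofReal_le_ofReal
  rw [div_pow, one_pow, div_le_iff₀ (by positivity)]
  nlinarith

/-- The Poincaré inequality on the unit disc for `C¹` functions. -/
theorem lintegral_sub_sq_le_of_contDiff {φ : Plane → E} (hφ : ContDiff ℝ 1 φ) :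
    ∫⁻ p, ‖φ p.1 - φ p.2‖ₑ ^ 2 ∂(unifBall.prod unifBall) ≤
      16 * ∫⁻ w, ‖fderiv ℝ φ w‖ₑ ^ 2 ∂unifBall := by
  set F : Plane → ℝ≥0∞ := fun w => ‖fderiv ℝ φ w‖ₑ ^ 2 with hF
  have hFm : Continuous F := by
    have := continuous_fderiv_of_C1 hφ
    fun_prop
  set μ := volume.restrict (Set.Icc (0 : ℝ) 1)
  have hseg : ∀ p : Plane × Plane, ∀ t : ℝ, p.2 + t • (p.1 - p.2) = (1 - t) • p.2 + t • p.1 := by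
    intro p t; module
  have hb : ∀ᵐ p ∂(unifBall.prod unifBall), p.1 ∈ Metric.ball (0 : Plane) 1 ∧
      p.2 ∈ Metric.ball (0 : Plane) 1 := by
    filter_upwards [Measure.quasiMeasurePreserving_fst.ae ae_unifBall,
      Measure.quasiMeasurePreserving_snd.ae ae_unifBall] with p h1 h2 using ⟨h1, h2⟩
  calc ∫⁻ p, ‖φ p.1 - φ p.2‖ₑ ^ 2 ∂(unifBall.prod unifBall)
      ≤ ∫⁻ p, (∫⁻ t, F ((1 - t) • p.2 + t • p.1) * 4 ∂μ) ∂(unifBall.prod unifBall) := by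
        refine lintegral_mono_ae ?_
        filter_upwards [hb] with p hp
        refine (enorm_sub_sq_le_lintegral hφ p.1 p.2).trans ?_
        refine lintegral_mono fun t => ?_
        rw [hseg]
        gcongr
        have h2 : ‖p.1 - p.2‖ₑ ≤ 2 := by
          have h3 : ‖p.1 - p.2‖ ≤ 2 := by
            have := norm_sub_le p.1 p.2
            have h4 := mem_ball_zero_iff.1 hp.1
            have h5 := mem_ball_zero_iff.1 hp.2
            linarith
          rw [← ofReal_norm]
          exact (ENNReal.ofReal_le_ofReal h3).trans (by norm_num)
        calc ‖p.1 - p.2‖ₑ ^ 2 ≤ 2 ^ 2 := by gcongr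
          _ = 4 := by norm_num
    _ = ∫⁻ t, (∫⁻ p, F ((1 - t) • p.2 + t • p.1) * 4 ∂(unifBall.prod unifBall)) ∂μ := by
        rw [lintegral_lintegral_swap]
        exact (((hFm.comp (by fun_prop : Continuous fun q : (Plane × Plane) × ℝ =>
          (1 - q.2) • q.1.2 + q.2 • q.1.1)).measurable).mul_const 4).aemeasurable
    _ ≤ ∫⁻ t, (16 * ∫⁻ w, F w ∂unifBall) ∂μ := by
        refine lintegral_mono_ae ?_
        filter_upwards [ae_restrict_mem measurableSet_Icc] with t ht
        have hm : ∀ s : ℝ, Measurable fun p : Plane × Plane => F ((1 - s) • p.2 + s • p.1) :=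
          fun s => (hFm.comp (by fun_prop)).measurable
        rw [lintegral_mul_const _ (hm t)]
        have key : ∫⁻ p, F ((1 - t) • p.2 + t • p.1) ∂(unifBall.prod unifBall) ≤
            4 * ∫⁻ w, F w ∂unifBall := by
          -- Integrate first over the endpoint with the larger coefficient, so that the contraction
          -- factor is at least `1 / 2`.
          rcases le_total (1 / 2) t with h | h
          · rw [lintegral_prod_symm' _ (hm t)]
            calc _ ≤ ∫⁻ _, (4 * ∫⁻ w, F w ∂unifBall) ∂unifBall := by
                  refine lintegral_mono_ae ?_
                  filter_upwards [ae_unifBall] with w' hw'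
                  exact lintegral_unifBall_segment_le F h ht.2 hw'
              _ = _ := by simp
          · rw [lintegral_prod _ (hm t).aemeasurable]
            calc _ ≤ ∫⁻ _, (4 * ∫⁻ w, F w ∂unifBall) ∂unifBall := by
                  refine lintegral_mono_ae ?_
                  filter_upwards [ae_unifBall] with w' hw'
                  have := lintegral_unifBall_segment_le F (t := 1 - t) (by linarith)
                    (by linarith [ht.1]) hw'
                  simpa [add_comm] using this
              _ = _ := by simp
        calc _ ≤ (4 * ∫⁻ w, F w ∂unifBall) * 4 := by gcongr
          _ = _ := by ring
    _ = _ := by simp [μ]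

/-- The Poincaré inequality on discs, for functions in `W₀^{1,2}`. -/
theorem W0.lintegral_sub_sq_le {Ω : Set Plane} {f : Plane → E} {g : Plane → Plane →L[ℝ] E}
    (h : W0 Ω f g) (z : Plane) {t : ℝ} (ht : 0 < t) :
    ∫⁻ p, ‖f (z + t • p.1) - f (z + t • p.2)‖ₑ ^ 2 ∂(unifBall.prod unifBall) ≤
      16 * ∫⁻ y in Metric.ball z t, ‖g y‖ₑ ^ 2 := by
  obtain ⟨φ, hφ, h1, h2, h3⟩ := h.exists_approx_ae
  have hT : ∀ n, ∫⁻ p, ‖φ n (z + t • p.1) - φ n (z + t • p.2)‖ₑ ^ 2 ∂(unifBall.prod unifBall) ≤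
      16 * ∫⁻ y in Metric.ball z t, ‖fderiv ℝ (φ n) y‖ₑ ^ 2 := by
    intro n
    have hC := (hφ n).contDiff_one
    have hd : ∀ w, fderiv ℝ (fun w => φ n (z + t • w)) w = t • fderiv ℝ (φ n) (z + t • w) := by
      intro w
      have h5 : HasFDerivAt (fun w : Plane => z + t • w) (t • ContinuousLinearMap.id ℝ Plane) w :=
        ((hasFDerivAt_id w).const_smul t).const_add z
      have h6 := (((hC.differentiable (by norm_num)) (z + t • w)).hasFDerivAt.comp w h5).fderiv
      simp only [Function.comp_def] at h6
      rw [h6]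
      simp
    have h5 := lintegral_sub_sq_le_of_contDiff (φ := fun w => φ n (z + t • w))
      (hC.comp (contDiff_const.add (contDiff_id.const_smul t)))
    refine h5.trans (mul_le_mul' le_rfl ?_)
    refine le_trans (le_of_eq ?_) (lintegral_unifBall_comp_le
      (fun y => ‖fderiv ℝ (φ n) y‖ₑ ^ 2) z ht)
    rw [← lintegral_const_mul' _ _ ENNReal.ofReal_ne_top]
    refine lintegral_congr fun w => ?_
    rw [hd, enorm_smul, mul_pow, Real.enorm_eq_ofReal ht.le, ENNReal.ofReal_pow ht.le]
  have hlim : Tendsto (fun n => 16 * ∫⁻ y in Metric.ball z t, ‖fderiv ℝ (φ n) y‖ₑ ^ 2) atTop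
      (𝓝 (16 * ∫⁻ y in Metric.ball z t, ‖g y‖ₑ ^ 2)) := by
    refine ENNReal.Tendsto.const_mul (tendsto_lintegral_enorm_sq
      (fun n => (continuous_fderiv_of_C1 (hφ n).contDiff_one).aestronglyMeasurable)
      (h.memLp_deriv.restrict _) ?_) (Or.inr (by norm_num))
    exact tendsto_of_tendsto_of_tendsto_of_le_of_le tendsto_const_nhds h2 (fun _ => zero_le)
        (fun n => eLpNorm_mono_measure _ Measure.restrict_le_self)
  have hae : ∀ᵐ w ∂unifBall, Tendsto (fun n => φ n (z + t • w)) atTop (𝓝 (f (z + t • w))) :=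
    (quasiMeasurePreserving_unifBall z ht.ne').ae h3
  have hae2 : ∀ᵐ p ∂(unifBall.prod unifBall), Tendsto
      (fun n => ‖φ n (z + t • p.1) - φ n (z + t • p.2)‖ₑ ^ 2) atTop
      (𝓝 (‖f (z + t • p.1) - f (z + t • p.2)‖ₑ ^ 2)) := by
    filter_upwards [Measure.quasiMeasurePreserving_fst.ae hae,
      Measure.quasiMeasurePreserving_snd.ae hae] with p hp1 hp2
    exact ENNReal.Tendsto.pow ((hp1.sub hp2).enorm)
  calc ∫⁻ p, ‖f (z + t • p.1) - f (z + t • p.2)‖ₑ ^ 2 ∂(unifBall.prod unifBall)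
      = ∫⁻ p, liminf (fun n => ‖φ n (z + t • p.1) - φ n (z + t • p.2)‖ₑ ^ 2) atTop
          ∂(unifBall.prod unifBall) := by
        refine lintegral_congr_ae ?_
        filter_upwards [hae2] with p hp using hp.liminf_eq.symm
    _ ≤ liminf (fun n => ∫⁻ p, ‖φ n (z + t • p.1) - φ n (z + t • p.2)‖ₑ ^ 2
          ∂(unifBall.prod unifBall)) atTop := by
        refine lintegral_liminf_le' fun n => ?_
        have hC := (hφ n).contDiff_one.continuous
        fun_prop
    _ ≤ liminf (fun n => 16 * ∫⁻ y in Metric.ball z t, ‖fderiv ℝ (φ n) y‖ₑ ^ 2) atTop :=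
        liminf_le_liminf (Eventually.of_forall hT)
    _ = _ := hlim.liminf_eq

end Poincare

/-! ### Discs of variable radius -/

section Radius

/-- A radius function for averaging inside the disc `B_R(x)`: it vanishes outside that disc, and the
disc around `z` with radius `ρ z` lies in `B_R(x)` for each `z` there. -/
structure IsRadius (x : Plane) (R : ℝ) (ρ : Plane → ℝ) : Prop where
  contDiff : ContDiff ℝ 1 ρ
  nonneg : ∀ z, 0 ≤ ρ z
  le : ∀ z ∈ Metric.ball x R, ρ z ≤ R - dist z x
  eq_zero : ∀ z ∉ Metric.ball x R, ρ z = 0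
  norm_fderiv_le : ∀ z, ‖fderiv ℝ ρ z‖ ≤ 1 / 2

variable {x : Plane} {R : ℝ} {ρ : Plane → ℝ}

theorem IsRadius.hasFDerivAt (h : IsRadius x R ρ) (z : Plane) :
    HasFDerivAt ρ (fderiv ℝ ρ z) z :=
  ((h.contDiff.differentiable (by norm_num)) z).hasFDerivAt

theorem IsRadius.fderiv_eq_zero (h : IsRadius x R ρ) {z : Plane} (hz : ρ z = 0) :
    fderiv ℝ ρ z = 0 :=
  IsLocalMin.fderiv_eq_zero (Eventually.of_forall fun y => hz ▸ h.nonneg y)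

theorem IsRadius.dist_le (h : IsRadius x R ρ) (y z : Plane) :
    |ρ y - ρ z| ≤ 1 / 2 * ‖y - z‖ := by
  have h1 := Convex.norm_image_sub_le_of_norm_fderiv_le (𝕜 := ℝ) (f := ρ) (s := Set.univ)
    (fun w _ => (h.contDiff.differentiable (by norm_num)) w) (fun w _ => h.norm_fderiv_le w)
    convex_univ (Set.mem_univ z) (Set.mem_univ y)
  simpa using h1

theorem IsRadius.ball_subset (h : IsRadius x R ρ) {z : Plane} (hz : z ∈ Metric.ball x R) :
    Metric.ball z (ρ z) ⊆ Metric.ball x R :=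
  Metric.ball_subset_ball' (by linarith [h.le z hz])

theorem IsRadius.const_mul (h : IsRadius x R ρ) {s : ℝ} (h0 : 0 ≤ s) (h1 : s ≤ 1) :
    IsRadius x R (fun z => s * ρ z) where
  contDiff := contDiff_const.mul h.contDiff
  nonneg z := mul_nonneg h0 (h.nonneg z)
  le z hz := (mul_le_of_le_one_left (h.nonneg z) h1).trans (h.le z hz)
  eq_zero z hz := by simp [h.eq_zero z hz]
  norm_fderiv_le z := by
    rw [((h.hasFDerivAt z).const_mul s).fderiv, norm_smul, Real.norm_eq_abs, abs_of_nonneg h0]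
    nlinarith [h.norm_fderiv_le z, norm_nonneg (fderiv ℝ ρ z)]

/-- The derivative of `z ↦ z + ρ(z) w`. -/
def shiftDeriv (ρ : Plane → ℝ) (w z : Plane) : Plane →L[ℝ] Plane :=
  ContinuousLinearMap.id ℝ Plane + (fderiv ℝ ρ z).smulRight w

theorem IsRadius.hasFDerivAt_shift (h : IsRadius x R ρ) (w z : Plane) :
    HasFDerivAt (fun z => z + ρ z • w) (shiftDeriv ρ w z) z :=
  (hasFDerivAt_id z).add ((h.hasFDerivAt z).smul_const w)

theorem det_shiftDeriv (w z : Plane) : (shiftDeriv ρ w z).det = 1 + fderiv ℝ ρ z w := by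
  have := LinearMap.transvection.det (fderiv ℝ ρ z).toLinearMap w
  rw [ContinuousLinearMap.det]
  convert this using 2
  · ext v
    simp [shiftDeriv, LinearMap.transvection]
  · rfl

theorem IsRadius.norm_shiftDeriv_le (h : IsRadius x R ρ) {w : Plane}
    (hw : w ∈ Metric.ball (0 : Plane) 1) (z : Plane) : ‖shiftDeriv ρ w z‖ ≤ 2 := by
  have hw' := mem_ball_zero_iff.1 hw
  refine (norm_add_le _ _).trans ?_
  have h1 := ContinuousLinearMap.norm_id_le (𝕜 := ℝ) (E := Plane)
  have h2 : ‖(fderiv ℝ ρ z).smulRight w‖ = ‖fderiv ℝ ρ z‖ * ‖w‖ :=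
    ContinuousLinearMap.norm_smulRight_apply _ _
  rw [h2]
  nlinarith [h.norm_fderiv_le z, norm_nonneg (fderiv ℝ ρ z), norm_nonneg w]

theorem IsRadius.continuous_shiftDeriv (h : IsRadius x R ρ) :
    Continuous fun p : Plane × Plane => shiftDeriv ρ p.2 p.1 := by
  have h1 := continuous_fderiv_of_C1 h.contDiff
  unfold shiftDeriv
  refine continuous_const.add ?_
  have h2 : Continuous fun p : Plane × Plane =>
      ContinuousLinearMap.smulRightL ℝ Plane Plane (fderiv ℝ ρ p.1) p.2 := by fun_prop
  exact h2

theorem IsRadius.continuous_shift (h : IsRadius x R ρ) :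
    Continuous fun p : Plane × Plane => p.1 + ρ p.1 • p.2 := by
  have := h.contDiff.continuous
  fun_prop

theorem IsRadius.shift_mem (h : IsRadius x R ρ) {w z : Plane}
    (hw : w ∈ Metric.ball (0 : Plane) 1) (hz : z ∈ Metric.ball x R) :
    z + ρ z • w ∈ Metric.ball x R := by
  rcases (h.nonneg z).eq_or_lt with h0 | h0
  · simpa [← h0] using hz
  · apply h.ball_subset hz
    rw [mem_ball_iff_norm, add_sub_cancel_left, norm_smul, Real.norm_eq_abs, abs_of_pos h0]
    have := mem_ball_zero_iff.1 hw
    nlinarith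

/-- Moving points by `z ↦ z + ρ(z) w` at most doubles integrals, since the Jacobian determinant is
at least `1 / 2`. -/
theorem IsRadius.lintegral_shift_le (h : IsRadius x R ρ) {w : Plane}
    (hw : w ∈ Metric.ball (0 : Plane) 1) {S : Set Plane} (hS : MeasurableSet S)
    (hm : ∀ z ∈ S, z + ρ z • w ∈ S) (F : Plane → ℝ≥0∞) :
    ∫⁻ z in S, F (z + ρ z • w) ≤ 2 * ∫⁻ z in S, F z := by
  have hw' := mem_ball_zero_iff.1 hw
  have hinj : Set.InjOn (fun z => z + ρ z • w) S := by
    intro y _ z _ hyz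
    simp only at hyz
    have h1 : y - z = (ρ z - ρ y) • w := by
      have : y - z - (ρ z - ρ y) • w = (y + ρ y • w) - (z + ρ z • w) := by module
      rw [hyz, sub_self, sub_eq_zero] at this
      exact this
    have h2 := congrArg norm h1
    rw [norm_smul, Real.norm_eq_abs, abs_sub_comm] at h2
    have h3 := h.dist_le y z
    have h4 : ‖y - z‖ = 0 := by
      nlinarith [norm_nonneg (y - z), norm_nonneg w, abs_nonneg (ρ y - ρ z)]
    exact sub_eq_zero.1 (norm_eq_zero.1 h4)
  have hcv := lintegral_image_eq_lintegral_abs_det_fderiv_mul volume hS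
    (fun z _ => (h.hasFDerivAt_shift w z).hasFDerivWithinAt) hinj F
  have hsub : (fun z => z + ρ z • w) '' S ⊆ S := by
    rintro _ ⟨z, hz, rfl⟩
    exact hm z hz
  have hdet : ∀ z, (1 : ℝ) / 2 ≤ |(shiftDeriv ρ w z).det| := by
    intro z
    rw [det_shiftDeriv]
    refine le_trans ?_ (le_abs_self _)
    have h1 : |fderiv ℝ ρ z w| ≤ 1 / 2 := by
      refine ((fderiv ℝ ρ z).le_opNorm w).trans ?_
      nlinarith [h.norm_fderiv_le z, norm_nonneg (fderiv ℝ ρ z), norm_nonneg w]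
    linarith [(abs_le.1 h1).1]
  calc ∫⁻ z in S, F (z + ρ z • w)
      ≤ ∫⁻ z in S, 2 * (ENNReal.ofReal |(shiftDeriv ρ w z).det| * F (z + ρ z • w)) := by
        refine lintegral_mono fun z => ?_
        rw [← mul_assoc]
        refine le_mul_of_one_le_left' ?_
        have h1 : (1 : ℝ≥0∞) = 2 * ENNReal.ofReal (1 / 2) := by
          rw [← ENNReal.ofReal_ofNat 2, ← ENNReal.ofReal_mul (by norm_num)]
          norm_num
        rw [h1]
        gcongr
        exact hdet z
    _ = 2 * ∫⁻ z in (fun z => z + ρ z • w) '' S, F z := by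
        rw [lintegral_const_mul' _ _ (by norm_num), hcv]
    _ ≤ _ := by gcongr

end Radius

/-! ### Averages over discs of variable radius -/

section WeightedAverage

variable {E E' : Type*} [NormedAddCommGroup E] [NormedSpace ℝ E]
  [NormedAddCommGroup E'] [NormedSpace ℝ E'] {x : Plane} {R : ℝ} {ρ : Plane → ℝ}

/-- The average of `w ↦ L z w (f (z + ρ(z) w))` over the unit disc. The weight `L` is trivial for
the average of a function, and is the derivative of `z ↦ z + ρ(z) w` for that of a gradient. -/
def weightedAverage (ρ : Plane → ℝ) (L : Plane → Plane → E →L[ℝ] E') (f : Plane → E) (z : Plane) :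
    E' := ∫ w, L z w (f (z + ρ z • w)) ∂unifBall

/-- A continuous weight, bounded by `2`. -/
structure IsWeight (L : Plane → Plane → E →L[ℝ] E') : Prop where
  continuous : Continuous fun p : Plane × Plane => L p.1 p.2
  norm_le : ∀ z, ∀ w ∈ Metric.ball (0 : Plane) 1, ‖L z w‖ ≤ 2

variable {L : Plane → Plane → E →L[ℝ] E'}

theorem IsWeight.stronglyMeasurable (hL : IsWeight L) (h : IsRadius x R ρ) {f : Plane → E}
    (hf : StronglyMeasurable f) :
    StronglyMeasurable fun p : Plane × Plane => L p.1 p.2 (f (p.1 + ρ p.1 • p.2)) := by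
  have h1 : StronglyMeasurable fun p : Plane × Plane => f (p.1 + ρ p.1 • p.2) :=
    hf.comp_measurable h.continuous_shift.measurable
  exact isBoundedBilinearMap_apply.continuous.comp_stronglyMeasurable
    (hL.continuous.stronglyMeasurable.prodMk h1)

theorem IsWeight.stronglyMeasurable_weightedAverage (hL : IsWeight L) (h : IsRadius x R ρ)
    {f : Plane → E} (hf : StronglyMeasurable f) :
    StronglyMeasurable (weightedAverage ρ L f) :=
  (hL.stronglyMeasurable h hf).integral_prod_right'

theorem IsWeight.integrable (hL : IsWeight L) (h : IsRadius x R ρ) {f : Plane → E}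
    (hf : StronglyMeasurable f) (h2 : MemLp f 2 volume) (z : Plane) :
    Integrable (fun w => L z w (f (z + ρ z • w))) unifBall := by
  refine ((integrable_unifBall hf h2 z (h.nonneg z)).norm.const_mul 2).mono' ?_ ?_
  · exact ((hL.stronglyMeasurable h hf).comp_measurable
      (measurable_prodMk_left (x := z))).aestronglyMeasurable
  · filter_upwards [ae_unifBall] with w hw
    refine ((L z w).le_opNorm _).trans ?_
    gcongr
    exact hL.norm_le z w hw

theorem IsWeight.enorm_sq_le (hL : IsWeight L) (h : IsRadius x R ρ) {f : Plane → E}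
    (hf : StronglyMeasurable f) (z : Plane) :
    ‖weightedAverage ρ L f z‖ₑ ^ 2 ≤ ∫⁻ w, 4 * ‖f (z + ρ z • w)‖ₑ ^ 2 ∂unifBall := by
  refine (enorm_integral_sq_le ((hL.stronglyMeasurable h hf).comp_measurable
    (measurable_prodMk_left (x := z))).aestronglyMeasurable).trans ?_
  refine lintegral_mono_ae ?_
  filter_upwards [ae_unifBall] with w hw
  have h1 : ‖L z w (f (z + ρ z • w))‖ₑ ≤ 2 * ‖f (z + ρ z • w)‖ₑ := by
    refine ((L z w).le_opENorm _).trans ?_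
    gcongr
    rw [← ofReal_norm]
    exact (ENNReal.ofReal_le_ofReal (hL.norm_le z w hw)).trans (by norm_num)
  calc ‖L z w (f (z + ρ z • w))‖ₑ ^ 2 ≤ (2 * ‖f (z + ρ z • w)‖ₑ) ^ 2 := by gcongr
    _ = _ := by ring

/-- Weighted averaging is bounded on `L²(S)` for each set `S` that the moves `z ↦ z + ρ(z) w`
preserve. -/
theorem IsWeight.lintegral_sq_le (hL : IsWeight L) (h : IsRadius x R ρ) {f : Plane → E}
    (hf : StronglyMeasurable f) {S : Set Plane} (hS : MeasurableSet S)
    (hm : ∀ w ∈ Metric.ball (0 : Plane) 1, ∀ z ∈ S, z + ρ z • w ∈ S) :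
    ∫⁻ z in S, ‖weightedAverage ρ L f z‖ₑ ^ 2 ≤ 8 * ∫⁻ z in S, ‖f z‖ₑ ^ 2 := by
  have hjm : Measurable fun p : Plane × Plane => ‖f (p.1 + ρ p.1 • p.2)‖ₑ ^ 2 :=
    ((hf.comp_measurable h.continuous_shift.measurable).enorm).pow_const 2
  calc ∫⁻ z in S, ‖weightedAverage ρ L f z‖ₑ ^ 2
      ≤ ∫⁻ z in S, ∫⁻ w, 4 * ‖f (z + ρ z • w)‖ₑ ^ 2 ∂unifBall :=
        lintegral_mono fun z => hL.enorm_sq_le h hf z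
    _ = ∫⁻ w, (∫⁻ z in S, 4 * ‖f (z + ρ z • w)‖ₑ ^ 2) ∂unifBall :=
        lintegral_lintegral_swap (hjm.const_mul 4).aemeasurable
    _ ≤ ∫⁻ _, (8 * ∫⁻ z in S, ‖f z‖ₑ ^ 2) ∂unifBall := by
        refine lintegral_mono_ae ?_
        filter_upwards [ae_unifBall] with w hw
        rw [lintegral_const_mul' _ _ (by norm_num)]
        have h1 := h.lintegral_shift_le hw hS (hm w hw) (fun z => ‖f z‖ₑ ^ 2)
        calc _ ≤ 4 * (2 * ∫⁻ z in S, ‖f z‖ₑ ^ 2) := by gcongr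
          _ = _ := by ring
    _ = _ := by simp

theorem IsWeight.eLpNorm_le (hL : IsWeight L) (h : IsRadius x R ρ) {f : Plane → E}
    (hf : StronglyMeasurable f) :
    eLpNorm (weightedAverage ρ L f) 2 volume ≤ 3 * eLpNorm f 2 volume := by
  have h1 := hL.lintegral_sq_le h hf MeasurableSet.univ (fun _ _ _ _ => Set.mem_univ _)
  rw [setLIntegral_univ, setLIntegral_univ, ← eLpNorm_two_sq, ← eLpNorm_two_sq] at h1
  refine (ENNReal.pow_le_pow_left_iff (n := 2) (by norm_num)).1 (h1.trans ?_)
  rw [mul_pow]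
  gcongr
  norm_num

theorem IsWeight.sub (hL : IsWeight L) (h : IsRadius x R ρ) {f f' : Plane → E}
    (hf : StronglyMeasurable f) (h2 : MemLp f 2 volume) (hf' : StronglyMeasurable f')
    (h2' : MemLp f' 2 volume) :
    weightedAverage ρ L f - weightedAverage ρ L f' = weightedAverage ρ L (f - f') := by
  ext z
  simp only [weightedAverage, Pi.sub_apply]
  rw [← integral_sub (hL.integrable h hf h2 z) (hL.integrable h hf' h2' z)]
  simp

theorem IsWeight.tendsto (hL : IsWeight L) (h : IsRadius x R ρ) {f : Plane → E}
    (hf : StronglyMeasurable f) (h2 : MemLp f 2 volume) {fn : ℕ → Plane → E}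
    (hfn : ∀ n, StronglyMeasurable (fn n)) (hn2 : ∀ n, MemLp (fn n) 2 volume)
    (hlim : Tendsto (fun n => eLpNorm (fn n - f) 2 volume) atTop (𝓝 0)) :
    Tendsto (fun n => eLpNorm (weightedAverage ρ L (fn n) - weightedAverage ρ L f) 2 volume)
      atTop (𝓝 0) := by
  have h3 : Tendsto (fun n => 3 * eLpNorm (fn n - f) 2 volume) atTop (𝓝 0) := by
    simpa using ENNReal.Tendsto.const_mul hlim (Or.inr (by norm_num : (3 : ℝ≥0∞) ≠ ⊤))
  refine tendsto_of_tendsto_of_tendsto_of_le_of_le tendsto_const_nhds h3 (fun _ => zero_le)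
    fun n => ?_
  rw [hL.sub h (hfn n) (hn2 n) hf h2]
  exact hL.eLpNorm_le h ((hfn n).sub hf)

end WeightedAverage

section Average

variable {E : Type*} [NormedAddCommGroup E] [NormedSpace ℝ E] {x : Plane} {R : ℝ} {ρ : Plane → ℝ}

/-- The average of `f` over the disc with centre `z` and radius `ρ z`. -/
def average (ρ : Plane → ℝ) (f : Plane → E) : Plane → E :=
  weightedAverage ρ (fun _ _ => ContinuousLinearMap.id ℝ E) f

/-- The gradient of `average ρ f`, in terms of the gradient `g` of `f`. -/
def averageDeriv (ρ : Plane → ℝ) (g : Plane → Plane →L[ℝ] E) : Plane → Plane →L[ℝ] E :=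
  weightedAverage ρ (fun z w => (ContinuousLinearMap.compL ℝ Plane Plane E).flip
    (shiftDeriv ρ w z)) g

theorem average_apply (f : Plane → E) (z : Plane) :
    average ρ f z = ∫ w, f (z + ρ z • w) ∂unifBall := by
  simp [average, weightedAverage]

theorem averageDeriv_apply (g : Plane → Plane →L[ℝ] E) (z : Plane) :
    averageDeriv ρ g z = ∫ w, (g (z + ρ z • w)).comp (shiftDeriv ρ w z) ∂unifBall := by
  simp [averageDeriv, weightedAverage]

theorem isWeight_id : IsWeight fun _ _ : Plane => ContinuousLinearMap.id ℝ E :=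
  ⟨continuous_const, fun _ _ _ => ContinuousLinearMap.norm_id_le.trans one_le_two⟩

theorem IsRadius.isWeight (h : IsRadius x R ρ) : IsWeight fun z w =>
    (ContinuousLinearMap.compL ℝ Plane Plane E).flip (shiftDeriv ρ w z) := by
  refine ⟨(ContinuousLinearMap.continuous _).comp h.continuous_shiftDeriv, fun z w hw => ?_⟩
  refine ContinuousLinearMap.opNorm_le_bound _ (by norm_num) fun a => ?_
  simp only [ContinuousLinearMap.flip_apply, ContinuousLinearMap.compL_apply]
  refine (ContinuousLinearMap.opNorm_comp_le _ _).trans ?_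
  rw [mul_comm]
  gcongr
  exact h.norm_shiftDeriv_le hw z

theorem IsRadius.hasFDerivAt_average (h : IsRadius x R ρ) {φ : Plane → E} (hφ : ContDiff ℝ 1 φ)
    (hc : HasCompactSupport φ) (z : Plane) :
    HasFDerivAt (average ρ φ) (averageDeriv ρ (fderiv ℝ φ) z) z := by
  have h1 : average ρ φ = fun z => ∫ w, φ (z + ρ z • w) ∂unifBall := by
    ext z; exact average_apply φ z
  obtain ⟨C, hC⟩ := (hc.fderiv (𝕜 := ℝ)).exists_bound_of_continuous (continuous_fderiv_of_C1 hφ)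
  have hcs := h.continuous_shift
  rw [h1, averageDeriv_apply]
  refine hasFDerivAt_integral_of_dominated_of_fderiv_le (s := Set.univ) (bound := fun _ => C * 2)
    (F' := fun z w => (fderiv ℝ φ (z + ρ z • w)).comp (shiftDeriv ρ w z))
    univ_mem (Eventually.of_forall fun z => ?_) ?_ ?_ ?_ (integrable_const _) ?_
  · exact (hφ.continuous.comp (hcs.comp (by fun_prop : Continuous fun w : Plane =>
      (z, w)))).aestronglyMeasurable
  · exact integrable_unifBall hφ.continuous.stronglyMeasurable (memLp_of_C1 hφ hc) z (h.nonneg z)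
  · have : SecondCountableTopologyEither Plane (Plane →L[ℝ] E) :=
      secondCountableTopologyEither_of_left _ _
    refine Continuous.aestronglyMeasurable ?_
    exact ((continuous_fderiv_of_C1 hφ).comp (hcs.comp (by fun_prop : Continuous fun w : Plane =>
      (z, w)))).clm_comp (h.continuous_shiftDeriv.comp (by fun_prop : Continuous fun w : Plane =>
      (z, w)))
  · filter_upwards [ae_unifBall] with w hw y _
    refine (ContinuousLinearMap.opNorm_comp_le _ _).trans ?_
    have := h.norm_shiftDeriv_le hw y
    have h3 := hC (y + ρ y • w)
    gcongr
    exact (norm_nonneg _).trans h3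
  · refine Eventually.of_forall fun w y _ => ?_
    exact ((hφ.differentiable (by norm_num)) _).hasFDerivAt.comp y (h.hasFDerivAt_shift w y)

theorem IsRadius.continuous_averageDeriv (h : IsRadius x R ρ) {φ : Plane → E}
    (hφ : ContDiff ℝ 1 φ) (hc : HasCompactSupport φ) :
    Continuous (averageDeriv ρ (fderiv ℝ φ)) := by
  have h1 : averageDeriv ρ (fderiv ℝ φ) = fun z =>
      ∫ w, (fderiv ℝ φ (z + ρ z • w)).comp (shiftDeriv ρ w z) ∂unifBall := by
    ext1 z; exact averageDeriv_apply _ z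
  obtain ⟨C, hC⟩ := (hc.fderiv (𝕜 := ℝ)).exists_bound_of_continuous (continuous_fderiv_of_C1 hφ)
  have hcs := h.continuous_shift
  have hcont : Continuous fun p : Plane × Plane =>
      (fderiv ℝ φ (p.1 + ρ p.1 • p.2)).comp (shiftDeriv ρ p.2 p.1) :=
    ((continuous_fderiv_of_C1 hφ).comp hcs).clm_comp h.continuous_shiftDeriv
  rw [h1]
  refine MeasureTheory.continuous_of_dominated (bound := fun _ => C * 2) (fun z => ?_)
    (fun z => ?_) (integrable_const _) ?_
  · have : SecondCountableTopologyEither Plane (Plane →L[ℝ] E) :=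
      secondCountableTopologyEither_of_left _ _
    exact (hcont.comp (by fun_prop : Continuous fun w : Plane => (z, w))).aestronglyMeasurable
  · filter_upwards [ae_unifBall] with w hw
    refine (ContinuousLinearMap.opNorm_comp_le _ _).trans ?_
    have := h.norm_shiftDeriv_le hw z
    have h3 := hC (z + ρ z • w)
    gcongr
    exact (norm_nonneg _).trans h3
  · exact Eventually.of_forall fun w =>
      hcont.comp (by fun_prop : Continuous fun z : Plane => (z, w))

variable [CompleteSpace E]

theorem IsRadius.average_of_notMem (h : IsRadius x R ρ) {f : Plane → E} {z : Plane}
    (hz : z ∉ Metric.ball x R) : average ρ f z = f z := by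
  rw [average_apply]
  simp [h.eq_zero z hz]

theorem IsRadius.averageDeriv_of_notMem (h : IsRadius x R ρ) {g : Plane → Plane →L[ℝ] E}
    {z : Plane} (hz : z ∉ Metric.ball x R) : averageDeriv ρ g z = g z := by
  rw [averageDeriv_apply]
  simp [h.eq_zero z hz, shiftDeriv, h.fderiv_eq_zero (h.eq_zero z hz)]

/-- The average of a `C¹` function is `C¹` and differs from it only inside the disc `B_R(x)`, so
it has compact support in `Ω` as well. -/
theorem IsRadius.average_W0_of_contDiff [FiniteDimensional ℝ E] (h : IsRadius x R ρ)
    {Ω : Set Plane} (hΩ : IsOpen Ω) (hb : Metric.closedBall x R ⊆ Ω) {φ : Plane → E}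
    (hφ : ContDiff ℝ 1 φ) (hc : HasCompactSupport φ) (hs : tsupport φ ⊆ Ω) :
    W0 Ω (average ρ φ) (averageDeriv ρ (fderiv ℝ φ)) := by
  have hC : ContDiff ℝ 1 (average ρ φ) :=
    contDiff_one_iff_hasFDerivAt.2 ⟨_, h.continuous_averageDeriv hφ hc,
      h.hasFDerivAt_average hφ hc⟩
  have hK : IsCompact (tsupport φ ∪ Metric.closedBall x R) :=
    IsCompact.union hc (isCompact_closedBall x R)
  have hsub : tsupport (average ρ φ) ⊆ tsupport φ ∪ Metric.closedBall x R := by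
    refine closure_minimal (fun z hz => ?_) hK.isClosed
    by_cases hzb : z ∈ Metric.ball x R
    · exact Or.inr (Metric.ball_subset_closedBall hzb)
    · left
      rw [Function.mem_support, h.average_of_notMem hzb] at hz
      exact subset_closure hz
  have h1 := W0.of_contDiff hΩ hC (hK.of_isClosed_subset (isClosed_tsupport _) hsub)
    (hsub.trans (Set.union_subset hs hb))
  have h2 : fderiv ℝ (average ρ φ) = averageDeriv ρ (fderiv ℝ φ) := by
    ext1 z; exact (h.hasFDerivAt_average hφ hc z).fderiv
  rwa [h2] at h1

/-- Averaging preserves `W₀^{1,2}`. -/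
theorem W0.average [FiniteDimensional ℝ E] (h : IsRadius x R ρ)
    {Ω : Set Plane} (hΩ : IsOpen Ω) (hb : Metric.closedBall x R ⊆ Ω) {f : Plane → E}
    {g : Plane → Plane →L[ℝ] E} (hf : W0 Ω f g) :
    W0 Ω (average ρ f) (averageDeriv ρ g) := by
  obtain ⟨φ, hφ, h1, h2⟩ := hf.exists_approx
  refine W0.of_tendsto (isWeight_id.stronglyMeasurable_weightedAverage h hf.meas)
    (h.isWeight.stronglyMeasurable_weightedAverage h hf.meas_deriv)
    (fun n => h.average_W0_of_contDiff hΩ hb (hφ n).contDiff_one (hφ n).compact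
      (hφ n).support_subset) ?_ ?_
  · exact isWeight_id.tendsto h hf.meas hf.memLp
      (fun n => (hφ n).smooth.continuous.stronglyMeasurable)
      (fun n => memLp_of_C1 (hφ n).contDiff_one (hφ n).compact) h1
  · exact h.isWeight.tendsto h hf.meas_deriv hf.memLp_deriv
      (fun n => (continuous_fderiv_of_C1 (hφ n).contDiff_one).stronglyMeasurable)
      (fun n => memLp_fderiv_of_C1 (hφ n).contDiff_one (hφ n).compact) h2

end Average

/-! ### Continuity of the degree -/

section BilinearLimits

variable {F G H : Type*} [NormedAddCommGroup F] [NormedSpace ℝ F] [NormedAddCommGroup G]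
  [NormedSpace ℝ G] [NormedAddCommGroup H] [NormedSpace ℝ H]

/-- A bounded sequence that converges almost everywhere acts continuously on sequences that
converge in `L²`. -/
theorem tendsto_eLpNorm_bilin_of_ae {α : Type*} [MeasurableSpace α] {μ : Measure α}
    (B : F →L[ℝ] G →L[ℝ] H)
    {an : ℕ → α → F} {a : α → F} {bn : ℕ → α → G} {b : α → G} {c : ℝ≥0}
    (han : ∀ n, AEStronglyMeasurable (an n) μ) (ha : AEStronglyMeasurable a μ)
    (hbn : ∀ n, AEStronglyMeasurable (bn n) μ) (hb : MemLp b 2 μ)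
    (hc : ∀ n, ∀ᵐ x ∂μ, ‖an n x‖ ≤ c) (hc' : ∀ᵐ x ∂μ, ‖a x‖ ≤ c)
    (h1 : ∀ᵐ x ∂μ, Tendsto (fun n => an n x) atTop (𝓝 (a x)))
    (h2 : Tendsto (fun n => eLpNorm (bn n - b) 2 μ) atTop (𝓝 0)) :
    Tendsto (fun n => eLpNorm ((fun x => B (an n x) (bn n x)) - fun x => B (a x) (b x)) 2 μ)
      atTop (𝓝 0) := by
  have hm : ∀ {p : α → F} {q : α → G}, AEStronglyMeasurable p μ → AEStronglyMeasurable q μ →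
      AEStronglyMeasurable (fun x => B (p x) (q x)) μ := fun hp hq =>
    B.aestronglyMeasurable_comp₂ hp hq
  refine tendsto_eLpNorm_add (u := fun n x => B (an n x) (bn n x - b x))
    (v := fun n x => B (an n x - a x) (b x))
    (fun n => hm (han n) ((hbn n).sub hb.1)) (fun n => hm ((han n).sub ha) hb.1) ?_ ?_ ?_
  · have hlim : Tendsto (fun n => ((‖B‖₊ * c : ℝ≥0) : ℝ≥0∞) * eLpNorm (bn n - b) 2 μ)
        atTop (𝓝 0) := by
      simpa using ENNReal.Tendsto.const_mul (a := ((‖B‖₊ * c : ℝ≥0) : ℝ≥0∞)) h2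
        (Or.inr ENNReal.coe_ne_top)
    refine tendsto_of_tendsto_of_tendsto_of_le_of_le tendsto_const_nhds hlim
      (fun _ => zero_le) fun n => ?_
    refine eLpNorm_le_nnreal_smul_eLpNorm_of_ae_le_mul (c := ‖B‖₊ * c) ?_ 2
    filter_upwards [hc n] with x hx
    refine NNReal.coe_le_coe.1 ?_
    push_cast
    refine (B.le_opNorm₂ _ _).trans ?_
    simp only [Pi.sub_apply]
    gcongr
  · refine tendsto_eLpNorm_zero_of_dominated hb (c := ‖B‖₊ * (2 * c))
      (fun n => hm ((han n).sub ha) hb.1) (fun n => ?_) ?_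
    · filter_upwards [hc n, hc'] with x hx hx'
      refine (B.le_opNorm₂ _ _).trans ?_
      push_cast
      gcongr
      exact (norm_sub_le _ _).trans (by linarith)
    · filter_upwards [h1] with x hx
      have h3 : Tendsto (fun n => an n x - a x) atTop (𝓝 0) := by
        simpa using hx.sub_const (a x)
      have hcont : Continuous (fun y : F => B y (b x)) := by fun_prop
      have := (hcont.tendsto 0).comp h3
      simpa [Function.comp_def] using this
  · intro n
    ext x
    simp

end BilinearLimits

section DegreeLimit

/-- The cross product as a continuous bilinear map. -/
def crossCLM : Space →L[ℝ] Space →L[ℝ] Space :=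
  LinearMap.toContinuousBilinearMap (LinearMap.mk₂ ℝ
    (fun m a : Space => (WithLp.toLp 2 (m.ofLp ⨯₃ a.ofLp) : Space))
    (fun m m' a => by simp) (fun c m a => by simp) (fun m a a' => by simp) (fun c m a => by simp))

theorem jac_eq_inner (m a b : Space) : jac m a b = inner ℝ (crossCLM m a) b := by
  rw [jac_eq, inner_eq_sum]
  simp [crossCLM, cross_apply]
  ring

/-- The degree is continuous under strong convergence of sphere-valued maps in `W^{1,2}`. -/
theorem tendsto_degInt {Ω : Set Plane} {un : ℕ → Plane → Space}
    {gn : ℕ → Plane → Plane →L[ℝ] Space} {u : Plane → Space} {g : Plane → Plane →L[ℝ] Space}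
    (hn : ∀ n, SphereMap Ω (un n) (gn n)) (h : SphereMap Ω u g)
    (h1 : ∀ᵐ x, Tendsto (fun n => un n x) atTop (𝓝 (u x)))
    (h2 : Tendsto (fun n => eLpNorm (gn n - g) 2 volume) atTop (𝓝 0)) :
    Tendsto (fun n => degInt (un n) (gn n)) atTop (𝓝 (degInt u g)) := by
  have hg : ∀ v, Tendsto (fun n => eLpNorm ((fun x => gn n x v) - fun x => g x v) 2 volume)
      atTop (𝓝 0) := fun v =>
    tendsto_eLpNorm_clm (ContinuousLinearMap.apply ℝ Space v) h2
  have hms : ∀ {u : Plane → Space} {g : Plane → Plane →L[ℝ] Space}, SphereMap Ω u g →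
      AEStronglyMeasurable (fun x => u x - e₃) volume := fun h =>
    h.w0.meas.aestronglyMeasurable.sub aestronglyMeasurable_const
  have hmem : ∀ {u : Plane → Space} {g : Plane → Plane →L[ℝ] Space}, SphereMap Ω u g →
      MemLp (fun x => crossCLM (u x - e₃) (g x (bx 0))) 2 volume := by
    intro u g h
    refine (memLp_deriv_apply h.w0 (bx 0)).of_le_mul (c := ‖crossCLM‖)
      (crossCLM.aestronglyMeasurable_comp₂ (hms h) (memLp_deriv_apply h.w0 (bx 0)).1)
      (Eventually.of_forall fun x => ?_)
    refine (crossCLM.le_opNorm₂ _ _).trans ?_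
    rw [h.unit, mul_one]
  have hL := tendsto_eLpNorm_bilin_of_ae crossCLM (an := fun n x => un n x - e₃)
    (a := fun x => u x - e₃) (c := 1) (fun n => hms (hn n)) (hms h)
    (fun n => (memLp_deriv_apply (hn n).w0 (bx 0)).1) (memLp_deriv_apply h.w0 (bx 0))
    (fun n => Eventually.of_forall fun x => by simp [(hn n).unit x])
    (Eventually.of_forall fun x => by simp [h.unit x])
    (h1.mono fun x hx => hx.sub_const e₃) (hg (bx 0))
  have := tendsto_integral_bilin (innerSL ℝ) (fun n => hmem (hn n))
    (fun n => memLp_deriv_apply (hn n).w0 (bx 1)) (hmem h) (memLp_deriv_apply h.w0 (bx 1)) hL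
    (hg (bx 1))
  simp only [degInt, jac_eq_inner]
  exact this

end DegreeLimit

/-! ### Radial retraction onto the sphere -/

section Retraction

/-- The radial retraction `y ↦ e₃ + (y - e₃) / |y - e₃|` onto the unit sphere centred at `e₃`. -/
def retract (y : Space) : Space := e₃ + ‖y - e₃‖⁻¹ • (y - e₃)

theorem retract_sub (y : Space) : retract y - e₃ = ‖y - e₃‖⁻¹ • (y - e₃) := by simp [retract]

theorem norm_retract_sub {y : Space} (hy : y ≠ e₃) : ‖retract y - e₃‖ = 1 := by
  have : ‖y - e₃‖ ≠ 0 := norm_ne_zero_iff.2 (sub_ne_zero.2 hy)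
  rw [retract_sub, norm_smul, norm_inv, norm_norm, inv_mul_cancel₀ this]

theorem retract_of_norm {y : Space} (hy : ‖y - e₃‖ = 1) : retract y = y := by
  simp [retract, hy]

theorem retract_zero : retract 0 = 0 := retract_of_norm (by simp [norm_e₃])

theorem inner_retract_nonneg {y z : Space} (h : 0 ≤ inner ℝ (y - e₃) (z - e₃)) :
    0 ≤ inner ℝ (retract y - e₃) (retract z - e₃) := by
  rw [retract_sub, retract_sub, real_inner_smul_left, real_inner_smul_right]
  positivity

theorem norm_retract_le {y : Space} (hy : y ≠ e₃) : ‖retract y‖ ≤ 2 * ‖y‖ := by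
  have h0 : 0 < ‖y - e₃‖ := norm_pos_iff.2 (sub_ne_zero.2 hy)
  have h1 : ‖retract y - y‖ = |1 - ‖y - e₃‖| := by
    have : retract y - y = (‖y - e₃‖⁻¹ - 1) • (y - e₃) := by
      rw [retract]; module
    rw [this, norm_smul, Real.norm_eq_abs, ← abs_of_pos h0, ← abs_mul, abs_of_pos h0, sub_mul,
      inv_mul_cancel₀ h0.ne', one_mul]
  have h2 : |1 - ‖y - e₃‖| ≤ ‖y‖ := by
    have h3 := abs_norm_sub_norm_le (-e₃) (y - e₃)
    rw [norm_neg, norm_e₃] at h3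
    refine h3.trans (le_of_eq ?_)
    rw [← norm_neg]; congr 1; abel
  calc ‖retract y‖ = ‖(retract y - y) + y‖ := by simp
    _ ≤ ‖retract y - y‖ + ‖y‖ := norm_add_le _ _
    _ ≤ _ := by linarith

theorem hasFDerivAt_retract {y : Space} (hy : y ≠ e₃) : HasFDerivAt retract
    (‖y - e₃‖⁻¹ • (ContinuousLinearMap.id ℝ Space -
      (‖y - e₃‖⁻¹ ^ 2 • innerSL ℝ (y - e₃)).smulRight (y - e₃))) y := by
  have h0 : 0 < ‖y - e₃‖ := norm_pos_iff.2 (sub_ne_zero.2 hy)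
  have h1 : HasFDerivAt (fun y : Space => y - e₃) (ContinuousLinearMap.id ℝ Space) y :=
    (hasFDerivAt_id y).sub_const e₃
  have h2 : HasFDerivAt (fun y : Space => √(‖y - e₃‖ ^ 2)) _ y :=
    (h1.norm_sq).sqrt (by positivity)
  simp only [Real.sqrt_sq (norm_nonneg _)] at h2
  have h3 := ((hasDerivAt_inv h0.ne').comp_hasFDerivAt y h2).smul h1
  refine (h3.const_add e₃).congr_fderiv ?_
  ext a
  simp [ContinuousLinearMap.smulRight_apply]
  field_simp
  ring

theorem contDiffOn_retract : ContDiffOn ℝ 1 retract {y | y ≠ e₃} := by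
  intro y hy
  have h0 : y - e₃ ≠ 0 := sub_ne_zero.2 hy
  have h1 : ContDiffAt ℝ 1 (fun y : Space => y - e₃) y := contDiffAt_id.sub contDiffAt_const
  have h2 : ContDiffAt ℝ 1 (fun y : Space => ‖y - e₃‖⁻¹) y :=
    (h1.norm ℝ h0).inv (norm_ne_zero_iff.2 h0)
  exact (contDiffAt_const.add (h2.smul h1)).contDiffWithinAt

theorem norm_fderiv_retract_le {y : Space} (hy : y ≠ e₃) :
    ‖fderiv ℝ retract y‖ ≤ 2 * ‖y - e₃‖⁻¹ := by
  have h0 : 0 < ‖y - e₃‖ := norm_pos_iff.2 (sub_ne_zero.2 hy)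
  rw [(hasFDerivAt_retract hy).fderiv, norm_smul, norm_inv, norm_norm, mul_comm]
  gcongr
  refine (norm_sub_le _ _).trans ?_
  have h1 := ContinuousLinearMap.norm_id_le (𝕜 := ℝ) (E := Space)
  rw [ContinuousLinearMap.norm_smulRight_apply, norm_smul, innerSL_apply_norm, norm_pow, norm_inv,
    norm_norm]
  have : ‖y - e₃‖⁻¹ ^ 2 * ‖y - e₃‖ * ‖y - e₃‖ = 1 := by field_simp
  linarith

theorem fderiv_retract_of_tangent {y a : Space} (hy : ‖y - e₃‖ = 1)
    (ha : inner ℝ (y - e₃) a = 0) : fderiv ℝ retract y a = a := by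
  have hne : y ≠ e₃ := fun h => by simp [h] at hy
  rw [(hasFDerivAt_retract hne).fderiv]
  rw [inner_sub_left] at ha
  simp [hy, ha]

theorem isOpen_ne_e₃ : IsOpen {y : Space | y ≠ e₃} := isOpen_ne

/-- The retraction of a `W₀^{1,2}` map with values in the shell `1 / 2 ≤ |y - e₃| ≤ 1`. -/
theorem W0.retract {Ω : Set Plane} (hΩ : IsOpen Ω) {v : Plane → Space}
    {k : Plane → Plane →L[ℝ] Space} (h : W0 Ω v k) (h1 : ∀ x, 1 / 2 ≤ ‖v x - e₃‖)
    (h2 : ∀ x, ‖v x - e₃‖ ≤ 1) : SphereMap Ω (fun x => Skyrmion.retract (v x))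
      (fun x => (fderiv ℝ Skyrmion.retract (v x)).comp (k x)) := by
  have hne : ∀ y : Space, 1 / 2 ≤ ‖y - e₃‖ → y ≠ e₃ := fun y hy h0 => by
    rw [h0] at hy; norm_num at hy
  refine ⟨h.comp_of_mem hΩ (K := {y | 1 / 2 ≤ ‖y - e₃‖} ∩ Metric.closedBall e₃ 1) ?_
    isOpen_ne_e₃ (fun y hy => hne y hy.1) contDiffOn_retract (fun x => ⟨h1 x, ?_⟩) ⟨?_, ?_⟩
    retract_zero, fun x => norm_retract_sub (hne _ (h1 x))⟩
  · exact (isCompact_closedBall _ _).inter_left (isClosed_le (by fun_prop) (by fun_prop))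
  · rw [mem_closedBall_iff_norm]; exact h2 x
  · simp [norm_e₃]; norm_num
  · simp [norm_e₃]

end Retraction

/-! ### Averages over shrinking discs -/

section AverageLimit

variable {E : Type*} [NormedAddCommGroup E] [NormedSpace ℝ E] [CompleteSpace E]
  {x : Plane} {R : ℝ} {ρn : ℕ → Plane → ℝ} {Ln : ℕ → Plane → Plane → E →L[ℝ] E}

/-- For continuous functions weighted averages over shrinking discs converge pointwise, and hence in
`L²`, as they change only inside `B_R(x)`. -/
theorem tendsto_weightedAverage_of_continuous (h : ∀ n, IsRadius x R (ρn n))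
    (hL : ∀ n, IsWeight (Ln n)) (hρ : ∀ z, Tendsto (fun n => ρn n z) atTop (𝓝 0))
    (hlim : ∀ z w, Tendsto (fun n => Ln n z w) atTop (𝓝 (ContinuousLinearMap.id ℝ E)))
    (hoff : ∀ n, ∀ z ∉ Metric.ball x R, ∀ w, Ln n z w = ContinuousLinearMap.id ℝ E)
    {φ : Plane → E} (hφ : Continuous φ) (hc : HasCompactSupport φ) :
    Tendsto (fun n => eLpNorm (weightedAverage (ρn n) (Ln n) φ - φ) 2 volume) atTop (𝓝 0) := by
  obtain ⟨C, hC⟩ := hc.exists_bound_of_continuous hφ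
  have hC0 : 0 ≤ C := (norm_nonneg _).trans (hC 0)
  lift C to ℝ≥0 using hC0
  have hm : ∀ n, StronglyMeasurable (weightedAverage (ρn n) (Ln n) φ) := fun n =>
    (hL n).stronglyMeasurable_weightedAverage (h n) hφ.stronglyMeasurable
  have hb : ∀ n z, ∀ᵐ w ∂unifBall, ‖Ln n z w (φ (z + ρn n z • w))‖ ≤ 2 * C := by
    intro n z
    filter_upwards [ae_unifBall] with w hw
    refine (ContinuousLinearMap.le_opNorm _ _).trans ?_
    gcongr
    exacts [(hL n).norm_le z w hw, hC _]
  have hind : MemLp (Set.indicator (Metric.closedBall x R) fun _ : Plane => (1 : ℝ)) 2 volume :=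
    memLp_indicator_const 2 measurableSet_closedBall 1
      (Or.inr measure_closedBall_lt_top.ne)
  refine tendsto_eLpNorm_zero_of_dominated hind (c := 3 * C)
    (fun n => ((hm n).sub hφ.stronglyMeasurable).aestronglyMeasurable)
    (fun n => Eventually.of_forall fun z => ?_) (Eventually.of_forall fun z => ?_)
  · by_cases hz : z ∈ Metric.ball x R
    · rw [Set.indicator_of_mem (Metric.ball_subset_closedBall hz)]
      push_cast
      simp only [Pi.sub_apply, norm_one, mul_one]
      refine (norm_sub_le _ _).trans ?_
      have h1 := norm_integral_le_of_norm_le_const (hb n z)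
      simp only [probReal_univ, mul_one] at h1
      have h2 := hC z
      unfold weightedAverage
      linarith
    · have : weightedAverage (ρn n) (Ln n) φ z = φ z := by
        simp [weightedAverage, hoff n z hz, (h n).eq_zero z hz]
      simp [this]
      positivity
  · have h1 : Tendsto (fun n => weightedAverage (ρn n) (Ln n) φ z) atTop (𝓝 (φ z)) := by
      have h2 : φ z = ∫ _, φ z ∂unifBall := by simp
      rw [h2]
      refine tendsto_integral_of_dominated_convergence (fun _ => 2 * C) (fun n => ?_)
        (integrable_const _) (fun n => hb n z) (Eventually.of_forall fun w => ?_)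
      · exact (((hL n).stronglyMeasurable (h n) hφ.stronglyMeasurable).comp_measurable
          (measurable_prodMk_left (x := z))).aestronglyMeasurable
      · have h3 : Tendsto (fun n => φ (z + ρn n z • w)) atTop (𝓝 (φ z)) := by
          refine (hφ.tendsto _).comp ?_
          have := ((hρ z).smul_const w).const_add z
          simpa using this
        have h4 := ((isBoundedBilinearMap_apply (𝕜 := ℝ) (E := E) (F := E)).continuous.tendsto
          (ContinuousLinearMap.id ℝ E, φ z)).comp ((hlim z w).prodMk_nhds h3)
        simpa [Function.comp_def] using h4
    simpa using h1.sub_const (φ z)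

/-- Weighted averages over shrinking discs converge in `L²`, by approximation with continuous
functions and the uniform bound `IsWeight.eLpNorm_le`. -/
theorem tendsto_weightedAverage (h : ∀ n, IsRadius x R (ρn n))
    (hL : ∀ n, IsWeight (Ln n)) (hρ : ∀ z, Tendsto (fun n => ρn n z) atTop (𝓝 0))
    (hlim : ∀ z w, Tendsto (fun n => Ln n z w) atTop (𝓝 (ContinuousLinearMap.id ℝ E)))
    (hoff : ∀ n, ∀ z ∉ Metric.ball x R, ∀ w, Ln n z w = ContinuousLinearMap.id ℝ E)
    {f : Plane → E} (hf : StronglyMeasurable f) (h2 : MemLp f 2 volume) {φ : ℕ → Plane → E}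
    (hφ : ∀ k, Continuous (φ k)) (hc : ∀ k, HasCompactSupport (φ k))
    (happ : Tendsto (fun k => eLpNorm (φ k - f) 2 volume) atTop (𝓝 0)) :
    Tendsto (fun n => eLpNorm (weightedAverage (ρn n) (Ln n) f - f) 2 volume) atTop (𝓝 0) := by
  rw [ENNReal.tendsto_atTop_zero]
  intro ε hε
  have hε8 : 0 < ε / 8 := ENNReal.div_pos hε.ne' (by norm_num)
  obtain ⟨k, hk⟩ := (ENNReal.tendsto_atTop_zero.1 happ) (ε / 8) hε8
  obtain ⟨N, hN⟩ := (ENNReal.tendsto_atTop_zero.1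
    (tendsto_weightedAverage_of_continuous h hL hρ hlim hoff (hφ k) (hc k))) (ε / 8) hε8
  refine ⟨N, fun n hn => ?_⟩
  have hφL : MemLp (φ k) 2 volume := (hφ k).memLp_of_hasCompactSupport (hc k)
  have hm := (hL n).stronglyMeasurable_weightedAverage (h n) hf
  have hm' := (hL n).stronglyMeasurable_weightedAverage (h n) (hφ k).stronglyMeasurable
  have e1 : weightedAverage (ρn n) (Ln n) f - f =
      (weightedAverage (ρn n) (Ln n) f - weightedAverage (ρn n) (Ln n) (φ k)) +
      ((weightedAverage (ρn n) (Ln n) (φ k) - φ k) + (φ k - f)) := by abel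
  have e2 : eLpNorm (weightedAverage (ρn n) (Ln n) f - weightedAverage (ρn n) (Ln n) (φ k)) 2
      volume ≤ 3 * eLpNorm (φ k - f) 2 volume := by
    rw [(hL n).sub (h n) hf h2 (hφ k).stronglyMeasurable hφL, eLpNorm_sub_comm (φ k) f]
    exact (hL n).eLpNorm_le (h n) (hf.sub (hφ k).stronglyMeasurable)
  have e3 := hk k le_rfl
  have e4 := hN n hn
  rw [e1]
  refine (eLpNorm_add_le (hm.sub hm').aestronglyMeasurable
    ((hm'.sub (hφ k).stronglyMeasurable).add
      ((hφ k).stronglyMeasurable.sub hf)).aestronglyMeasurable (by norm_num)).trans ?_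
  refine (add_le_add le_rfl (eLpNorm_add_le (hm'.sub (hφ k).stronglyMeasurable).aestronglyMeasurable
      ((hφ k).stronglyMeasurable.sub hf).aestronglyMeasurable (by norm_num))).trans ?_
  calc _ ≤ 3 * (ε / 8) + (ε / 8 + ε / 8) := by
        refine add_le_add (e2.trans ?_) (add_le_add e4 e3)
        gcongr
    _ = 5 * (ε / 8) := by ring
    _ ≤ 8 * (ε / 8) := by gcongr; norm_num
    _ = ε := ENNReal.mul_div_cancel (by norm_num) (by norm_num)

end AverageLimit

section AverageConvergence

variable {E : Type*} [NormedAddCommGroup E] [NormedSpace ℝ E] [CompleteSpace E]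
  {x : Plane} {R : ℝ} {ρ : Plane → ℝ} {s : ℕ → ℝ}

/-- Averages over discs of radius `s n * ρ` converge in `W^{1,2}` as `s n → 0`. -/
theorem W0.tendsto_average {Ω : Set Plane} {f : Plane → E} {g : Plane → Plane →L[ℝ] E}
    (hf : W0 Ω f g) (h : IsRadius x R ρ) (h0 : ∀ n, 0 ≤ s n) (h1 : ∀ n, s n ≤ 1)
    (hs : Tendsto s atTop (𝓝 0)) :
    Tendsto (fun n => eLpNorm (Skyrmion.average (fun z => s n * ρ z) f - f) 2 volume) atTop (𝓝 0) ∧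
    Tendsto (fun n => eLpNorm (averageDeriv (fun z => s n * ρ z) g - g) 2 volume)
      atTop (𝓝 0) := by
  have hr : ∀ n, IsRadius x R (fun z => s n * ρ z) := fun n => h.const_mul (h0 n) (h1 n)
  have hρ : ∀ z, Tendsto (fun n => s n * ρ z) atTop (𝓝 0) := fun z => by
    simpa using hs.mul_const (ρ z)
  obtain ⟨φ, hφ, a1, a2⟩ := hf.exists_approx
  refine ⟨tendsto_weightedAverage hr (fun _ => isWeight_id) hρ (fun _ _ => tendsto_const_nhds)
    (fun _ _ _ _ => rfl) hf.meas hf.memLp (fun k => (hφ k).smooth.continuous)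
    (fun k => (hφ k).compact) a1, ?_⟩
  refine tendsto_weightedAverage hr (fun n => (hr n).isWeight) hρ (fun z w => ?_)
    (fun n z hz w => ?_) hf.meas_deriv hf.memLp_deriv
    (fun k => continuous_fderiv_of_C1 (hφ k).contDiff_one)
    (fun k => (hφ k).compact.fderiv (𝕜 := ℝ)) a2
  · have e1 : Tendsto (fun n => shiftDeriv (fun z => s n * ρ z) w z) atTop
        (𝓝 (ContinuousLinearMap.id ℝ Plane)) := by
      have e2 : ∀ n, shiftDeriv (fun z => s n * ρ z) w z =
          ContinuousLinearMap.id ℝ Plane + s n • (fderiv ℝ ρ z).smulRight w := by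
        intro n
        rw [shiftDeriv, ((h.hasFDerivAt z).const_mul (s n)).fderiv]
        congr 1
        ext v : 1
        simp [mul_smul]
      simp_rw [e2]
      have e6 : Continuous fun r : ℝ => ContinuousLinearMap.id ℝ Plane +
          r • (fderiv ℝ ρ z).smulRight w := by fun_prop
      have e7 : ContinuousLinearMap.id ℝ Plane + (0 : ℝ) • (fderiv ℝ ρ z).smulRight w =
          ContinuousLinearMap.id ℝ Plane := by ext v : 1; simp
      have e8 := (e6.tendsto 0).comp hs
      rw [e7] at e8
      exact e8
    have e3 := (((ContinuousLinearMap.compL ℝ Plane Plane E).flip.continuous).tendsto _).comp e1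
    have e4 : (ContinuousLinearMap.compL ℝ Plane Plane E).flip (ContinuousLinearMap.id ℝ Plane) =
        ContinuousLinearMap.id ℝ (Plane →L[ℝ] E) := by ext; simp
    rw [e4] at e3
    exact e3
  · have e5 : shiftDeriv (fun z => s n * ρ z) w z = ContinuousLinearMap.id ℝ Plane := by
      rw [shiftDeriv, (hr n).fderiv_eq_zero ((hr n).eq_zero z hz)]
      ext; simp
    rw [e5]
    ext; simp

end AverageConvergence

/-! ### Averages of sphere-valued maps with small energy -/

section Closeness

theorem norm_sq_le_of_enorm_sq_le {E : Type*} [NormedAddCommGroup E] {a : E} {c : ℝ} (hc : 0 ≤ c)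
    (h : ‖a‖ₑ ^ 2 ≤ ENNReal.ofReal c) : ‖a‖ ^ 2 ≤ c := by
  rw [← ofReal_norm, ← ENNReal.ofReal_pow (norm_nonneg _)] at h
  exact (ENNReal.ofReal_le_ofReal_iff hc).1 h

variable {E : Type*} [NormedAddCommGroup E] [NormedSpace ℝ E] [CompleteSpace E]

/-- The averages of `u` over a disc and over a larger disc differ little if the Dirichlet energy in
the larger one is small. -/
theorem W0.norm_average_sub_sq_le {Ω : Set Plane} {u : Plane → E} {g : Plane → Plane →L[ℝ] E}
    (h : W0 Ω u g) {z x : Plane} {t R δ : ℝ} (ht : 0 < t) (hR : 0 < R) (hδ : 0 ≤ δ)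
    (hs : Metric.ball z t ⊆ Metric.ball x R)
    (hX : ∫⁻ y in Metric.ball x R, ‖g y‖ₑ ^ 2 ≤ ENNReal.ofReal δ) :
    ‖(∫ w, u (z + t • w) ∂unifBall) - ∫ w, u (x + R • w) ∂unifBall‖ ^ 2 ≤
      (R / t) ^ 2 * (16 * δ) := by
  refine norm_sq_le_of_enorm_sq_le (by positivity) ?_
  have hm : StronglyMeasurable fun p : Plane × Plane => u (z + t • p.1) - u (x + R • p.2) :=
    (h.meas.comp_measurable (by fun_prop)).sub (h.meas.comp_measurable (by fun_prop))
  have hm2 : StronglyMeasurable fun p : Plane × Plane => u (x + R • p.1) - u (x + R • p.2) :=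
    (h.meas.comp_measurable (by fun_prop)).sub (h.meas.comp_measurable (by fun_prop))
  refine (enorm_integral_sub_sq_le (integrable_unifBall h.meas h.memLp z ht.le)
    (integrable_unifBall h.meas h.memLp x hR.le)).trans ?_
  have e1 : ∫⁻ p, ‖u (z + t • p.1) - u (x + R • p.2)‖ₑ ^ 2 ∂(unifBall.prod unifBall) ≤
      ENNReal.ofReal ((R / t) ^ 2) *
        ∫⁻ p, ‖u (x + R • p.1) - u (x + R • p.2)‖ₑ ^ 2 ∂(unifBall.prod unifBall) := by
    rw [lintegral_prod_symm' _ (hm.enorm.pow_const 2), lintegral_prod_symm' _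
      (hm2.enorm.pow_const 2), ← lintegral_const_mul' _ _ ENNReal.ofReal_ne_top]
    refine lintegral_mono fun w' => ?_
    exact lintegral_unifBall_mono (fun y => ‖u y - u (x + R • w')‖ₑ ^ 2) ht hR hs
  refine e1.trans ?_
  rw [ENNReal.ofReal_mul (by positivity)]
  refine mul_le_mul' le_rfl ?_
  refine (h.lintegral_sub_sq_le x hR).trans ?_
  rw [ENNReal.ofReal_mul (by norm_num)]
  refine mul_le_mul' (by norm_num) hX

/-- If the Dirichlet energy in a disc is small, the average of a sphere-valued map over the disc is
close to the sphere. -/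
theorem SphereMap.le_norm_average_sub {Ω : Set Plane} {u : Plane → Space}
    {g : Plane → Plane →L[ℝ] Space} (h : SphereMap Ω u g) {z : Plane} {t c : ℝ} (ht : 0 < t)
    (hc : 0 ≤ c)
    (hX : 16 * ∫⁻ y in Metric.ball z t, ‖g y‖ₑ ^ 2 ≤ ENNReal.ofReal (c ^ 2)) :
    1 - c ≤ ‖(∫ w, u (z + t • w) ∂unifBall) - e₃‖ := by
  have hm : StronglyMeasurable fun p : Plane × Plane => u (z + t • p.1) - u (z + t • p.2) :=
    (h.w0.meas.comp_measurable (by fun_prop)).sub (h.w0.meas.comp_measurable (by fun_prop))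
  have hme : Measurable fun p : Plane × Plane => ‖u (z + t • p.1) - u (z + t • p.2)‖ₑ ^ 2 :=
    hm.enorm.pow_const 2
  -- A point at which the mean square distance to the other values is at most its average: the
  -- average of `u` is close to the value there, which lies on the sphere.
  obtain ⟨w₀, hw₀⟩ := exists_le_lintegral (μ := unifBall) (f := fun w =>
    ∫⁻ w', ‖u (z + t • w) - u (z + t • w')‖ₑ ^ 2 ∂unifBall)
    (hme.lintegral_prod_right').aemeasurable
  rw [← lintegral_prod _ hme.aemeasurable] at hw₀
  have hint := integrable_unifBall h.w0.meas h.w0.memLp z ht.le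
  have h1 : ‖u (z + t • w₀) - ∫ w, u (z + t • w) ∂unifBall‖ₑ ^ 2 ≤ ENNReal.ofReal (c ^ 2) := by
    have e : u (z + t • w₀) - ∫ w, u (z + t • w) ∂unifBall =
        ∫ w, (u (z + t • w₀) - u (z + t • w)) ∂unifBall := by
      rw [integral_sub (integrable_const _) hint]
      simp
    rw [e]
    refine (enorm_integral_sq_le ((integrable_const _).sub hint).aestronglyMeasurable).trans ?_
    exact hw₀.trans ((h.w0.lintegral_sub_sq_le z ht).trans hX)
  have h2 := norm_sq_le_of_enorm_sq_le (by positivity) h1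
  have h3 := abs_le_of_sq_le_sq' h2 hc
  have h4 := norm_sub_norm_le (u (z + t • w₀) - e₃) (u (z + t • w₀) - ∫ w, u (z + t • w) ∂unifBall)
  rw [h.unit] at h4
  have h5 : (u (z + t • w₀) - e₃) - (u (z + t • w₀) - ∫ w, u (z + t • w) ∂unifBall) =
      (∫ w, u (z + t • w) ∂unifBall) - e₃ := by abel
  rw [h5] at h4
  linarith [h3.2]

theorem SphereMap.norm_average_sub_le {Ω : Set Plane} {u : Plane → Space}
    {g : Plane → Plane →L[ℝ] Space} (h : SphereMap Ω u g) (z : Plane) {t : ℝ} (ht : 0 ≤ t) :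
    ‖(∫ w, u (z + t • w) ∂unifBall) - e₃‖ ≤ 1 := by
  have e : (∫ w, u (z + t • w) ∂unifBall) - e₃ = ∫ w, (u (z + t • w) - e₃) ∂unifBall := by
    rw [integral_sub (integrable_unifBall h.w0.meas h.w0.memLp z ht) (integrable_const _)]
    simp
  rw [e]
  refine (norm_integral_le_of_norm_le_const (C := 1) (Eventually.of_forall fun w =>
    (h.unit _).le)).trans ?_
  simp

theorem inner_nonneg_of_norm_sub_le {E : Type*} [NormedAddCommGroup E] [InnerProductSpace ℝ E]
    {a b : E} (h : ‖b - a‖ ≤ ‖a‖) : 0 ≤ inner ℝ a b := by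
  have h1 : inner ℝ a b = ‖a‖ ^ 2 + inner ℝ a (b - a) := by
    rw [inner_sub_right, real_inner_self_eq_norm_sq]; ring
  have h2 := abs_le.1 (abs_real_inner_le_norm a (b - a))
  nlinarith [norm_nonneg a, norm_nonneg (b - a)]

end Closeness

/-! ### The degree of retracted averages -/

section DegreeOfAverage

variable {Ω : Set Plane} {u : Plane → Space} {g : Plane → Plane →L[ℝ] Space} {x : Plane} {R : ℝ}
  {ρ : Plane → ℝ}

/-- Under a bound on the Dirichlet energy in `B_R(x)` all averages stay near the unit sphere, and
can be retracted to it. -/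
theorem SphereMap.le_norm_average (h : SphereMap Ω u g) (hρ : IsRadius x R ρ)
    (hX : ∫⁻ y in Metric.ball x R, ‖g y‖ₑ ^ 2 ≤ ENNReal.ofReal ((1 / 2) ^ 20)) (z : Plane) :
    15 / 16 ≤ ‖average ρ u z - e₃‖ := by
  rcases (hρ.nonneg z).eq_or_lt with h0 | h0
  · rw [average_apply]
    simp [← h0, h.unit]
    norm_num
  · have hz : z ∈ Metric.ball x R := by
      by_contra hz
      exact h0.ne' (hρ.eq_zero z hz)
    have := h.le_norm_average_sub (z := z) h0 (c := 1 / 16) (by norm_num) (by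
      calc 16 * ∫⁻ y in Metric.ball z (ρ z), ‖g y‖ₑ ^ 2
          ≤ 16 * ∫⁻ y in Metric.ball x R, ‖g y‖ₑ ^ 2 := by
            gcongr; exact hρ.ball_subset hz
        _ ≤ ENNReal.ofReal 16 * ENNReal.ofReal ((1 / 2) ^ 20) := by gcongr; norm_num
        _ = ENNReal.ofReal (16 * (1 / 2) ^ 20) := (ENNReal.ofReal_mul (by norm_num)).symm
        _ ≤ _ := ENNReal.ofReal_le_ofReal (by norm_num))
    rw [average_apply]
    linarith

theorem SphereMap.norm_average_le (h : SphereMap Ω u g) (hρ : IsRadius x R ρ) (z : Plane) :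
    ‖average ρ u z - e₃‖ ≤ 1 := by
  rw [average_apply]
  exact h.norm_average_sub_le z (hρ.nonneg z)

theorem SphereMap.retract_average (h : SphereMap Ω u g) (hΩ : IsOpen Ω) (hρ : IsRadius x R ρ)
    (hb : Metric.closedBall x R ⊆ Ω)
    (hX : ∫⁻ y in Metric.ball x R, ‖g y‖ₑ ^ 2 ≤ ENNReal.ofReal ((1 / 2) ^ 20)) :
    SphereMap Ω (fun z => retract (average ρ u z))
      (fun z => (fderiv ℝ retract (average ρ u z)).comp (averageDeriv ρ g z)) :=
  W0.retract hΩ (W0.average hρ hΩ hb h.w0)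
    (fun z => le_trans (by norm_num) (h.le_norm_average hρ hX z)) (h.norm_average_le hρ)

/-- Halving the radius does not change the degree of the retracted averages, because the averages
themselves are close to each other. -/
theorem SphereMap.degInt_retract_average_half (h : SphereMap Ω u g) (hΩ : IsOpen Ω)
    (hρ : IsRadius x R ρ) (hb : Metric.closedBall x R ⊆ Ω)
    (hX : ∫⁻ y in Metric.ball x R, ‖g y‖ₑ ^ 2 ≤ ENNReal.ofReal ((1 / 2) ^ 20)) :
    degInt (fun z => retract (average ρ u z))
      (fun z => (fderiv ℝ retract (average ρ u z)).comp (averageDeriv ρ g z)) =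
    degInt (fun z => retract (average (fun z => 1 / 2 * ρ z) u z))
      (fun z => (fderiv ℝ retract (average (fun z => 1 / 2 * ρ z) u z)).comp
        (averageDeriv (fun z => 1 / 2 * ρ z) g z)) := by
  have hρ2 := hρ.const_mul (s := 1 / 2) (by norm_num) (by norm_num)
  have s1 := h.retract_average hΩ hρ hb hX
  have s2 := h.retract_average hΩ hρ2 hb hX
  refine degInt_eq_of_inner_nonneg hΩ s1.w0 s2.w0 s1.unit s2.unit fun z => ?_
  refine inner_retract_nonneg (inner_nonneg_of_norm_sub_le ?_)
  rw [sub_sub_sub_cancel_right]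
  refine le_trans ?_ (h.le_norm_average hρ hX z)
  rcases (hρ.nonneg z).eq_or_lt with h0 | h0
  · rw [average_apply, average_apply]
    simp [← h0]
    norm_num
  · have hz : z ∈ Metric.ball x R := by
      by_contra hz
      exact h0.ne' (hρ.eq_zero z hz)
    have h1 := h.w0.norm_average_sub_sq_le (z := z) (x := z) (t := 1 / 2 * ρ z) (R := ρ z)
      (δ := (1 / 2) ^ 20) (by positivity) h0 (by positivity)
      (Metric.ball_subset_ball (by linarith))
      ((lintegral_mono_set (hρ.ball_subset hz)).trans hX)
    rw [average_apply, average_apply]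
    refine abs_le_of_sq_le_sq' (h1.trans ?_) (by norm_num) |>.2
    have : ρ z / (1 / 2 * ρ z) = 2 := by field_simp
    rw [this]
    norm_num

/-- The retracted averages have the same degree as the original map. -/
theorem SphereMap.degInt_retract_average (h : SphereMap Ω u g) (hΩ : IsOpen Ω)
    (hρ : IsRadius x R ρ) (hb : Metric.closedBall x R ⊆ Ω)
    (hX : ∫⁻ y in Metric.ball x R, ‖g y‖ₑ ^ 2 ≤ ENNReal.ofReal ((1 / 2) ^ 20)) :
    degInt (fun z => retract (average ρ u z))
      (fun z => (fderiv ℝ retract (average ρ u z)).comp (averageDeriv ρ g z)) = degInt u g := by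
  -- All radii `2⁻ᵏ ρ` give the same degree, and the limit `k → ∞` recovers the original map.
  set s : ℕ → ℝ := fun k => (1 / 2) ^ k with hs
  have s0 : ∀ k, 0 ≤ s k := fun k => by positivity
  have s1 : ∀ k, s k ≤ 1 := fun k => pow_le_one₀ (by norm_num) (by norm_num)
  have hr : ∀ k, IsRadius x R (fun z => s k * ρ z) := fun k => hρ.const_mul (s0 k) (s1 k)
  set U : ℕ → Plane → Space := fun k z => retract (average (fun z => s k * ρ z) u z) with hU
  set D : ℕ → Plane → Plane →L[ℝ] Space := fun k z =>
    (fderiv ℝ retract (average (fun z => s k * ρ z) u z)).comp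
      (averageDeriv (fun z => s k * ρ z) g z) with hD
  have hUD : ∀ k, SphereMap Ω (U k) (D k) := fun k => h.retract_average hΩ (hr k) hb hX
  have hconst : ∀ k, degInt (U k) (D k) = degInt (U 0) (D 0) := by
    intro k
    induction k with
    | zero => rfl
    | succ k ih =>
      rw [← ih]
      have h1 := h.degInt_retract_average_half hΩ (hr k) hb hX
      have h2 : (fun z => 1 / 2 * (s k * ρ z)) = fun z => s (k + 1) * ρ z := by
        ext z; simp only [hs]; ring
      rw [h2] at h1
      exact h1.symm
  obtain ⟨a1, a2⟩ := h.w0.tendsto_average hρ s0 s1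
    (tendsto_pow_atTop_nhds_zero_of_lt_one (by norm_num) (by norm_num))
  have hW : ∀ k, W0 Ω (average (fun z => s k * ρ z) u) (averageDeriv (fun z => s k * ρ z) g) :=
    fun k => W0.average (hr k) hΩ hb h.w0
  obtain ⟨ns, hns, hae⟩ := exists_seq_ae_tendsto
    (fun k => (hW k).meas.aestronglyMeasurable) h.w0.meas.aestronglyMeasurable a1
  have hlim : SphereMap Ω (fun z => retract (u z))
      (fun z => (fderiv ℝ retract (u z)).comp (g z)) :=
    W0.retract hΩ h.w0 (fun z => by rw [h.unit]; norm_num) (fun z => (h.unit z).le)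
  have hne : ∀ y : Space, 1 / 2 ≤ ‖y - e₃‖ → y ≠ e₃ := fun y hy h0 => by
    rw [h0] at hy; norm_num at hy
  have hcont := contDiffOn_retract.continuousOn_fderiv_of_isOpen isOpen_ne_e₃ le_rfl
  have hbd : ∀ y : Space, 1 / 2 ≤ ‖y - e₃‖ → ‖fderiv ℝ retract y‖ ≤ (4 : ℝ≥0) := fun y hy => by
    refine (norm_fderiv_retract_le (hne y hy)).trans ?_
    have : ‖y - e₃‖⁻¹ ≤ 2 := by
      rw [inv_le_comm₀ (by linarith) (by norm_num)]; linarith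
    push_cast
    linarith
  have hge : ∀ k z, 1 / 2 ≤ ‖average (fun z => s k * ρ z) u z - e₃‖ := fun k z =>
    le_trans (by norm_num) (h.le_norm_average (hr k) hX z)
  have hmeas : ∀ {v : Plane → Space}, StronglyMeasurable v →
      AEStronglyMeasurable (fun z => fderiv ℝ retract (v z)) volume := fun hv =>
    ((measurable_fderiv ℝ retract).comp hv.measurable).aestronglyMeasurable
  have hgrad := tendsto_eLpNorm_bilin_of_ae (ContinuousLinearMap.compL ℝ Plane Space Space)
    (an := fun k z => fderiv ℝ retract (average (fun z => s (ns k) * ρ z) u z))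
    (a := fun z => fderiv ℝ retract (u z)) (c := 4)
    (bn := fun k => averageDeriv (fun z => s (ns k) * ρ z) g) (b := g) (μ := volume)
    (fun k => hmeas (hW _).meas) (hmeas h.w0.meas)
    (fun k => (hW _).meas_deriv.aestronglyMeasurable) h.w0.memLp_deriv
    (fun k => Eventually.of_forall fun z => hbd _ (hge _ z))
    (Eventually.of_forall fun z => hbd _ (by rw [h.unit]; norm_num))
    (by
      filter_upwards [hae] with z hz
      have hc := (hcont.continuousAt (isOpen_ne_e₃.mem_nhds (hne (u z) (by
        rw [h.unit]; norm_num)))).tendsto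
      exact hc.comp hz)
    (a2.comp hns.tendsto_atTop)
  have hU' : ∀ᵐ z, Tendsto (fun k => U (ns k) z) atTop (𝓝 (retract (u z))) := by
    filter_upwards [hae] with z hz
    have hc := (contDiffOn_retract.continuousOn.continuousAt (isOpen_ne_e₃.mem_nhds
      (hne (u z) (by rw [h.unit]; norm_num)))).tendsto
    exact hc.comp hz
  have ht := tendsto_degInt (fun k => hUD (ns k)) hlim hU' hgrad
  simp only [hconst] at ht
  have e1 := tendsto_nhds_unique ht tendsto_const_nhds
  have e2 : degInt (fun z => retract (u z)) (fun z => (fderiv ℝ retract (u z)).comp (g z)) =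
      degInt u g := by
    refine degInt_eq_of_inner_nonneg hΩ hlim.w0 h.w0 hlim.unit h.unit fun z => ?_
    rw [retract_of_norm (h.unit z)]
    exact real_inner_self_nonneg
  rw [← e2, e1]
  simp [hU, hD, hs]

end DegreeOfAverage

/-! ### Radius functions and cutoff functions -/

section PosSq

/-- The square of the positive part. -/
def posSq (t : ℝ) : ℝ := max t 0 ^ 2

theorem hasDerivAt_posSq (t : ℝ) : HasDerivAt posSq (2 * max t 0) t := by
  rcases lt_trichotomy t 0 with ht | rfl | ht
  · rw [max_eq_right ht.le, mul_zero]
    refine (hasDerivAt_const t (0 : ℝ)).congr_of_eventuallyEq ?_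
    filter_upwards [gt_mem_nhds ht] with s hs
    simp [posSq, max_eq_right hs.le]
  · rw [max_self, mul_zero]
    have h : posSq =O[𝓝 0] fun s : ℝ => ‖s - 0‖ ^ 2 := by
      refine Asymptotics.IsBigO.of_bound 1 (Eventually.of_forall fun s => ?_)
      rw [posSq, norm_pow, one_mul, sub_zero, norm_pow, norm_norm]
      gcongr
      rw [Real.norm_eq_abs, Real.norm_eq_abs, abs_of_nonneg (le_max_right _ _)]
      exact max_le (le_abs_self s) (abs_nonneg s)
    have h2 := h.hasFDerivAt (𝕜 := ℝ) (by norm_num)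
    simpa using h2.hasDerivAt
  · rw [max_eq_left ht.le]
    have h := (hasDerivAt_pow 2 t)
    simp only [Nat.cast_ofNat, Nat.add_one_sub_one, pow_one] at h
    refine h.congr_of_eventuallyEq ?_
    filter_upwards [lt_mem_nhds ht] with s hs
    simp [posSq, max_eq_left hs.le]

theorem contDiff_posSq : ContDiff ℝ 1 posSq := by
  rw [contDiff_one_iff_deriv]
  refine ⟨fun t => (hasDerivAt_posSq t).differentiableAt, ?_⟩
  have : deriv posSq = fun t => 2 * max t 0 := funext fun t => (hasDerivAt_posSq t).deriv
  rw [this]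
  fun_prop

end PosSq

section RadiusAndCutoff

theorem hasFDerivAt_posSq_norm (x : Plane) (R : ℝ) (z : Plane) :
    HasFDerivAt (fun z => posSq (1 - ‖z - x‖ ^ 2 / R ^ 2))
      (-(4 * max (1 - ‖z - x‖ ^ 2 / R ^ 2) 0 / R ^ 2) • innerSL ℝ (z - x)) z := by
  have h1 : HasFDerivAt (fun z : Plane => 1 - ‖z - x‖ ^ 2 * (R ^ 2)⁻¹) _ z :=
    ((((hasFDerivAt_id z).sub_const x).norm_sq).mul_const ((R ^ 2)⁻¹)).const_sub 1
  simp only [← div_eq_mul_inv] at h1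
  have h2 := (hasDerivAt_posSq (1 - ‖z - x‖ ^ 2 / R ^ 2)).comp_hasFDerivAt z h1
  refine h2.congr_fderiv ?_
  ext v
  simp
  ring

/-- A radius function that is comparable to `R` in the inner half of the disc. -/
theorem exists_isRadius (x : Plane) {R : ℝ} (hR : 0 < R) :
    ∃ ρ, IsRadius x R ρ ∧ ∀ z ∈ Metric.ball x (R / 2), R / 16 ≤ ρ z := by
  -- The square makes the function `C¹` across the rim; the factor `1 / 8` gives slope `1 / 2`.
  refine ⟨fun z => R / 8 * posSq (1 - ‖z - x‖ ^ 2 / R ^ 2), ⟨?_, fun z => ?_, fun z hz => ?_,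
    fun z hz => ?_, fun z => ?_⟩, fun z hz => ?_⟩
  · refine contDiff_const.mul (contDiff_posSq.comp ?_)
    have h1 : ContDiff ℝ 1 fun z : Plane => ‖z - x‖ ^ 2 :=
      (contDiff_id.sub contDiff_const).norm_sq ℝ
    exact contDiff_const.sub (h1.div_const _)
  · unfold posSq; positivity
  · rw [mem_ball_iff_norm] at hz
    rw [dist_eq_norm]
    have h0 := norm_nonneg (z - x)
    have hs : ‖z - x‖ ^ 2 / R ^ 2 = (‖z - x‖ / R) ^ 2 := (div_pow _ _ _).symm
    set s := ‖z - x‖ / R with hsd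
    have hs0 : 0 ≤ s := by positivity
    have hs1 : s ≤ 1 := by rw [hsd, div_le_one hR]; exact hz.le
    have hzs : ‖z - x‖ = s * R := by rw [hsd]; field_simp
    rw [hs, posSq, max_eq_left (by nlinarith), hzs]
    have h2 : (1 - s ^ 2) ^ 2 ≤ 8 * (1 - s) := by
      have h3 : (1 - s ^ 2) ≤ 1 := by nlinarith
      have h4 : 0 ≤ 1 - s ^ 2 := by nlinarith
      nlinarith
    nlinarith
  · rw [Metric.mem_ball, not_lt, dist_eq_norm] at hz
    have h1 : 1 ≤ ‖z - x‖ ^ 2 / R ^ 2 := by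
      rw [le_div_iff₀ (by positivity), one_mul]; gcongr
    simp [posSq, max_eq_right (by linarith : 1 - ‖z - x‖ ^ 2 / R ^ 2 ≤ 0)]
  · rw [((hasFDerivAt_posSq_norm x R z).const_mul (R / 8)).fderiv, norm_smul, norm_smul,
      innerSL_apply_norm, norm_neg, Real.norm_of_nonneg (by positivity : 0 ≤ R / 8),
      Real.norm_of_nonneg (by positivity)]
    have h0 := norm_nonneg (z - x)
    rcases le_or_gt R ‖z - x‖ with hz | hz
    · have h1 : 1 ≤ ‖z - x‖ ^ 2 / R ^ 2 := by
        rw [le_div_iff₀ (by positivity), one_mul]; gcongr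
      rw [max_eq_right (by linarith)]
      norm_num
    · have h1 : max (1 - ‖z - x‖ ^ 2 / R ^ 2) 0 ≤ 1 := by
        refine max_le ?_ zero_le_one
        have : 0 ≤ ‖z - x‖ ^ 2 / R ^ 2 := by positivity
        linarith
      have h2 : 0 ≤ max (1 - ‖z - x‖ ^ 2 / R ^ 2) 0 := le_max_right _ _
      calc R / 8 * (4 * max (1 - ‖z - x‖ ^ 2 / R ^ 2) 0 / R ^ 2 * ‖z - x‖)
          ≤ R / 8 * (4 * 1 / R ^ 2 * R) := by gcongr
        _ = 1 / 2 := by field_simp; norm_num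
  · rw [mem_ball_iff_norm] at hz
    have h0 := norm_nonneg (z - x)
    have h1 : ‖z - x‖ ^ 2 / R ^ 2 ≤ 1 / 4 := by
      rw [div_le_iff₀ (by positivity)]; nlinarith
    have h2 : 3 / 4 ≤ max (1 - ‖z - x‖ ^ 2 / R ^ 2) 0 := le_max_of_le_left (by linarith)
    have h3 : 1 / 2 ≤ posSq (1 - ‖z - x‖ ^ 2 / R ^ 2) := by unfold posSq; nlinarith
    nlinarith

/-- A cutoff function that is one on `B_{R/4}(x)` and zero outside `B_{R/2}(x)`, with a gradient of
size at most `C / R`. -/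
structure IsCutoff (x : Plane) (R C : ℝ) (η : Plane → ℝ) : Prop where
  contDiff : ContDiff ℝ 1 η
  nonneg : ∀ z, 0 ≤ η z
  le_one : ∀ z, η z ≤ 1
  eq_one : ∀ z ∈ Metric.ball x (R / 4), η z = 1
  eq_zero : ∀ z ∉ Metric.ball x (R / 2), η z = 0
  norm_fderiv_le : ∀ z, ‖fderiv ℝ η z‖ ≤ C / R

theorem exists_isCutoff : ∃ C : ℝ, 0 < C ∧ ∀ (x : Plane) {R : ℝ}, 0 < R →
    ∃ η, IsCutoff x R C η := by
  let b : ContDiffBump (0 : Plane) := ⟨1 / 4, 1 / 2, by norm_num, by norm_num⟩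
  obtain ⟨C, hC⟩ := exists_bound_fderiv (b.contDiff (n := 1)) b.hasCompactSupport
  refine ⟨C + 1, by positivity, fun x R hR => ⟨fun z => b (R⁻¹ • (z - x)), ?_, fun z => b.nonneg,
    fun z => b.le_one, fun z hz => ?_, fun z hz => ?_, fun z => ?_⟩⟩
  · exact b.contDiff.comp ((contDiff_id.sub contDiff_const).const_smul _)
  · refine b.one_of_mem_closedBall ?_
    rw [mem_ball_iff_norm] at hz
    rw [mem_closedBall_zero_iff, norm_smul, norm_inv, Real.norm_of_nonneg hR.le,
      inv_mul_le_iff₀ hR]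
    show ‖z - x‖ ≤ R * (1 / 4)
    linarith
  · refine b.zero_of_le_dist ?_
    rw [Metric.mem_ball, not_lt, dist_eq_norm] at hz
    rw [dist_zero_right, norm_smul, norm_inv, Real.norm_of_nonneg hR.le, le_inv_mul_iff₀ hR]
    show R * (1 / 2) ≤ ‖z - x‖
    linarith
  · have h1 : HasFDerivAt (fun z : Plane => R⁻¹ • (z - x)) (R⁻¹ • ContinuousLinearMap.id ℝ Plane)
        z := ((hasFDerivAt_id z).sub_const x).const_smul R⁻¹
    have h2 := (((b.contDiff (n := 1)).differentiable (by norm_num)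
      (R⁻¹ • (z - x))).hasFDerivAt.comp z h1).fderiv
    simp only [Function.comp_def] at h2
    rw [h2]
    refine (ContinuousLinearMap.opNorm_comp_le _ _).trans ?_
    rw [norm_smul, norm_inv, Real.norm_of_nonneg hR.le, div_eq_mul_inv]
    have h3 := ContinuousLinearMap.norm_id_le (𝕜 := ℝ) (E := Plane)
    have h4 := hC (R⁻¹ • (z - x))
    have h5 : R⁻¹ * ‖ContinuousLinearMap.id ℝ Plane‖ ≤ R⁻¹ * 1 := by gcongr
    have h6 : 0 < R⁻¹ := by positivity
    calc _ ≤ (C : ℝ) * (R⁻¹ * 1) := by gcongr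
      _ ≤ _ := by nlinarith

variable {x : Plane} {R C : ℝ} {η : Plane → ℝ}

theorem IsCutoff.fderiv_of_eq_zero (h : IsCutoff x R C η) {z : Plane} (hz : η z = 0) :
    fderiv ℝ η z = 0 :=
  IsLocalMin.fderiv_eq_zero (Eventually.of_forall fun y => hz ▸ h.nonneg y)

theorem IsCutoff.fderiv_of_eq_one (h : IsCutoff x R C η) {z : Plane} (hz : η z = 1) :
    fderiv ℝ η z = 0 :=
  IsLocalMax.fderiv_eq_zero (Eventually.of_forall fun y => hz ▸ h.le_one y)

end RadiusAndCutoff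

/-! ### Making a map constant near a point -/

section Interpolation

theorem add_sq_le_four (a b : ℝ≥0∞) : (a + b) ^ 2 ≤ 4 * a ^ 2 + 4 * b ^ 2 := by
  rcases le_total a b with h | h
  · calc (a + b) ^ 2 ≤ (b + b) ^ 2 := by gcongr
      _ = 4 * b ^ 2 := by ring
      _ ≤ _ := le_add_self
  · calc (a + b) ^ 2 ≤ (a + a) ^ 2 := by gcongr
      _ = 4 * a ^ 2 := by ring
      _ ≤ _ := le_self_add

variable {E : Type*} [NormedAddCommGroup E] [NormedSpace ℝ E] [FiniteDimensional ℝ E]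
  {x : Plane} {R C : ℝ} {η : Plane → ℝ}

/-- Interpolation between a function and a constant by means of a cutoff function. -/
theorem W0.interpolate {Ω : Set Plane} (hΩ : IsOpen Ω) {f : Plane → E}
    {g : Plane → Plane →L[ℝ] E} (h : W0 Ω f g) (hη : IsCutoff x R C η) (hR : 0 < R)
    (hb : Metric.closedBall x R ⊆ Ω) (P : E) :
    W0 Ω (fun z => (1 - η z) • f z + η z • P)
      (fun z => (1 - η z) • g z + (fderiv ℝ η z).smulRight (P - f z)) := by
  have hK : Metric.closedBall x (R / 2) ⊆ Metric.closedBall x R :=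
    Metric.closedBall_subset_closedBall (by linarith)
  have hsupp : tsupport η ⊆ Metric.closedBall x (R / 2) := by
    refine closure_minimal (fun z hz => ?_) Metric.isClosed_closedBall
    by_contra hcon
    exact hz (hη.eq_zero z fun hz' => hcon (Metric.ball_subset_closedBall hz'))
  have hηc : HasCompactSupport η :=
    (isCompact_closedBall x (R / 2)).of_isClosed_subset (isClosed_tsupport _) hsupp
  have hCR : 0 ≤ C / R := (norm_nonneg _).trans (hη.norm_fderiv_le x)
  have hdη : ∀ z, HasFDerivAt η (fderiv ℝ η z) z := fun z =>
    (hη.contDiff.differentiable (by norm_num) z).hasFDerivAt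
  have hdm : ∀ z, fderiv ℝ (fun z => 1 - η z) z = -fderiv ℝ η z := fun z =>
    ((hdη z).const_sub 1).fderiv
  have h1 := h.smul_contDiff hΩ (η := fun z => 1 - η z) (contDiff_const.sub hη.contDiff)
    (C := ⟨1 + C / R, by positivity⟩) (fun z => by
      rw [Real.norm_of_nonneg (by linarith [hη.le_one z])]
      show 1 - η z ≤ 1 + C / R
      linarith [hη.nonneg z])
    (fun z => by
      rw [hdm, norm_neg]
      show ‖fderiv ℝ η z‖ ≤ 1 + C / R
      linarith [hη.norm_fderiv_le z])
  have h2 : W0 Ω (fun z => η z • P) (fderiv ℝ fun z => η z • P) :=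
    W0.of_contDiff hΩ (hη.contDiff.smul contDiff_const) hηc.smul_right
      ((tsupport_smul_subset_left _ _).trans (hsupp.trans (hK.trans hb)))
  convert h1.add h2 using 1
  · rfl
  refine funext fun z => ContinuousLinearMap.ext fun v => ?_
  simp only [Pi.add_apply]
  rw [((hdη z).smul_const P).fderiv, hdm]
  simp [sub_eq_add_neg]
  abel

end Interpolation

section Flatten

theorem enorm_le_mul {E F : Type*} [NormedAddCommGroup E] [NormedAddCommGroup F] {a : E} {b : F}
    {c : ℝ} (hc : 0 ≤ c) (h : ‖a‖ ≤ c * ‖b‖) : ‖a‖ₑ ≤ ENNReal.ofReal c * ‖b‖ₑ := by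
  rw [← ofReal_norm, ← ofReal_norm, ← ENNReal.ofReal_mul hc]
  exact ENNReal.ofReal_le_ofReal h

set_option maxHeartbeats 1000000 in
/-- A sphere-valued map with small Dirichlet energy in a disc can be made constant in the
concentric disc of a quarter of the radius, at the cost of constant factors in the energy and
without changing its degree or its values outside the larger disc. -/
theorem exists_flatten : ∃ C : ℝ, 0 < C ∧ ∀ Ω : Set Plane, IsOpen Ω → ∀ (x : Plane) (R : ℝ),
    0 < R → Metric.closedBall x R ⊆ Ω → ∀ (u : Plane → Space) (g : Plane → Plane →L[ℝ] Space),
    SphereMap Ω u g →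
    ∫⁻ y in Metric.ball x R, ‖g y‖ₑ ^ 2 ≤ ENNReal.ofReal ((1 / 2) ^ 20) →
    ∃ (u' : Plane → Space) (g' : Plane → Plane →L[ℝ] Space) (p : Space), SphereMap Ω u' g' ∧
      degInt u' g' = degInt u g ∧
      (∀ᵐ z, z ∉ Metric.ball x R → u' z = u z ∧ g' z = g z) ∧
      (∀ z ∈ Metric.ball x (R / 4), u' z = p ∧ g' z = 0) ∧
      ‖p‖ₑ ^ 2 * ENNReal.ofReal (R ^ 2) ≤ 4 * ∫⁻ y in Metric.ball x R, ‖u y‖ₑ ^ 2 ∧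
      ∫⁻ y in Metric.ball x R, ‖g' y‖ₑ ^ 2 ≤
        ENNReal.ofReal C * ∫⁻ y in Metric.ball x R, ‖g y‖ₑ ^ 2 ∧
      ∫⁻ y in Metric.ball x R, ‖u' y‖ₑ ^ 2 ≤
        ENNReal.ofReal C * ∫⁻ y in Metric.ball x R, ‖u y‖ₑ ^ 2 := by
  obtain ⟨C₀, hC₀, hcut⟩ := exists_isCutoff
  refine ⟨1000 + 16 * (32 + 16 * (C₀ * 64) ^ 2), by positivity,
    fun Ω hΩ x R hR hb u g h hX => ?_⟩
  obtain ⟨ρ, hρ, hρR⟩ := exists_isRadius x hR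
  obtain ⟨η, hη⟩ := hcut x hR
  set A := average ρ u with hA
  set DA := averageDeriv ρ g with hDA
  set P := ∫ w, u (x + R • w) ∂unifBall with hP
  set I := ∫⁻ y in Metric.ball x R, ‖g y‖ₑ ^ 2 with hI
  set J := ∫⁻ y in Metric.ball x R, ‖u y‖ₑ ^ 2 with hJ
  have hIfin : I ≠ ⊤ := (hX.trans_lt ENNReal.ofReal_lt_top).ne
  set X := I.toReal with hXdef
  have hX0 : 0 ≤ X := ENNReal.toReal_nonneg
  have hXI : ENNReal.ofReal X = I := ENNReal.ofReal_toReal hIfin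
  have hXle : X ≤ (1 / 2) ^ 20 := by
    rw [← hXI] at hX
    exact (ENNReal.ofReal_le_ofReal_iff (by positivity)).1 hX
  have hAW : W0 Ω A DA := W0.average hρ hΩ hb h.w0
  -- the averages over the small discs are close to the average over the whole disc
  have hAP : ∀ z ∈ Metric.ball x (R / 2), ‖A z - P‖ ≤ 64 * √X := by
    intro z hz
    have hz' : z ∈ Metric.ball x R := Metric.ball_subset_ball (by linarith) hz
    have hρz := hρR z hz
    have hρ0 : 0 < ρ z := lt_of_lt_of_le (by positivity) hρz
    have h1 := h.w0.norm_average_sub_sq_le hρ0 hR hX0 (hρ.ball_subset hz') hXI.ge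
    rw [hA, average_apply]
    refine abs_le_of_sq_le_sq' (h1.trans ?_) (by positivity) |>.2
    have h2 : R / ρ z ≤ 16 := by rw [div_le_iff₀ hρ0]; linarith
    have h3 : 0 ≤ R / ρ z := by positivity
    rw [mul_pow, Real.sq_sqrt hX0]
    calc (R / ρ z) ^ 2 * (16 * X) ≤ 16 ^ 2 * (16 * X) := by gcongr
      _ = _ := by ring
  have hsX : √X ≤ (1 / 2) ^ 10 := by
    rw [Real.sqrt_le_left (by positivity)]
    exact hXle.trans (by norm_num)
  have hAP' : ∀ z ∈ Metric.ball x (R / 2), ‖A z - P‖ ≤ 1 / 16 := fun z hz =>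
    (hAP z hz).trans (by linarith)
  have hPge : 15 / 16 ≤ ‖P - e₃‖ := by
    have := h.le_norm_average_sub (z := x) hR (c := 1 / 16) (by norm_num) (by
      calc 16 * I ≤ ENNReal.ofReal 16 * ENNReal.ofReal ((1 / 2) ^ 20) := by gcongr; norm_num
        _ = ENNReal.ofReal (16 * (1 / 2) ^ 20) := (ENNReal.ofReal_mul (by norm_num)).symm
        _ ≤ _ := ENNReal.ofReal_le_ofReal (by norm_num))
    linarith
  have hPle : ‖P - e₃‖ ≤ 1 := h.norm_average_sub_le x hR.le
  have hAge : ∀ z, 15 / 16 ≤ ‖A z - e₃‖ := h.le_norm_average hρ hX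
  have hAle : ∀ z, ‖A z - e₃‖ ≤ 1 := h.norm_average_le hρ
  set v : Plane → Space := fun z => (1 - η z) • A z + η z • P with hv
  set k : Plane → Plane →L[ℝ] Space :=
    fun z => (1 - η z) • DA z + (fderiv ℝ η z).smulRight (P - A z) with hk
  have hvW : W0 Ω v k := hAW.interpolate hΩ hη hR hb P
  have hv_off : ∀ z ∉ Metric.ball x (R / 2), v z = A z ∧ k z = DA z := by
    intro z hz
    have h0 := hη.eq_zero z hz
    simp [hv, hk, h0, hη.fderiv_of_eq_zero h0]
  have hvge : ∀ z, 1 / 2 ≤ ‖v z - e₃‖ := by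
    intro z
    by_cases hz : z ∈ Metric.ball x (R / 2)
    · have h1 : v z - P = (1 - η z) • (A z - P) := by simp only [hv]; module
      have h2 : ‖v z - P‖ ≤ 1 / 16 := by
        rw [h1, norm_smul, Real.norm_of_nonneg (by linarith [hη.le_one z])]
        nlinarith [hAP' z hz, norm_nonneg (A z - P), hη.nonneg z, hη.le_one z]
      have h3 := norm_sub_norm_le (P - e₃) (P - v z)
      rw [sub_sub_sub_cancel_left, norm_sub_rev P (v z)] at h3
      linarith
    · rw [(hv_off z hz).1]
      linarith [hAge z]
  have hvle : ∀ z, ‖v z - e₃‖ ≤ 1 := by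
    intro z
    have h1 : v z - e₃ = (1 - η z) • (A z - e₃) + η z • (P - e₃) := by simp only [hv]; module
    rw [h1]
    refine (norm_add_le _ _).trans ?_
    rw [norm_smul, norm_smul, Real.norm_of_nonneg (by linarith [hη.le_one z]),
      Real.norm_of_nonneg (hη.nonneg z)]
    nlinarith [hAle z, hη.nonneg z, hη.le_one z]
  have hne : ∀ z, v z ≠ e₃ := fun z h0 => by
    have := hvge z
    rw [h0] at this; norm_num at this
  have hPne : P ≠ e₃ := fun h0 => by
    rw [h0] at hPge; norm_num at hPge
  have hDR : ∀ z, ‖fderiv ℝ retract (v z)‖ ≤ 4 := fun z => by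
    refine (norm_fderiv_retract_le (hne z)).trans ?_
    have : ‖v z - e₃‖⁻¹ ≤ 2 := by
      rw [inv_le_comm₀ (by linarith [hvge z]) (by norm_num)]; linarith [hvge z]
    linarith
  have hS := hvW.retract hΩ hvge hvle
  refine ⟨fun z => retract (v z), fun z => (fderiv ℝ retract (v z)).comp (k z), retract P, hS,
    ?_, ?_, ?_, ?_, ?_, ?_⟩
  -- Before the retraction the map is within distance `1 / 16` of the average, which is at
  -- distance at least `15 / 16` from `e₃`; so the retractions are less than a right angle apart.
  · have hS1 := h.retract_average hΩ hρ hb hX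
    rw [← h.degInt_retract_average hΩ hρ hb hX]
    refine degInt_eq_of_inner_nonneg hΩ hS.w0 hS1.w0 hS.unit hS1.unit fun z => ?_
    rw [real_inner_comm]
    refine inner_retract_nonneg (inner_nonneg_of_norm_sub_le ?_)
    rw [sub_sub_sub_cancel_right]
    by_cases hz : z ∈ Metric.ball x (R / 2)
    · have h1 : v z - A z = η z • (P - A z) := by simp only [hv]; module
      have h2 : ‖v z - A z‖ ≤ 1 / 16 := by
        rw [h1, norm_smul, Real.norm_of_nonneg (hη.nonneg z), norm_sub_rev]
        nlinarith [hAP' z hz, norm_nonneg (A z - P), hη.nonneg z, hη.le_one z]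
      have h3 := hAge z
      linarith
    · rw [(hv_off z hz).1, sub_self, norm_zero]
      exact norm_nonneg _
  · filter_upwards [h.w0.tangent hΩ h.unit] with z hz hzB
    have hz2 : z ∉ Metric.ball x (R / 2) := fun hcon =>
      hzB (Metric.ball_subset_ball (by linarith) hcon)
    obtain ⟨e1, e2⟩ := hv_off z hz2
    have e3 : A z = u z := hρ.average_of_notMem hzB
    have e4 : DA z = g z := hρ.averageDeriv_of_notMem hzB
    rw [e1, e2, e3, e4]
    refine ⟨retract_of_norm (h.unit z), ContinuousLinearMap.ext fun w => ?_⟩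
    exact fderiv_retract_of_tangent (h.unit z) (hz w)
  · intro z hz
    have h1 := hη.eq_one z hz
    have e1 : v z = P := by simp [hv, h1]
    have e2 : k z = 0 := by simp [hk, h1, hη.fderiv_of_eq_one h1]
    simp [e1, e2]
  all_goals
    have hPJ : ‖P‖ₑ ^ 2 * ENNReal.ofReal (R ^ 2) ≤ J := by
      rw [mul_comm]
      refine le_trans (mul_le_mul' le_rfl ?_)
        (lintegral_unifBall_comp_le (fun y => ‖u y‖ₑ ^ 2) x hR)
      exact enorm_integral_sq_le
        (integrable_unifBall h.w0.meas h.w0.memLp x hR.le).aestronglyMeasurable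
    have hvol : volume (Metric.ball x R) ≤ 4 * ENNReal.ofReal (R ^ 2) := by
      rw [EuclideanSpace.volume_ball_fin_two, ENNReal.ofReal_pow hR.le, mul_comm]
      gcongr
      rw [← ENNReal.ofReal_ofNat 4]
      exact ENNReal.ofReal_le_ofReal Real.pi_le_four
  · calc ‖retract P‖ₑ ^ 2 * ENNReal.ofReal (R ^ 2)
        ≤ (2 * ‖P‖ₑ) ^ 2 * ENNReal.ofReal (R ^ 2) := by
          gcongr
          simpa using enorm_le_mul (by norm_num) (norm_retract_le hPne)
      _ = 4 * (‖P‖ₑ ^ 2 * ENNReal.ofReal (R ^ 2)) := by ring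
      _ ≤ _ := by gcongr
  · set b : ℝ := C₀ / R * (64 * √X) with hbdef
    have hb0 : 0 ≤ b := by positivity
    have hk1 : ∀ z, ‖k z‖ₑ ≤ ‖DA z‖ₑ + ENNReal.ofReal b := by
      intro z
      rw [← ofReal_norm, ← ofReal_norm, ← ENNReal.ofReal_add (norm_nonneg _) hb0]
      refine ENNReal.ofReal_le_ofReal ?_
      refine (norm_add_le _ _).trans ?_
      refine add_le_add ?_ ?_
      · rw [norm_smul, Real.norm_of_nonneg (by linarith [hη.le_one z])]
        nlinarith [hη.nonneg z, norm_nonneg (DA z)]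
      · rw [ContinuousLinearMap.norm_smulRight_apply]
        by_cases hz : z ∈ Metric.ball x (R / 2)
        · rw [norm_sub_rev]
          have := hAP z hz
          have := hη.norm_fderiv_le z
          rw [hbdef]
          gcongr
        · rw [hη.fderiv_of_eq_zero (hη.eq_zero z hz)]
          simpa using hb0
    have hg1 : ∀ z, ‖(fderiv ℝ retract (v z)).comp (k z)‖ₑ ≤ 4 * ‖k z‖ₑ := by
      intro z
      have h4 : ‖(fderiv ℝ retract (v z)).comp (k z)‖ ≤ 4 * ‖k z‖ := by
        refine (ContinuousLinearMap.opNorm_comp_le _ _).trans ?_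
        gcongr
        exact hDR z
      simpa using enorm_le_mul (by norm_num) h4
    have hDAI : ∫⁻ y in Metric.ball x R, ‖DA y‖ₑ ^ 2 ≤ 8 * I :=
      hρ.isWeight.lintegral_sq_le hρ h.w0.meas_deriv Metric.isOpen_ball.measurableSet
        (fun w hw z hz => hρ.shift_mem hw hz)
    have hbI : ENNReal.ofReal b ^ 2 * (4 * ENNReal.ofReal (R ^ 2)) =
        ENNReal.ofReal (4 * (C₀ * 64) ^ 2) * I := by
      rw [← hXI, ← ENNReal.ofReal_pow hb0, ← ENNReal.ofReal_ofNat 4,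
        ← ENNReal.ofReal_mul (by norm_num), ← ENNReal.ofReal_mul (by positivity),
        ← ENNReal.ofReal_mul (by positivity)]
      congr 1
      rw [hbdef, mul_pow, mul_pow, Real.sq_sqrt hX0]
      field_simp
    have hK : 0 ≤ 4 * (C₀ * 64) ^ 2 := by positivity
    calc ∫⁻ y in Metric.ball x R, ‖(fderiv ℝ retract (v y)).comp (k y)‖ₑ ^ 2
        ≤ ∫⁻ y in Metric.ball x R, (64 * ‖DA y‖ₑ ^ 2 + 64 * ENNReal.ofReal b ^ 2) := by
          refine lintegral_mono fun z => ?_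
          calc _ ≤ (4 * (‖DA z‖ₑ + ENNReal.ofReal b)) ^ 2 := by
                gcongr
                exact (hg1 z).trans (by gcongr; exact hk1 z)
            _ = 16 * (‖DA z‖ₑ + ENNReal.ofReal b) ^ 2 := by ring
            _ ≤ 16 * (4 * ‖DA z‖ₑ ^ 2 + 4 * ENNReal.ofReal b ^ 2) := by
                gcongr; exact add_sq_le_four _ _
            _ = _ := by ring
      _ = 64 * (∫⁻ y in Metric.ball x R, ‖DA y‖ₑ ^ 2) +
          64 * ENNReal.ofReal b ^ 2 * volume (Metric.ball x R) := by
          rw [lintegral_add_right _ measurable_const, lintegral_const_mul' _ _ (by norm_num),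
            setLIntegral_const]
      _ ≤ 64 * (8 * I) + 64 * ENNReal.ofReal b ^ 2 * (4 * ENNReal.ofReal (R ^ 2)) := by
          gcongr
      _ = 64 * (8 * I) + 64 * (ENNReal.ofReal (4 * (C₀ * 64) ^ 2) * I) := by
          rw [mul_assoc 64, hbI]
      _ = ENNReal.ofReal (512 + 64 * (4 * (C₀ * 64) ^ 2)) * I := by
          rw [ENNReal.ofReal_add (by norm_num) (mul_nonneg (by norm_num) hK),
            ENNReal.ofReal_mul (p := 64) (by norm_num), ENNReal.ofReal_ofNat, ENNReal.ofReal_ofNat]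
          ring
      _ ≤ _ := by
          refine mul_le_mul' (ENNReal.ofReal_le_ofReal ?_) le_rfl
          linarith
  · have hu1 : ∀ z, ‖retract (v z)‖ₑ ≤ 2 * (‖A z‖ₑ + ‖P‖ₑ) := by
      intro z
      have h5 : ‖retract (v z)‖ₑ ≤ 2 * ‖v z‖ₑ := by
        simpa using enorm_le_mul (by norm_num) (norm_retract_le (hne z))
      refine h5.trans ?_
      gcongr
      rw [← ofReal_norm, ← ofReal_norm, ← ofReal_norm, ← ENNReal.ofReal_add (norm_nonneg _)
        (norm_nonneg _)]
      refine ENNReal.ofReal_le_ofReal ?_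
      refine (norm_add_le _ _).trans ?_
      rw [norm_smul, norm_smul, Real.norm_of_nonneg (by linarith [hη.le_one z]),
        Real.norm_of_nonneg (hη.nonneg z)]
      nlinarith [hη.nonneg z, hη.le_one z, norm_nonneg (A z), norm_nonneg P]
    have hAJ : ∫⁻ y in Metric.ball x R, ‖A y‖ₑ ^ 2 ≤ 8 * J :=
      isWeight_id.lintegral_sq_le hρ h.w0.meas Metric.isOpen_ball.measurableSet
        (fun w hw z hz => hρ.shift_mem hw hz)
    calc ∫⁻ y in Metric.ball x R, ‖retract (v y)‖ₑ ^ 2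
        ≤ ∫⁻ y in Metric.ball x R, (16 * ‖A y‖ₑ ^ 2 + 16 * ‖P‖ₑ ^ 2) := by
          refine lintegral_mono fun z => ?_
          calc _ ≤ (2 * (‖A z‖ₑ + ‖P‖ₑ)) ^ 2 := by gcongr; exact hu1 z
            _ = 4 * (‖A z‖ₑ + ‖P‖ₑ) ^ 2 := by ring
            _ ≤ 4 * (4 * ‖A z‖ₑ ^ 2 + 4 * ‖P‖ₑ ^ 2) := by gcongr; exact add_sq_le_four _ _
            _ = _ := by ring
      _ = 16 * (∫⁻ y in Metric.ball x R, ‖A y‖ₑ ^ 2) +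
          16 * ‖P‖ₑ ^ 2 * volume (Metric.ball x R) := by
          rw [lintegral_add_right _ measurable_const, lintegral_const_mul' _ _ (by norm_num),
            setLIntegral_const]
      _ ≤ 16 * (8 * J) + 16 * ‖P‖ₑ ^ 2 * (4 * ENNReal.ofReal (R ^ 2)) := by gcongr
      _ = 16 * (8 * J) + 64 * (‖P‖ₑ ^ 2 * ENNReal.ofReal (R ^ 2)) := by ring
      _ ≤ 16 * (8 * J) + 64 * J := by gcongr
      _ = ENNReal.ofReal 192 * J := by rw [ENNReal.ofReal_ofNat]; ring
      _ ≤ _ := by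
          refine mul_le_mul' (ENNReal.ofReal_le_ofReal ?_) le_rfl
          linarith [sq_nonneg (C₀ * 64)]

end Flatten

/-! ### The bubble -/

section BubbleIdentities

/-- `∑ |∂ᵢ b|² = 2 b · (∂₁ b × ∂₂ b) + 16 q² h'² / (h² + q)²` for the map
`b = (-2 h z, h² - q) / (h² + q)`, `q = |z|²`, with a radial `h = h(q)`. -/
theorem bubble_gradient_identity {z₀ z₁ h k : ℝ} (hD : h ^ 2 + (z₀ ^ 2 + z₁ ^ 2) ≠ 0)
    {q D f f' c' : ℝ} (hq : q = z₀ ^ 2 + z₁ ^ 2) (hDe : D = h ^ 2 + q) (hf : f = 2 * h / D)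
    (hf' : f' = (2 * k * D - 2 * h * (2 * h * k + 1)) / D ^ 2)
    (hc' : c' = (4 * h * k * D - 2 * h ^ 2 * (2 * h * k + 1)) / D ^ 2) :
    ((-(f + 2 * f' * z₀ * z₀)) ^ 2 + (-(2 * f' * z₀ * z₁)) ^ 2 + (2 * c' * z₀) ^ 2) +
    ((-(2 * f' * z₁ * z₀)) ^ 2 + (-(f + 2 * f' * z₁ * z₁)) ^ 2 + (2 * c' * z₁) ^ 2) =
    2 * (4 * h * (h - 2 * q * k) / D ^ 2) + 16 * q ^ 2 * k ^ 2 / D ^ 2 := by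
  subst hf hf' hc' hDe hq
  field_simp
  ring

theorem bubble_jacobian_identity {z₀ z₁ h k : ℝ} (hD : h ^ 2 + (z₀ ^ 2 + z₁ ^ 2) ≠ 0)
    {q D f f' c c' : ℝ} (hq : q = z₀ ^ 2 + z₁ ^ 2) (hDe : D = h ^ 2 + q) (hf : f = 2 * h / D)
    (hc : c = 2 * h ^ 2 / D)
    (hf' : f' = (2 * k * D - 2 * h * (2 * h * k + 1)) / D ^ 2)
    (hc' : c' = (4 * h * k * D - 2 * h ^ 2 * (2 * h * k + 1)) / D ^ 2) :
    -(f * z₀) * (-(2 * f' * z₀ * z₁) * (2 * c' * z₁) - 2 * c' * z₀ * -(f + 2 * f' * z₁ * z₁)) +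
    -(f * z₁) * (2 * c' * z₀ * -(2 * f' * z₁ * z₀) - -(f + 2 * f' * z₀ * z₀) * (2 * c' * z₁)) +
    (c - 1) * (-(f + 2 * f' * z₀ * z₀) * -(f + 2 * f' * z₁ * z₁) -
      -(2 * f' * z₀ * z₁) * -(2 * f' * z₁ * z₀)) =
    4 * h * (h - 2 * q * k) / D ^ 2 := by
  subst hf hf' hc hc' hDe hq
  field_simp
  ring

theorem bubble_dmi_identity {z₀ z₁ h k : ℝ} (hD : h ^ 2 + (z₀ ^ 2 + z₁ ^ 2) ≠ 0)
    {q D f c' : ℝ} (hq : q = z₀ ^ 2 + z₁ ^ 2) (hDe : D = h ^ 2 + q) (hf : f = 2 * h / D)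
    (hc' : c' = (4 * h * k * D - 2 * h ^ 2 * (2 * h * k + 1)) / D ^ 2) :
    -(f * z₀) * (2 * c' * z₀) + -(f * z₁) * (2 * c' * z₁) =
    8 * h ^ 2 * (h - 2 * q * k) * q / D ^ 3 := by
  subst hf hc' hDe hq
  field_simp
  ring

end BubbleIdentities

section Profile

variable {l ρ : ℝ}

/-- The profile `h(q) = l (1 - q / ρ²)₊²` of the bubble as a function of `q = |z|²`. It equals the
size `l` at the centre, vanishes for `|z| ≥ ρ`, and is `C¹`. The constant profile `h = l` would
give the stereographic projection. -/
def profile (l ρ q : ℝ) : ℝ := l * posSq (1 - q / ρ ^ 2)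

/-- The derivative of `profile` with respect to `q`. -/
def profileDeriv (l ρ q : ℝ) : ℝ := -(2 * l / ρ ^ 2 * max (1 - q / ρ ^ 2) 0)

/-- The denominator `h² + q`. -/
def denom (l ρ q : ℝ) : ℝ := profile l ρ q ^ 2 + q

theorem hasDerivAt_profile (l ρ q : ℝ) :
    HasDerivAt (profile l ρ) (profileDeriv l ρ q) q := by
  have h1 : HasDerivAt (fun q : ℝ => 1 - q / ρ ^ 2) (-(1 / ρ ^ 2)) q :=
    ((hasDerivAt_id q).div_const _).const_sub 1
  have h2 := ((hasDerivAt_posSq _).comp q h1).const_mul l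
  refine h2.congr_deriv ?_
  rw [profileDeriv]
  ring

theorem contDiff_profile (l ρ : ℝ) : ContDiff ℝ 1 (profile l ρ) :=
  contDiff_const.mul (contDiff_posSq.comp (contDiff_const.sub (contDiff_id.div_const _)))

theorem profile_nonneg (hl : 0 < l) (q : ℝ) : 0 ≤ profile l ρ q := by
  unfold profile posSq; positivity

theorem max_profile_le_one {q : ℝ} (hq : 0 ≤ q) : max (1 - q / ρ ^ 2) 0 ≤ 1 :=
  max_le (by have : 0 ≤ q / ρ ^ 2 := by positivity
             linarith) zero_le_one

theorem profile_le (hl : 0 < l) {q : ℝ} (hq : 0 ≤ q) : profile l ρ q ≤ l := by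
  have h1 := max_profile_le_one (ρ := ρ) hq
  have h2 : 0 ≤ max (1 - q / ρ ^ 2) 0 := le_max_right _ _
  have h3 : posSq (1 - q / ρ ^ 2) ≤ 1 := by unfold posSq; nlinarith
  unfold profile
  nlinarith

theorem profile_zero (l ρ : ℝ) : profile l ρ 0 = l := by simp [profile, posSq]

theorem profile_eq_zero (hρ : 0 < ρ) {q : ℝ} (hq : ρ ^ 2 ≤ q) : profile l ρ q = 0 := by
  have h1 : 1 ≤ q / ρ ^ 2 := by rw [le_div_iff₀ (by positivity)]; linarith
  simp [profile, posSq, max_eq_right (by linarith : 1 - q / ρ ^ 2 ≤ 0)]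

theorem profileDeriv_eq_zero (hρ : 0 < ρ) {q : ℝ} (hq : ρ ^ 2 ≤ q) : profileDeriv l ρ q = 0 := by
  have h1 : 1 ≤ q / ρ ^ 2 := by rw [le_div_iff₀ (by positivity)]; linarith
  simp [profileDeriv, max_eq_right (by linarith : 1 - q / ρ ^ 2 ≤ 0)]

theorem profileDeriv_nonpos (hl : 0 < l) (q : ℝ) : profileDeriv l ρ q ≤ 0 := by
  have : 0 ≤ 2 * l / ρ ^ 2 * max (1 - q / ρ ^ 2) 0 := by positivity
  unfold profileDeriv
  linarith

theorem abs_profileDeriv_le (hl : 0 < l) {q : ℝ} (hq : 0 ≤ q) :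
    |profileDeriv l ρ q| ≤ 2 * l / ρ ^ 2 := by
  have h1 := max_profile_le_one (ρ := ρ) hq
  have h2 : 0 ≤ max (1 - q / ρ ^ 2) 0 := le_max_right _ _
  have h3 : 0 ≤ 2 * l / ρ ^ 2 := by positivity
  rw [profileDeriv, abs_neg, abs_of_nonneg (by positivity)]
  nlinarith

theorem mul_abs_profileDeriv_le (hl : 0 < l) (hρ : 0 < ρ) {q : ℝ} (hq : 0 ≤ q) :
    q * |profileDeriv l ρ q| ≤ 2 * l := by
  rcases le_total q (ρ ^ 2) with h | h
  · calc q * |profileDeriv l ρ q| ≤ ρ ^ 2 * (2 * l / ρ ^ 2) := by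
          gcongr; exact abs_profileDeriv_le hl hq
      _ = 2 * l := by field_simp
  · rw [profileDeriv_eq_zero hρ h]
    simp; positivity

theorem half_le_profile (hl : 0 < l) (hρ : 0 < ρ) {q : ℝ} (hq : q ≤ ρ ^ 2 / 4) :
    l / 2 ≤ profile l ρ q := by
  have h1 : q / ρ ^ 2 ≤ 1 / 4 := by rw [div_le_iff₀ (by positivity)]; linarith
  have h2 : 3 / 4 ≤ max (1 - q / ρ ^ 2) 0 := le_max_of_le_left (by linarith)
  have h3 : 1 / 2 ≤ posSq (1 - q / ρ ^ 2) := by unfold posSq; nlinarith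
  unfold profile
  nlinarith

theorem denom_pos (hl : 0 < l) {q : ℝ} (hq : 0 ≤ q) : 0 < denom l ρ q := by
  unfold denom
  rcases hq.eq_or_lt with rfl | hq
  · rw [profile_zero]; positivity
  · positivity

theorem le_denom (l ρ q : ℝ) : q ≤ denom l ρ q := by
  unfold denom; nlinarith [sq_nonneg (profile l ρ q)]

/-- The denominator is comparable to that of the stereographic projection of size `l`. -/
theorem denom_ge (hl : 0 < l) (hρ : 0 < ρ) (hlρ : l ≤ ρ) {q : ℝ} (hq : 0 ≤ q) :
    (l ^ 2 + q) / 5 ≤ denom l ρ q := by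
  rcases le_total q (ρ ^ 2 / 4) with h | h
  · have h1 := half_le_profile hl hρ h
    unfold denom
    nlinarith
  · have h2 : l ^ 2 ≤ ρ ^ 2 := by gcongr
    have := le_denom l ρ q
    linarith

theorem denom_le (hl : 0 < l) {q : ℝ} (hq : 0 ≤ q) : denom l ρ q ≤ l ^ 2 + q := by
  have h1 := profile_le (ρ := ρ) hl hq
  have h2 := profile_nonneg (ρ := ρ) hl q
  unfold denom
  nlinarith

end Profile

section Bubble

variable {l ρ : ℝ}

/-- The factor `2 h / (h² + q)`. -/
def radialFactor (l ρ q : ℝ) : ℝ := 2 * profile l ρ q / denom l ρ q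

/-- The derivative of `radialFactor`. -/
def radialFactorDeriv (l ρ q : ℝ) : ℝ :=
  (2 * profileDeriv l ρ q * denom l ρ q - 2 * profile l ρ q *
    (2 * profile l ρ q * profileDeriv l ρ q + 1)) / denom l ρ q ^ 2

/-- The vertical component `2 h² / (h² + q)`. -/
def vertical (l ρ q : ℝ) : ℝ := 2 * profile l ρ q ^ 2 / denom l ρ q

/-- The derivative of `vertical`. -/
def verticalDeriv (l ρ q : ℝ) : ℝ :=
  (4 * profile l ρ q * profileDeriv l ρ q * denom l ρ q - 2 * profile l ρ q ^ 2 *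
    (2 * profile l ρ q * profileDeriv l ρ q + 1)) / denom l ρ q ^ 2

theorem hasDerivAt_denom (l ρ q : ℝ) :
    HasDerivAt (denom l ρ) (2 * profile l ρ q * profileDeriv l ρ q + 1) q := by
  have h := ((hasDerivAt_profile l ρ q).pow 2).add (hasDerivAt_id q)
  refine h.congr_deriv ?_
  simp

theorem hasDerivAt_radialFactor (hl : 0 < l) {q : ℝ} (hq : 0 ≤ q) :
    HasDerivAt (radialFactor l ρ) (radialFactorDeriv l ρ q) q :=
  ((hasDerivAt_profile l ρ q).const_mul 2).div (hasDerivAt_denom l ρ q) (denom_pos hl hq).ne'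

theorem hasDerivAt_vertical (hl : 0 < l) {q : ℝ} (hq : 0 ≤ q) :
    HasDerivAt (vertical l ρ) (verticalDeriv l ρ q) q := by
  have h := (((hasDerivAt_profile l ρ q).pow 2).const_mul 2).div (hasDerivAt_denom l ρ q)
    (denom_pos hl hq).ne'
  refine h.congr_deriv ?_
  rw [verticalDeriv]
  congr 1
  simp only [Pi.pow_apply]
  norm_num
  left
  ring

/-- The bubble: the stereographic projection `b = (-2 h z, h² - q) / (h² + q)` with `q = |z|²` and
`h = profile l ρ q` in place of a constant. The value is `b + e₃`, which vanishes outside the disc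
of radius `ρ`. At the centre `b = e₃`. -/
def bubble (l ρ : ℝ) (z : Plane) : Space :=
  !₂[-(radialFactor l ρ (‖z‖ ^ 2) * z 0), -(radialFactor l ρ (‖z‖ ^ 2) * z 1),
    vertical l ρ (‖z‖ ^ 2)]

theorem contDiff_denom_norm (l ρ : ℝ) : ContDiff ℝ 1 fun z : Plane => denom l ρ (‖z‖ ^ 2) := by
  have hq : ContDiff ℝ 1 fun z : Plane => ‖z‖ ^ 2 := contDiff_norm_sq ℝ
  exact (((contDiff_profile l ρ).comp hq).pow 2).add hq

theorem contDiff_radialFactor_norm (hl : 0 < l) :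
    ContDiff ℝ 1 fun z : Plane => radialFactor l ρ (‖z‖ ^ 2) :=
  (contDiff_const.mul ((contDiff_profile l ρ).comp (contDiff_norm_sq ℝ))).div
    (contDiff_denom_norm l ρ) fun _ => (denom_pos hl (sq_nonneg _)).ne'

theorem contDiff_vertical_norm (hl : 0 < l) :
    ContDiff ℝ 1 fun z : Plane => vertical l ρ (‖z‖ ^ 2) :=
  (contDiff_const.mul (((contDiff_profile l ρ).comp (contDiff_norm_sq ℝ)).pow 2)).div
    (contDiff_denom_norm l ρ) fun _ => (denom_pos hl (sq_nonneg _)).ne'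

theorem contDiff_bubble (hl : 0 < l) : ContDiff ℝ 1 (bubble l ρ) := by
  rw [contDiff_euclidean]
  have hc : ∀ i : Fin 2, ContDiff ℝ 1 fun z : Plane => z i := fun i =>
    contDiff_euclidean.1 contDiff_id i
  intro i
  fin_cases i
  · exact ((contDiff_radialFactor_norm hl).mul (hc 0)).neg
  · exact ((contDiff_radialFactor_norm hl).mul (hc 1)).neg
  · exact contDiff_vertical_norm hl

theorem bubble_eq_zero (hρ : 0 < ρ) {z : Plane} (hz : z ∉ Metric.ball (0 : Plane) ρ) :
    bubble l ρ z = 0 := by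
  rw [mem_ball_zero_iff, not_lt] at hz
  have h := profile_eq_zero (l := l) hρ (q := ‖z‖ ^ 2) (by gcongr)
  ext i
  fin_cases i <;> simp [bubble, radialFactor, vertical, h]

theorem hasFDerivAt_normSq (z : Plane) :
    HasFDerivAt (fun z : Plane => ‖z‖ ^ 2) (2 • innerSL ℝ z) z := by
  have := (hasFDerivAt_id (𝕜 := ℝ) z).norm_sq
  simpa using this

theorem fderiv_bubble (hl : 0 < l) (z v : Plane) :
    fderiv ℝ (bubble l ρ) z v = !₂[
      -(radialFactor l ρ (‖z‖ ^ 2) * v 0 + 2 * radialFactorDeriv l ρ (‖z‖ ^ 2) * inner ℝ z v * z 0),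
      -(radialFactor l ρ (‖z‖ ^ 2) * v 1 + 2 * radialFactorDeriv l ρ (‖z‖ ^ 2) * inner ℝ z v * z 1),
      2 * verticalDeriv l ρ (‖z‖ ^ 2) * inner ℝ z v] := by
  have hd : HasFDerivAt (bubble l ρ) (fderiv ℝ (bubble l ρ) z) z :=
    ((contDiff_bubble hl).differentiable (by norm_num) z).hasFDerivAt
  have hq : (0 : ℝ) ≤ ‖z‖ ^ 2 := sq_nonneg _
  have hf := (hasDerivAt_radialFactor (ρ := ρ) hl hq).comp_hasFDerivAt z (hasFDerivAt_normSq z)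
  have hc := (hasDerivAt_vertical (ρ := ρ) hl hq).comp_hasFDerivAt z (hasFDerivAt_normSq z)
  have hp : ∀ i : Fin 2, HasFDerivAt (fun z : Plane => z i)
      (EuclideanSpace.proj (𝕜 := ℝ) i : Plane →L[ℝ] ℝ) z := fun i =>
    (EuclideanSpace.proj (𝕜 := ℝ) i : Plane →L[ℝ] ℝ).hasFDerivAt
  have hcoord : ∀ i : Fin 3, HasFDerivAt (fun z => bubble l ρ z i)
      ((EuclideanSpace.proj (𝕜 := ℝ) i : Space →L[ℝ] ℝ).comp (fderiv ℝ (bubble l ρ) z)) z :=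
    fun i => (EuclideanSpace.proj (𝕜 := ℝ) i : Space →L[ℝ] ℝ).hasFDerivAt.comp z hd
  have h0 := DFunLike.congr_fun ((hcoord 0).unique (f := fun z => bubble l ρ z 0)
    ((hf.mul (hp 0)).neg)) v
  have h1 := DFunLike.congr_fun ((hcoord 1).unique (f := fun z => bubble l ρ z 1)
    ((hf.mul (hp 1)).neg)) v
  have h2 := DFunLike.congr_fun ((hcoord 2).unique (f := fun z => bubble l ρ z 2) hc) v
  ext i
  fin_cases i
  · simp at h0 ⊢
    rw [h0]; ring
  · simp at h1 ⊢
    rw [h1]; ring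
  · simp at h2 ⊢
    rw [h2]; ring

end Bubble

/-! ### The energy densities of the bubble -/

section BubblePointwise

variable {l ρ : ℝ}

/-- The Jacobian density `b · (∂₁ b × ∂₂ b)` of the bubble as a function of `q = |z|²`. -/
def bubbleJac (l ρ q : ℝ) : ℝ :=
  4 * profile l ρ q * (profile l ρ q - 2 * q * profileDeriv l ρ q) / denom l ρ q ^ 2

/-- The density of the Dirichlet energy of the bubble in excess of twice its Jacobian, as a function
of `q = |z|²`. It is due to the cutoff and vanishes for a constant profile. -/
def bubbleExcess (l ρ q : ℝ) : ℝ := 16 * q ^ 2 * profileDeriv l ρ q ^ 2 / denom l ρ q ^ 2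

theorem plane_normSq (z : Plane) : ‖z‖ ^ 2 = z 0 ^ 2 + z 1 ^ 2 := by
  rw [EuclideanSpace.norm_sq_eq]; simp [Fin.sum_univ_two]

theorem inner_bx (z : Plane) (i : Fin 2) : inner ℝ z (bx i) = z i := by
  simp [bx, EuclideanSpace.inner_single_right]

theorem denom_ne (hl : 0 < l) (z : Plane) :
    profile l ρ (‖z‖ ^ 2) ^ 2 + (z 0 ^ 2 + z 1 ^ 2) ≠ 0 := by
  rw [← plane_normSq]
  exact (denom_pos (ρ := ρ) hl (sq_nonneg ‖z‖)).ne'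

theorem fderiv_bubble_zero (hl : 0 < l) (z : Plane) :
    fderiv ℝ (bubble l ρ) z (bx 0) = !₂[
      -(radialFactor l ρ (‖z‖ ^ 2) + 2 * radialFactorDeriv l ρ (‖z‖ ^ 2) * z 0 * z 0),
      -(2 * radialFactorDeriv l ρ (‖z‖ ^ 2) * z 0 * z 1),
      2 * verticalDeriv l ρ (‖z‖ ^ 2) * z 0] := by
  rw [fderiv_bubble hl, inner_bx]
  simp [bx]

theorem fderiv_bubble_one (hl : 0 < l) (z : Plane) :
    fderiv ℝ (bubble l ρ) z (bx 1) = !₂[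
      -(2 * radialFactorDeriv l ρ (‖z‖ ^ 2) * z 1 * z 0),
      -(radialFactor l ρ (‖z‖ ^ 2) + 2 * radialFactorDeriv l ρ (‖z‖ ^ 2) * z 1 * z 1),
      2 * verticalDeriv l ρ (‖z‖ ^ 2) * z 1] := by
  rw [fderiv_bubble hl, inner_bx]
  simp [bx]

theorem sum_norm_sq_fderiv_bubble (hl : 0 < l) (z : Plane) :
    ∑ i, ‖fderiv ℝ (bubble l ρ) z (bx i)‖ ^ 2 =
      2 * bubbleJac l ρ (‖z‖ ^ 2) + bubbleExcess l ρ (‖z‖ ^ 2) := by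
  rw [Fin.sum_univ_two, norm_sq_eq_sum, norm_sq_eq_sum, fderiv_bubble_zero hl,
    fderiv_bubble_one hl]
  exact bubble_gradient_identity (denom_ne hl z) (plane_normSq z) rfl rfl rfl rfl

theorem jac_bubble (hl : 0 < l) (z : Plane) :
    jac (bubble l ρ z - e₃) (fderiv ℝ (bubble l ρ) z (bx 0)) (fderiv ℝ (bubble l ρ) z (bx 1)) =
      bubbleJac l ρ (‖z‖ ^ 2) := by
  rw [jac_eq, fderiv_bubble_zero hl, fderiv_bubble_one hl]
  have := bubble_jacobian_identity (denom_ne (ρ := ρ) hl z) (plane_normSq z)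
    (D := denom l ρ (‖z‖ ^ 2)) (k := profileDeriv l ρ (‖z‖ ^ 2))
    (f := radialFactor l ρ (‖z‖ ^ 2)) (f' := radialFactorDeriv l ρ (‖z‖ ^ 2))
    (c := vertical l ρ (‖z‖ ^ 2)) (c' := verticalDeriv l ρ (‖z‖ ^ 2)) rfl rfl rfl rfl rfl
  simpa [bubble, e₃, bubbleJac] using this

theorem dmi_bubble (hl : 0 < l) (z : Plane) :
    bubble l ρ z 0 * fderiv ℝ (bubble l ρ) z (bx 0) 2 +
      bubble l ρ z 1 * fderiv ℝ (bubble l ρ) z (bx 1) 2 =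
    8 * profile l ρ (‖z‖ ^ 2) ^ 2 * (profile l ρ (‖z‖ ^ 2) -
      2 * ‖z‖ ^ 2 * profileDeriv l ρ (‖z‖ ^ 2)) * ‖z‖ ^ 2 / denom l ρ (‖z‖ ^ 2) ^ 3 := by
  rw [fderiv_bubble_zero hl, fderiv_bubble_one hl]
  exact bubble_dmi_identity (denom_ne hl z) (plane_normSq z) rfl rfl rfl

theorem norm_sq_bubble (hl : 0 < l) (z : Plane) :
    ‖bubble l ρ z‖ ^ 2 = 4 * profile l ρ (‖z‖ ^ 2) ^ 2 / denom l ρ (‖z‖ ^ 2) := by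
  have h := (denom_pos (ρ := ρ) hl (sq_nonneg ‖z‖)).ne'
  rw [norm_sq_eq_sum]
  simp only [bubble, radialFactor, vertical]
  have h2 : z 0 ^ 2 + z 1 ^ 2 = denom l ρ (‖z‖ ^ 2) - profile l ρ (‖z‖ ^ 2) ^ 2 := by
    rw [← plane_normSq, denom]; ring
  generalize denom l ρ (‖z‖ ^ 2) = D at *
  generalize profile l ρ (‖z‖ ^ 2) = h at *
  simp
  field_simp
  linear_combination (4 * h ^ 2) * h2

theorem norm_bubble_sub (hl : 0 < l) (z : Plane) : ‖bubble l ρ z - e₃‖ = 1 := by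
  have h : ‖bubble l ρ z - e₃‖ ^ 2 = 1 := by
    have h1 := norm_sq_bubble (ρ := ρ) hl z
    rw [norm_sq_eq_sum] at h1 ⊢
    have h2 : bubble l ρ z 2 = 2 * profile l ρ (‖z‖ ^ 2) ^ 2 / denom l ρ (‖z‖ ^ 2) := rfl
    have h3 : (bubble l ρ z - e₃) 0 = bubble l ρ z 0 := by simp [e₃]
    have h4 : (bubble l ρ z - e₃) 1 = bubble l ρ z 1 := by simp [e₃]
    have h5 : (bubble l ρ z - e₃) 2 = bubble l ρ z 2 - 1 := by simp [e₃]
    rw [h3, h4, h5]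
    have h6 : 4 * profile l ρ (‖z‖ ^ 2) ^ 2 / denom l ρ (‖z‖ ^ 2) = 2 * bubble l ρ z 2 := by
      rw [h2]; ring
    linarith
  nlinarith [norm_nonneg (bubble l ρ z - e₃)]

theorem factor_nonneg (hl : 0 < l) {q : ℝ} (hq : 0 ≤ q) :
    profile l ρ q ≤ profile l ρ q - 2 * q * profileDeriv l ρ q := by
  nlinarith [mul_nonneg hq (neg_nonneg.2 (profileDeriv_nonpos (ρ := ρ) hl q))]

theorem factor_le (hl : 0 < l) (hρ : 0 < ρ) {q : ℝ} (hq : 0 ≤ q) :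
    profile l ρ q - 2 * q * profileDeriv l ρ q ≤ 5 * l := by
  have h1 := mul_abs_profileDeriv_le hl hρ hq
  rw [abs_of_nonpos (profileDeriv_nonpos hl q)] at h1
  linarith [profile_le (ρ := ρ) hl hq]

theorem bubbleJac_nonneg (hl : 0 < l) {q : ℝ} (hq : 0 ≤ q) : 0 ≤ bubbleJac l ρ q := by
  have h1 := factor_nonneg (ρ := ρ) hl hq
  have h2 := profile_nonneg (ρ := ρ) hl q
  unfold bubbleJac
  have h3 : 0 ≤ profile l ρ q - 2 * q * profileDeriv l ρ q := h2.trans h1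
  positivity

theorem bubbleExcess_le (hl : 0 < l) {q : ℝ} (hq : 0 ≤ q) :
    bubbleExcess l ρ q ≤ 64 * l ^ 2 / ρ ^ 4 := by
  have h1 := abs_profileDeriv_le (ρ := ρ) hl hq
  have h2 := le_denom l ρ q
  have h3 := denom_pos (ρ := ρ) hl hq
  have h4 : profileDeriv l ρ q ^ 2 ≤ (2 * l / ρ ^ 2) ^ 2 := by
    rw [← sq_abs]; gcongr
  have h5 : q ^ 2 / denom l ρ q ^ 2 ≤ 1 := by
    rw [div_le_one (by positivity)]; gcongr
  calc bubbleExcess l ρ q = 16 * (q ^ 2 / denom l ρ q ^ 2) * profileDeriv l ρ q ^ 2 := by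
        unfold bubbleExcess; ring
    _ ≤ 16 * 1 * (2 * l / ρ ^ 2) ^ 2 := by gcongr
    _ = _ := by rw [div_pow]; ring

theorem bubbleExcess_eq_zero (hρ : 0 < ρ) {q : ℝ} (hq : ρ ^ 2 ≤ q) : bubbleExcess l ρ q = 0 := by
  simp [bubbleExcess, profileDeriv_eq_zero hρ hq]

/-- The decay of the bubble is that of the stereographic projection of size `l`. -/
theorem norm_sq_bubble_le (hl : 0 < l) (hρ : 0 < ρ) (hlρ : l ≤ ρ) (z : Plane) :
    ‖bubble l ρ z‖ ^ 2 ≤ 20 * l ^ 2 / (l ^ 2 + ‖z‖ ^ 2) := by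
  have hq := sq_nonneg ‖z‖
  rw [norm_sq_bubble hl]
  have h1 := denom_ge hl hρ hlρ hq
  have h2 := profile_le (ρ := ρ) hl hq
  have h3 := profile_nonneg (ρ := ρ) hl (‖z‖ ^ 2)
  calc _ ≤ 4 * l ^ 2 / ((l ^ 2 + ‖z‖ ^ 2) / 5) := by gcongr
    _ = _ := by field_simp; norm_num

theorem norm_sq_fderiv_bubble_le (hl : 0 < l) (hρ : 0 < ρ) (hlρ : l ≤ ρ) (z : Plane) (i : Fin 2) :
    ‖fderiv ℝ (bubble l ρ) z (bx i)‖ ^ 2 ≤ 2600 * l ^ 2 / (l ^ 2 + ‖z‖ ^ 2) ^ 2 := by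
  have hq := sq_nonneg ‖z‖
  have hs : ‖fderiv ℝ (bubble l ρ) z (bx i)‖ ^ 2 ≤
      ∑ i, ‖fderiv ℝ (bubble l ρ) z (bx i)‖ ^ 2 :=
    Finset.single_le_sum (f := fun i => ‖fderiv ℝ (bubble l ρ) z (bx i)‖ ^ 2)
      (fun _ _ => sq_nonneg _) (Finset.mem_univ i)
  refine hs.trans ?_
  rw [sum_norm_sq_fderiv_bubble hl]
  have h1 := denom_ge hl hρ hlρ hq
  have h2 := profile_le (ρ := ρ) hl hq
  have h3 := profile_nonneg (ρ := ρ) hl (‖z‖ ^ 2)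
  have h4 := factor_le hl hρ hq
  have h5 := factor_nonneg (ρ := ρ) hl hq
  have h6 := mul_abs_profileDeriv_le hl hρ hq
  have h7 : (‖z‖ ^ 2) ^ 2 * profileDeriv l ρ (‖z‖ ^ 2) ^ 2 ≤ (2 * l) ^ 2 := by
    rw [← mul_pow, ← sq_abs, abs_mul, abs_of_nonneg hq]
    gcongr
  have e : 2 * bubbleJac l ρ (‖z‖ ^ 2) + bubbleExcess l ρ (‖z‖ ^ 2) =
      (8 * (profile l ρ (‖z‖ ^ 2) * (profile l ρ (‖z‖ ^ 2) -
        2 * ‖z‖ ^ 2 * profileDeriv l ρ (‖z‖ ^ 2))) +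
      16 * ((‖z‖ ^ 2) ^ 2 * profileDeriv l ρ (‖z‖ ^ 2) ^ 2)) / denom l ρ (‖z‖ ^ 2) ^ 2 := by
    unfold bubbleJac bubbleExcess; ring
  rw [e]
  calc _ ≤ (8 * (l * (5 * l)) + 16 * (2 * l) ^ 2) / ((l ^ 2 + ‖z‖ ^ 2) / 5) ^ 2 := by
        gcongr
        linarith
    _ = _ := by field_simp; norm_num

theorem dmi_bubble_nonneg (hl : 0 < l) (z : Plane) :
    0 ≤ bubble l ρ z 0 * fderiv ℝ (bubble l ρ) z (bx 0) 2 +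
      bubble l ρ z 1 * fderiv ℝ (bubble l ρ) z (bx 1) 2 := by
  rw [dmi_bubble hl]
  have hq := sq_nonneg ‖z‖
  have h1 := factor_nonneg (ρ := ρ) hl hq
  have h2 := profile_nonneg (ρ := ρ) hl (‖z‖ ^ 2)
  have h3 := h2.trans h1
  have h4 := denom_pos (ρ := ρ) hl hq
  positivity

theorem le_dmi_bubble (hl : 0 < l) (hlρ : 4 * l ≤ ρ) {z : Plane} (h1 : l ≤ ‖z‖)
    (h2 : ‖z‖ ≤ 2 * l) : 1 / (125 * l) ≤
    bubble l ρ z 0 * fderiv ℝ (bubble l ρ) z (bx 0) 2 +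
      bubble l ρ z 1 * fderiv ℝ (bubble l ρ) z (bx 1) 2 := by
  rw [dmi_bubble hl]
  have hρ : 0 < ρ := by linarith
  have hq := sq_nonneg ‖z‖
  have hq1 : l ^ 2 ≤ ‖z‖ ^ 2 := by gcongr
  have hq2 : ‖z‖ ^ 2 ≤ 4 * l ^ 2 := by nlinarith
  have h3 := half_le_profile (q := ‖z‖ ^ 2) hl hρ (by nlinarith)
  have h4 := h3.trans (factor_nonneg (ρ := ρ) hl hq)
  have h5 := denom_pos (ρ := ρ) hl hq
  have h6 : denom l ρ (‖z‖ ^ 2) ≤ 5 * l ^ 2 := (denom_le hl hq).trans (by linarith)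
  calc 1 / (125 * l) = 8 * (l / 2) ^ 2 * (l / 2) * l ^ 2 / (5 * l ^ 2) ^ 3 := by
        field_simp; norm_num
    _ ≤ _ := by
        have h7 : 0 ≤ profile l ρ (‖z‖ ^ 2) -
          2 * ‖z‖ ^ 2 * profileDeriv l ρ (‖z‖ ^ 2) := le_trans (by positivity) h4
        gcongr

end BubblePointwise

/-! ### The energies of the bubble -/

section BubbleIntegrals

variable {l ρ : ℝ}

theorem volume_real_ball (z : Plane) {r : ℝ} (hr : 0 ≤ r) :
    volume.real (Metric.ball z r) = Real.pi * r ^ 2 := by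
  rw [Measure.real, EuclideanSpace.volume_ball_fin_two]
  simp [ENNReal.toReal_mul, ENNReal.toReal_ofReal hr, Real.pi_pos.le]
  ring

/-- The Jacobian density is a radial derivative of the vertical component, up to a factor. -/
theorem verticalDeriv_eq (l ρ q : ℝ) : verticalDeriv l ρ q = -(bubbleJac l ρ q / 2) := by
  unfold verticalDeriv bubbleJac
  have : denom l ρ q = profile l ρ q ^ 2 + q := rfl
  rw [← neg_div, ← neg_div, div_div, mul_comm _ (2 : ℝ), ← div_div]
  congr 1
  rw [this]
  ring

/-- The bubble covers the sphere once. -/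
theorem integral_bubbleJac (hl : 0 < l) (hρ : 0 < ρ) :
    ∫ z : Plane, bubbleJac l ρ (‖z‖ ^ 2) = 4 * Real.pi := by
  have h1 := integral_fun_norm_addHaar (volume : Measure Plane) fun r => bubbleJac l ρ (r ^ 2)
  rw [h1]
  have hd : ∀ r ∈ Set.Ici (0 : ℝ), HasDerivAt (fun r => -vertical l ρ (r ^ 2))
      (r * bubbleJac l ρ (r ^ 2)) r := by
    intro r _
    have h0 : HasDerivAt (fun r : ℝ => r ^ 2) (2 * r) r := by simpa using hasDerivAt_pow 2 r
    have h2 : HasDerivAt (vertical l ρ) (verticalDeriv l ρ (r ^ 2)) ((fun r : ℝ => r ^ 2) r) :=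
      hasDerivAt_vertical hl (sq_nonneg r)
    refine (HasDerivAt.comp (h := fun r : ℝ => r ^ 2) r h2 h0).neg.congr_deriv ?_
    rw [verticalDeriv_eq]
    norm_num
    ring
  have hlim : Tendsto (fun r => -vertical l ρ (r ^ 2)) atTop (𝓝 0) := by
    refine tendsto_const_nhds.congr' ?_
    filter_upwards [eventually_ge_atTop ρ] with r hr
    simp [vertical, profile_eq_zero (l := l) hρ (q := r ^ 2) (by gcongr)]
  have h3 := integral_Ioi_of_hasDerivAt_of_nonneg' hd
    (fun r hr => mul_nonneg (le_of_lt hr) (bubbleJac_nonneg hl (sq_nonneg r))) hlim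
  have h4 : vertical l ρ 0 = 2 := by
    simp [vertical, denom, profile_zero]
    field_simp
  simp only [finrank_euclideanSpace, Fintype.card_fin, Nat.add_one_sub_one, pow_one, smul_eq_mul]
  rw [h3, volume_real_ball _ zero_le_one]
  norm_num [h4]
  ring

theorem continuous_bubbleJac (hl : 0 < l) :
    Continuous fun z : Plane => bubbleJac l ρ (‖z‖ ^ 2) := by
  have h1 : Continuous fun z : Plane => profile l ρ (‖z‖ ^ 2) :=
    (contDiff_profile l ρ).continuous.comp (by fun_prop)
  have h2 : Continuous fun z : Plane => profileDeriv l ρ (‖z‖ ^ 2) := by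
    unfold profileDeriv; fun_prop
  have h3 : Continuous fun z : Plane => denom l ρ (‖z‖ ^ 2) := (contDiff_denom_norm l ρ).continuous
  unfold bubbleJac
  exact Continuous.div (by fun_prop) (by fun_prop) fun z =>
    pow_ne_zero 2 (denom_pos hl (sq_nonneg _)).ne'

theorem continuous_bubbleExcess (hl : 0 < l) :
    Continuous fun z : Plane => bubbleExcess l ρ (‖z‖ ^ 2) := by
  have h2 : Continuous fun z : Plane => profileDeriv l ρ (‖z‖ ^ 2) := by
    unfold profileDeriv; fun_prop
  have h3 : Continuous fun z : Plane => denom l ρ (‖z‖ ^ 2) := (contDiff_denom_norm l ρ).continuous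
  unfold bubbleExcess
  exact Continuous.div (by fun_prop) (by fun_prop) fun z =>
    pow_ne_zero 2 (denom_pos hl (sq_nonneg _)).ne'

theorem integrable_of_continuous_of_zero {f : Plane → ℝ} (hf : Continuous f)
    (h0 : ∀ z ∉ Metric.ball (0 : Plane) ρ, f z = 0) : Integrable f volume := by
  refine hf.integrable_of_hasCompactSupport ?_
  refine HasCompactSupport.of_support_subset_isCompact (isCompact_closedBall (0 : Plane) ρ) ?_
  intro z hz
  by_contra hcon
  exact hz (h0 z fun h => hcon (Metric.ball_subset_closedBall h))

theorem sq_le_of_notMem (hρ : 0 < ρ) {z : Plane} (hz : z ∉ Metric.ball (0 : Plane) ρ) :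
    ρ ^ 2 ≤ ‖z‖ ^ 2 := by
  rw [mem_ball_zero_iff, not_lt] at hz
  gcongr

theorem integrable_bubbleJac (hl : 0 < l) (hρ : 0 < ρ) :
    Integrable (fun z : Plane => bubbleJac l ρ (‖z‖ ^ 2)) volume :=
  integrable_of_continuous_of_zero (ρ := ρ) (continuous_bubbleJac hl) fun z hz => by
    simp [bubbleJac, profile_eq_zero hρ (sq_le_of_notMem hρ hz)]

theorem integrable_bubbleExcess (hl : 0 < l) (hρ : 0 < ρ) :
    Integrable (fun z : Plane => bubbleExcess l ρ (‖z‖ ^ 2)) volume :=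
  integrable_of_continuous_of_zero (ρ := ρ) (continuous_bubbleExcess hl) fun _ hz =>
    bubbleExcess_eq_zero hρ (sq_le_of_notMem hρ hz)

theorem integrable_indicator_const {S : Set Plane} (hS : MeasurableSet S) (hv : volume S ≠ ⊤)
    (c : ℝ) : Integrable (S.indicator fun _ => c) volume :=
  (integrable_indicator_iff hS).2 (integrableOn_const hv)

theorem integrable_indicator_ball (z : Plane) (r c : ℝ) :
    Integrable ((Metric.ball z r).indicator fun _ => c) volume :=
  integrable_indicator_const Metric.isOpen_ball.measurableSet measure_ball_lt_top.ne c

/-- An integral over the plane of a function that is bounded and vanishes outside a disc. -/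
theorem integral_le_of_le_of_zero {f : Plane → ℝ} (hf : Integrable f volume) {c : ℝ} (hρ : 0 < ρ)
    (hc : 0 ≤ c) (h1 : ∀ z, f z ≤ c) (h0 : ∀ z ∉ Metric.ball (0 : Plane) ρ, f z = 0) :
    ∫ z, f z ≤ 4 * c * ρ ^ 2 := by
  have h2 : ∫ z, f z ≤ ∫ z, (Metric.ball (0 : Plane) ρ).indicator (fun _ => c) z := by
    refine integral_mono hf (integrable_indicator_ball _ _ _) fun z => ?_
    by_cases hz : z ∈ Metric.ball (0 : Plane) ρ
    · rw [Set.indicator_of_mem hz]; exact h1 z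
    · rw [Set.indicator_of_notMem hz, h0 z hz]
  refine h2.trans ?_
  rw [integral_indicator Metric.isOpen_ball.measurableSet, setIntegral_const,
    volume_real_ball _ hρ.le, smul_eq_mul]
  have := Real.pi_le_four
  have h3 : 0 ≤ ρ ^ 2 * c := by positivity
  nlinarith

theorem integral_bubbleExcess_le (hl : 0 < l) (hρ : 0 < ρ) :
    ∫ z : Plane, bubbleExcess l ρ (‖z‖ ^ 2) ≤ 256 * l ^ 2 / ρ ^ 2 := by
  refine (integral_le_of_le_of_zero (integrable_bubbleExcess hl hρ) hρ
    (c := 64 * l ^ 2 / ρ ^ 4) (by positivity) (fun z => bubbleExcess_le hl (sq_nonneg _))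
    fun z hz => bubbleExcess_eq_zero hρ (sq_le_of_notMem hρ hz)).trans (le_of_eq ?_)
  field_simp
  norm_num

theorem integrable_norm_sq_bubble (hl : 0 < l) (hρ : 0 < ρ) :
    Integrable (fun z => ‖bubble l ρ z‖ ^ 2) volume :=
  integrable_of_continuous_of_zero (ρ := ρ) ((contDiff_bubble hl).continuous.norm.pow 2) fun z hz => by
    simp [bubble_eq_zero hρ hz]

/-- The `L²` norm grows with the cutoff radius `ρ`; the stereographic projection itself is not
square integrable. -/
theorem integral_norm_sq_bubble_le (hl : 0 < l) (hρ : 0 < ρ) :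
    ∫ z, ‖bubble l ρ z‖ ^ 2 ≤ 32 * (l * ρ) := by
  -- Use `|b + e₃| ≤ 2` in the disc of radius `√(l ρ)`, and `|b + e₃|² ≤ 4 l² / q` outside it.
  set s := √(l * ρ) with hs
  have hs0 : 0 < s := Real.sqrt_pos.2 (by positivity)
  have hs2 : s ^ 2 = l * ρ := Real.sq_sqrt (by positivity)
  have hint : ∀ {r : ℝ} (c : ℝ), Integrable ((Metric.ball (0 : Plane) r).indicator fun _ => c)
      volume := fun {r} c => integrable_indicator_ball 0 r c
  have h1 : ∀ z, ‖bubble l ρ z‖ ^ 2 ≤ (Metric.ball (0 : Plane) s).indicator (fun _ => 4) z +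
      (Metric.ball (0 : Plane) ρ).indicator (fun _ => 4 * l / ρ) z := by
    intro z
    have hq := sq_nonneg ‖z‖
    have hD := denom_pos (ρ := ρ) hl hq
    have h4 : 0 ≤ (Metric.ball (0 : Plane) ρ).indicator (fun _ => 4 * l / ρ) z :=
      Set.indicator_nonneg (fun _ _ => by positivity) _
    by_cases hz : z ∈ Metric.ball (0 : Plane) s
    · rw [Set.indicator_of_mem hz]
      have h2 : ‖bubble l ρ z‖ ^ 2 ≤ 4 := by
        rw [norm_sq_bubble hl, div_le_iff₀ hD]
        unfold denom
        linarith
      linarith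
    · rw [Set.indicator_of_notMem hz, zero_add]
      by_cases hz2 : z ∈ Metric.ball (0 : Plane) ρ
      · rw [Set.indicator_of_mem hz2, norm_sq_bubble hl]
        have h5 := sq_le_of_notMem hs0 hz
        have h6 := le_denom l ρ (‖z‖ ^ 2)
        have h7 := profile_le (ρ := ρ) hl hq
        have h8 := profile_nonneg (ρ := ρ) hl (‖z‖ ^ 2)
        calc _ ≤ 4 * l ^ 2 / (l * ρ) := by
              gcongr
              linarith
          _ = _ := by field_simp
      · rw [bubble_eq_zero hρ hz2]
        simpa using h4
  have h2 := integral_mono (integrable_norm_sq_bubble hl hρ) ((hint 4).add (hint (4 * l / ρ))) h1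
  refine h2.trans ?_
  simp only [Pi.add_apply]
  rw [integral_add (hint 4) (hint (4 * l / ρ)), integral_indicator Metric.isOpen_ball.measurableSet,
    integral_indicator Metric.isOpen_ball.measurableSet, setIntegral_const, setIntegral_const,
    volume_real_ball _ hs0.le, volume_real_ball _ hρ.le, smul_eq_mul, smul_eq_mul, hs2]
  have e : Real.pi * (l * ρ) * 4 + Real.pi * ρ ^ 2 * (4 * l / ρ) = Real.pi * (8 * (l * ρ)) := by
    field_simp; ring
  rw [e]
  have := Real.pi_le_four
  have h3 : 0 ≤ l * ρ := by positivity
  nlinarith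

/-- The density `m' · ∇ m₃` of the bubble, for `m = b`. -/
def bubbleDmi (l ρ : ℝ) (z : Plane) : ℝ :=
  bubble l ρ z 0 * fderiv ℝ (bubble l ρ) z (bx 0) 2 +
    bubble l ρ z 1 * fderiv ℝ (bubble l ρ) z (bx 1) 2

theorem continuous_fderiv_bubble_apply (hl : 0 < l) (v : Plane) :
    Continuous fun z => fderiv ℝ (bubble l ρ) z v :=
  (continuous_fderiv_of_C1 (contDiff_bubble hl)).clm_apply continuous_const

theorem integrable_bubbleDmi (hl : 0 < l) (hρ : 0 < ρ) :
    Integrable (bubbleDmi l ρ) volume := by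
  have h1 := (contDiff_bubble (ρ := ρ) hl).continuous
  have h2 := continuous_fderiv_bubble_apply (ρ := ρ) hl
  refine integrable_of_continuous_of_zero (ρ := ρ) ?_ fun z hz => ?_
  · have h3 := h2 (bx 0)
    have h4 := h2 (bx 1)
    have hc : ∀ {f : Plane → Space}, Continuous f → ∀ i, Continuous fun z => f z i :=
      fun hf i => (EuclideanSpace.proj (𝕜 := ℝ) i : Space →L[ℝ] ℝ).continuous.comp hf
    exact ((hc h1 0).mul (hc h3 2)).add ((hc h1 1).mul (hc h4 2))
  · simp [bubbleDmi, bubble_eq_zero hρ hz]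

/-- The interaction term of the bubble is nonnegative, with integral at least a multiple of `l`. -/
theorem le_integral_bubbleDmi (hl : 0 < l) (hlρ : 4 * l ≤ ρ) :
    l / 14 ≤ ∫ z, bubbleDmi l ρ z := by
  have hρ : 0 < ρ := by linarith
  -- On the annulus `l ≤ |z| ≤ 2 l` the density is at least a multiple of `1 / l`.
  set S : Set Plane := Metric.ball 0 (2 * l) \ Metric.ball 0 l with hS
  have hSm : MeasurableSet S := Metric.isOpen_ball.measurableSet.diff
    Metric.isOpen_ball.measurableSet
  have hSfin : volume S ≠ ⊤ := ((measure_mono Set.sdiff_subset).trans_lt measure_ball_lt_top).ne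
  have hSv : volume.real S = Real.pi * (3 * l ^ 2) := by
    rw [hS, measureReal_sdiff (Metric.ball_subset_ball (by linarith))
      Metric.isOpen_ball.measurableSet, volume_real_ball _ (by positivity), volume_real_ball _ hl.le]
    ring
  have h1 : ∫ z, S.indicator (fun _ => 1 / (125 * l)) z ≤ ∫ z, bubbleDmi l ρ z := by
    refine integral_mono (integrable_indicator_const hSm hSfin _)
      (integrable_bubbleDmi hl hρ) fun z => ?_
    by_cases hz : z ∈ S
    · rw [Set.indicator_of_mem hz]
      simp only [hS, Set.mem_sdiff, mem_ball_zero_iff, not_lt] at hz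
      exact le_dmi_bubble hl hlρ hz.2 hz.1.le
    · rw [Set.indicator_of_notMem hz]
      exact dmi_bubble_nonneg hl z
  refine le_trans ?_ h1
  rw [integral_indicator hSm, setIntegral_const, hSv, smul_eq_mul]
  have h2 := Real.pi_gt_three
  have e : Real.pi * (3 * l ^ 2) * (1 / (125 * l)) = Real.pi * (3 * l / 125) := by
    field_simp
  rw [e]
  nlinarith

/-- The interaction terms `|b + e₃| |∇ b|` integrate to a multiple of the scale of the bubble. -/
theorem exists_integral_norm_mul_le : ∃ C : ℝ, 0 < C ∧ ∀ {l ρ : ℝ}, 0 < l → l ≤ ρ → ∀ i : Fin 2,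
    Integrable (fun z => ‖bubble l ρ z‖ * ‖fderiv ℝ (bubble l ρ) z (bx i)‖) volume ∧
    ∫ z, ‖bubble l ρ z‖ * ‖fderiv ℝ (bubble l ρ) z (bx i)‖ ≤ C * l := by
  -- After scaling to `l = 1` the product decays like `|y|⁻³`, which is integrable in the plane.
  set F : Plane → ℝ := fun y => (1 + ‖y‖ ^ 2) ^ (-(3 : ℝ) / 2) with hF
  have hFi : Integrable F volume :=
    integrable_rpow_neg_one_add_norm_sq (by simp; norm_num)
  have hF0 : 0 ≤ ∫ y, F y := integral_nonneg fun y => by positivity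
  refine ⟨229 * (∫ y, F y) + 1, by positivity, fun {l ρ} hl hlρ i => ?_⟩
  have hρ : 0 < ρ := hl.trans_le hlρ
  have hint : Integrable (fun z => ‖bubble l ρ z‖ * ‖fderiv ℝ (bubble l ρ) z (bx i)‖) volume := by
    refine integrable_of_continuous_of_zero (ρ := ρ) ?_ fun z hz => ?_
    · exact (contDiff_bubble hl).continuous.norm.mul (continuous_fderiv_bubble_apply hl _).norm
    · simp [bubble_eq_zero hρ hz]
  refine ⟨hint, ?_⟩
  have hle : ∀ z, ‖bubble l ρ z‖ * ‖fderiv ℝ (bubble l ρ) z (bx i)‖ ≤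
      229 * l⁻¹ * F (l⁻¹ • z) := by
    intro z
    have hFsq : F (l⁻¹ • z) ^ 2 = l ^ 6 / (l ^ 2 + ‖z‖ ^ 2) ^ 3 := by
      have e1 : 1 + ‖l⁻¹ • z‖ ^ 2 = (l ^ 2 + ‖z‖ ^ 2) / l ^ 2 := by
        rw [norm_smul, norm_inv, Real.norm_of_nonneg hl.le]; field_simp
      have e0 : 0 ≤ (l ^ 2 + ‖z‖ ^ 2) / l ^ 2 := by positivity
      simp only [hF]
      rw [e1, ← Real.rpow_natCast, ← Real.rpow_mul e0]
      norm_num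
      field_simp
    have h1 := norm_sq_bubble_le hl hρ hlρ z
    have h2 := norm_sq_fderiv_bubble_le hl hρ hlρ z i
    refine abs_le_of_sq_le_sq' ?_ (by positivity) |>.2
    rw [mul_pow, mul_pow _ (F _), hFsq]
    calc _ ≤ (20 * l ^ 2 / (l ^ 2 + ‖z‖ ^ 2)) * (2600 * l ^ 2 / (l ^ 2 + ‖z‖ ^ 2) ^ 2) := by gcongr
      _ = 52000 * (l ^ 4 / (l ^ 2 + ‖z‖ ^ 2) ^ 3) := by field_simp; norm_num
      _ ≤ 229 ^ 2 * (l ^ 4 / (l ^ 2 + ‖z‖ ^ 2) ^ 3) := by gcongr; norm_num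
      _ = _ := by field_simp
  have hFs : Integrable (fun z => F (l⁻¹ • z)) volume := by
    exact hFi.comp_smul (inv_ne_zero hl.ne')
  have h3 := integral_mono hint (hFs.const_mul (229 * l⁻¹)) hle
  refine h3.trans ?_
  rw [integral_const_mul, Measure.integral_comp_smul]
  simp only [finrank_euclideanSpace, Fintype.card_fin, smul_eq_mul]
  have e : |((l⁻¹) ^ 2)⁻¹| = l ^ 2 := by
    rw [inv_pow, inv_inv, abs_of_nonneg (by positivity)]
  rw [e]
  have e2 : 229 * l⁻¹ * (l ^ 2 * ∫ y, F y) = 229 * (∫ y, F y) * l := by field_simp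
  rw [e2]
  nlinarith

end BubbleIntegrals

/-! ### Rotations -/

section Rotation

/-- The rotation that takes `e₃` to the unit vector `n` along the shortest arc. The formula has the
denominator `1 + n₃`, and is used only for unit vectors in the upper half space. -/
def rotation (n : Space) : Space →L[ℝ] Space :=
  LinearMap.toContinuousLinearMap
    { toFun := fun a => !₂[
        (1 - n 0 ^ 2 * (1 + n 2)⁻¹) * a 0 - n 0 * n 1 * (1 + n 2)⁻¹ * a 1 + n 0 * a 2,
        -(n 0 * n 1 * (1 + n 2)⁻¹ * a 0) + (1 - n 1 ^ 2 * (1 + n 2)⁻¹) * a 1 + n 1 * a 2,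
        -(n 0 * a 0) - n 1 * a 1 + n 2 * a 2]
      map_add' := fun a b => by
        ext i
        fin_cases i <;> simp <;> ring
      map_smul' := fun c a => by
        ext i
        fin_cases i <;> simp <;> ring }

theorem rotation_zero (n a : Space) : rotation n a 0 =
    (1 - n 0 ^ 2 * (1 + n 2)⁻¹) * a 0 - n 0 * n 1 * (1 + n 2)⁻¹ * a 1 + n 0 * a 2 := rfl

theorem rotation_one (n a : Space) : rotation n a 1 =
    -(n 0 * n 1 * (1 + n 2)⁻¹ * a 0) + (1 - n 1 ^ 2 * (1 + n 2)⁻¹) * a 1 + n 1 * a 2 := rfl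

theorem rotation_two (n a : Space) : rotation n a 2 =
    -(n 0 * a 0) - n 1 * a 1 + n 2 * a 2 := rfl

theorem rotation_e₃ (n : Space) : rotation n e₃ = n := by
  ext i
  fin_cases i
  · show rotation n e₃ 0 = n 0
    rw [rotation_zero]; simp [e₃]
  · show rotation n e₃ 1 = n 1
    rw [rotation_one]; simp [e₃]
  · show rotation n e₃ 2 = n 2
    rw [rotation_two]; simp [e₃]

variable {n : Space}

theorem norm_rotation (hn : ‖n‖ = 1) (h2 : 0 ≤ n 2) (a : Space) : ‖rotation n a‖ = ‖a‖ := by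
  have h1 : n 0 ^ 2 + n 1 ^ 2 + n 2 ^ 2 = 1 := by rw [← norm_sq_eq_sum, hn, one_pow]
  have hs : (1 + n 2)⁻¹ * (1 + n 2) = 1 := inv_mul_cancel₀ (by linarith)
  have h : ‖rotation n a‖ ^ 2 = ‖a‖ ^ 2 := by
    rw [norm_sq_eq_sum, norm_sq_eq_sum, rotation_zero, rotation_one, rotation_two]
    generalize (1 + n 2)⁻¹ = s at *
    linear_combination (a 0 ^ 2 * n 0 ^ 2 + 2 * a 0 * a 1 * n 0 * n 1 + a 1 ^ 2 * n 1 ^ 2) *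
      (s ^ 2 * h1 + (s * (1 - n 2) - 1) * hs) +
      2 * a 2 * (a 0 * n 0 + a 1 * n 1) * (-s * h1 - (1 - n 2) * hs) + a 2 ^ 2 * h1
  exact (pow_left_inj₀ (norm_nonneg _) (norm_nonneg _) two_ne_zero).1 h

theorem jac_rotation (hn : ‖n‖ = 1) (h2 : 0 ≤ n 2) (a b c : Space) :
    jac (rotation n a) (rotation n b) (rotation n c) = jac a b c := by
  have h1 : n 0 ^ 2 + n 1 ^ 2 + n 2 ^ 2 = 1 := by rw [← norm_sq_eq_sum, hn, one_pow]
  have hs : (1 + n 2)⁻¹ * (1 + n 2) = 1 := inv_mul_cancel₀ (by linarith)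
  simp only [jac_eq, rotation_zero, rotation_one, rotation_two]
  generalize (1 + n 2)⁻¹ = s at *
  linear_combination (a 0 * (b 1 * c 2 - b 2 * c 1) + a 1 * (b 2 * c 0 - b 0 * c 2) +
    a 2 * (b 0 * c 1 - b 1 * c 0)) * ((1 - n 2 * s) * h1 - n 2 * (1 - n 2) * hs)

/-- The rotation is close to the identity if `n` is close to `e₃`. -/
theorem norm_rotation_sub_le (hn : ‖n‖ = 1) (h2 : 0 ≤ n 2) (a : Space) :
    ‖rotation n a - a‖ ≤ 6 * ‖n - e₃‖ * ‖a‖ := by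
  set t := ‖n - e₃‖ with ht
  have ht0 : 0 ≤ t := norm_nonneg _
  have e0 : |n 0| ≤ t := by
    have h : (n - e₃) 0 = n 0 := by simp [e₃]
    exact h ▸ abs_coord_le (n - e₃) 0
  have e1 : |n 1| ≤ t := by
    have h : (n - e₃) 1 = n 1 := by simp [e₃]
    exact h ▸ abs_coord_le (n - e₃) 1
  have e2 : |n 2 - 1| ≤ t := by
    have h : (n - e₃) 2 = n 2 - 1 := by simp [e₃]
    exact h ▸ abs_coord_le (n - e₃) 2
  have f0 : |n 0| ≤ 1 := hn ▸ abs_coord_le n 0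
  have f1 : |n 1| ≤ 1 := hn ▸ abs_coord_le n 1
  have s0 : 0 ≤ (1 + n 2)⁻¹ := by positivity
  have s1 : (1 + n 2)⁻¹ ≤ 1 := inv_le_one_of_one_le₀ (by linarith)
  have a0 := abs_coord_le a 0
  have a1 := abs_coord_le a 1
  have a2 := abs_coord_le a 2
  have key : ∀ i j : ℝ, |i| ≤ t → |j| ≤ 1 → |i * j * (1 + n 2)⁻¹| ≤ t := by
    intro i j hi hj
    rw [abs_mul, abs_mul, abs_of_nonneg s0]
    calc |i| * |j| * (1 + n 2)⁻¹ ≤ t * 1 * 1 := by gcongr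
      _ = t := by ring
  have hm : ∀ c y : ℝ, |c| ≤ t → |y| ≤ ‖a‖ → |c * y| ≤ t * ‖a‖ := fun c y hc hy => by
    rw [abs_mul]; gcongr
  have b0 : |(rotation n a - a) 0| ≤ 3 * (t * ‖a‖) := by
    have e : (rotation n a - a) 0 = -(n 0 * n 0 * (1 + n 2)⁻¹ * a 0) -
        n 0 * n 1 * (1 + n 2)⁻¹ * a 1 + n 0 * a 2 := by
      show rotation n a 0 - a 0 = _
      rw [rotation_zero]; ring
    rw [e]
    have k1 := abs_le.1 (hm _ _ (key _ _ e0 f0) a0)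
    have k2 := abs_le.1 (hm _ _ (key _ _ e0 f1) a1)
    have k3 := abs_le.1 (hm _ _ e0 a2)
    rw [abs_le]; constructor <;> linarith
  have b1 : |(rotation n a - a) 1| ≤ 3 * (t * ‖a‖) := by
    have e : (rotation n a - a) 1 = -(n 0 * n 1 * (1 + n 2)⁻¹ * a 0) -
        n 1 * n 1 * (1 + n 2)⁻¹ * a 1 + n 1 * a 2 := by
      show rotation n a 1 - a 1 = _
      rw [rotation_one]; ring
    rw [e]
    have k1 := abs_le.1 (hm _ _ (key _ _ e0 f1) a0)
    have k2 := abs_le.1 (hm _ _ (key _ _ e1 f1) a1)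
    have k3 := abs_le.1 (hm _ _ e1 a2)
    rw [abs_le]; constructor <;> linarith
  have b2 : |(rotation n a - a) 2| ≤ 3 * (t * ‖a‖) := by
    have e : (rotation n a - a) 2 = -(n 0 * a 0) - n 1 * a 1 + (n 2 - 1) * a 2 := by
      show rotation n a 2 - a 2 = _
      rw [rotation_two]; ring
    rw [e]
    have k1 := abs_le.1 (hm _ _ e0 a0)
    have k2 := abs_le.1 (hm _ _ e1 a1)
    have k3 := abs_le.1 (hm _ _ e2 a2)
    rw [abs_le]; constructor <;> linarith
  have hT : 0 ≤ t * ‖a‖ := by positivity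
  refine abs_le_of_sq_le_sq' ?_ (by positivity) |>.2
  rw [norm_sq_eq_sum]
  have c0 := sq_le_sq' (abs_le.1 b0).1 (abs_le.1 b0).2
  have c1 := sq_le_sq' (abs_le.1 b1).1 (abs_le.1 b1).2
  have c2 := sq_le_sq' (abs_le.1 b2).1 (abs_le.1 b2).2
  nlinarith

end Rotation

/-! ### Inserting a rotated bubble -/

section RotatedBubble

variable {l ρ : ℝ} {n : Space}

theorem fderiv_bubble_eq_zero (hl : 0 < l) (hρ : 0 < ρ) {z : Plane}
    (hz : z ∉ Metric.ball (0 : Plane) ρ) : fderiv ℝ (bubble l ρ) z = 0 := by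
  have h1 := profile_eq_zero (l := l) hρ (sq_le_of_notMem hρ hz)
  have h2 := profileDeriv_eq_zero (l := l) hρ (sq_le_of_notMem hρ hz)
  ext v i
  rw [fderiv_bubble hl]
  fin_cases i <;> simp [radialFactor, radialFactorDeriv, verticalDeriv, h1, h2]

/-- The bubble, centred at `x` and rotated so that it tends to `-n` instead of `-e₃`. -/
def rotatedBubble (l ρ : ℝ) (n : Space) (x z : Plane) : Space := rotation n (bubble l ρ (z - x))

theorem contDiff_rotatedBubble (hl : 0 < l) (x : Plane) :
    ContDiff ℝ 1 (rotatedBubble l ρ n x) :=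
  (rotation n).contDiff.comp ((contDiff_bubble hl).comp (contDiff_id.sub contDiff_const))

theorem fderiv_rotatedBubble (hl : 0 < l) (x z v : Plane) :
    fderiv ℝ (rotatedBubble l ρ n x) z v = rotation n (fderiv ℝ (bubble l ρ) (z - x) v) := by
  have h1 : HasFDerivAt (fun z : Plane => z - x) (ContinuousLinearMap.id ℝ Plane) z :=
    (hasFDerivAt_id z).sub_const x
  have h2 := ((contDiff_bubble (ρ := ρ) hl).differentiable (by norm_num) (z - x)).hasFDerivAt
  have h3 := ((rotation n).hasFDerivAt.comp z (h2.comp z h1)).fderiv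
  have h4 : fderiv ℝ (rotatedBubble l ρ n x) z = _ := h3
  rw [h4]
  simp

theorem sub_notMem {x z : Plane} (hz : z ∉ Metric.ball x ρ) :
    z - x ∉ Metric.ball (0 : Plane) ρ := by
  rwa [mem_ball_zero_iff, ← mem_ball_iff_norm]

theorem W0_rotatedBubble {Ω : Set Plane} (hΩ : IsOpen Ω) (hl : 0 < l) (hρ : 0 < ρ) {x : Plane}
    (hb : Metric.closedBall x ρ ⊆ Ω) :
    W0 Ω (rotatedBubble l ρ n x) (fderiv ℝ (rotatedBubble l ρ n x)) := by
  have hs : tsupport (rotatedBubble l ρ n x) ⊆ Metric.closedBall x ρ := by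
    refine closure_minimal (fun z hz => ?_) Metric.isClosed_closedBall
    by_contra hcon
    refine hz ?_
    have : z ∉ Metric.ball x ρ := fun h => hcon (Metric.ball_subset_closedBall h)
    simp [rotatedBubble, bubble_eq_zero hρ (sub_notMem this)]
  exact W0.of_contDiff hΩ (contDiff_rotatedBubble hl x)
    ((isCompact_closedBall x ρ).of_isClosed_subset (isClosed_tsupport _) hs) (hs.trans hb)

/-- Inserting a rotated bubble into a disc where a sphere-valued map is constant increases the
degree by one. The rotation makes the bubble match the constant value. -/
theorem SphereMap.add_bubble {Ω : Set Plane} (hΩ : IsOpen Ω) {u : Plane → Space}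
    {g : Plane → Plane →L[ℝ] Space} (h : SphereMap Ω u g) (hl : 0 < l) (hρ : 0 < ρ) {x : Plane}
    (hb : Metric.closedBall x ρ ⊆ Ω) {p : Space} (hp : ‖p‖ ≤ 1)
    (hu : ∀ z ∈ Metric.ball x ρ, u z = p ∧ g z = 0) :
    SphereMap Ω (u + rotatedBubble l ρ (e₃ - p) x)
      (g + fderiv ℝ (rotatedBubble l ρ (e₃ - p) x)) ∧
    degInt (u + rotatedBubble l ρ (e₃ - p) x) (g + fderiv ℝ (rotatedBubble l ρ (e₃ - p) x)) =
      degInt u g + 4 * Real.pi := by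
  set n := e₃ - p with hn
  have hn1 : ‖n‖ = 1 := by
    rw [hn, norm_sub_rev, ← (hu x (Metric.mem_ball_self hρ)).1]
    exact h.unit x
  have hn2 : 0 ≤ n 2 := by
    have h1 := (abs_le.1 ((abs_coord_le p 2).trans hp)).2
    have h2 : n 2 = 1 - p 2 := by simp [hn, e₃]
    linarith
  have hin : ∀ z ∈ Metric.ball x ρ, (u + rotatedBubble l ρ n x) z - e₃ =
      rotation n (bubble l ρ (z - x) - e₃) := by
    intro z hz
    rw [Pi.add_apply, (hu z hz).1, rotatedBubble, map_sub, rotation_e₃, hn]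
    abel
  have hout : ∀ z ∉ Metric.ball x ρ, (u + rotatedBubble l ρ n x) z = u z ∧
      ∀ v, (g + fderiv ℝ (rotatedBubble l ρ n x)) z v = g z v := by
    intro z hz
    refine ⟨?_, fun v => ?_⟩
    · simp [rotatedBubble, bubble_eq_zero hρ (sub_notMem hz)]
    · rw [Pi.add_apply, add_apply, fderiv_rotatedBubble hl,
        fderiv_bubble_eq_zero hl hρ (sub_notMem hz)]
      simp
  have hS : SphereMap Ω (u + rotatedBubble l ρ n x) (g + fderiv ℝ (rotatedBubble l ρ n x)) := by
    refine ⟨h.w0.add (W0_rotatedBubble hΩ hl hρ hb), fun z => ?_⟩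
    by_cases hz : z ∈ Metric.ball x ρ
    · rw [hin z hz, norm_rotation hn1 hn2, norm_bubble_sub hl]
    · rw [(hout z hz).1, h.unit]
  refine ⟨hS, ?_⟩
  have hpt : ∀ z, jac ((u + rotatedBubble l ρ n x) z - e₃)
      ((g + fderiv ℝ (rotatedBubble l ρ n x)) z (bx 0))
      ((g + fderiv ℝ (rotatedBubble l ρ n x)) z (bx 1)) =
      jac (u z - e₃) (g z (bx 0)) (g z (bx 1)) + bubbleJac l ρ (‖z - x‖ ^ 2) := by
    intro z
    by_cases hz : z ∈ Metric.ball x ρ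
    · have e : ∀ v, (g + fderiv ℝ (rotatedBubble l ρ n x)) z v =
          rotation n (fderiv ℝ (bubble l ρ) (z - x) v) := fun v => by
        rw [Pi.add_apply, (hu z hz).2, zero_add, fderiv_rotatedBubble hl]
      rw [hin z hz, e, e, jac_rotation hn1 hn2, jac_bubble hl, (hu z hz).2]
      simp [jac_eq]
    · rw [(hout z hz).1, (hout z hz).2, (hout z hz).2]
      simp [bubbleJac, profile_eq_zero hρ (sq_le_of_notMem hρ (sub_notMem hz))]
  unfold degInt
  simp_rw [hpt]
  rw [integral_add (integrable_jac h.w0 h.unit) ((integrable_bubbleJac hl hρ).comp_sub_right x),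
    integral_sub_right_eq_self (fun z => bubbleJac l ρ (‖z‖ ^ 2)), integral_bubbleJac hl hρ]

theorem integral_fderiv_apply_eq_zero {f : Plane → ℝ} (hf : ContDiff ℝ 1 f)
    (hc : HasCompactSupport f) (v : Plane) : ∫ z, fderiv ℝ f z v = 0 := by
  have h1 : Integrable (fun z => fderiv ℝ f z v) volume :=
    ((continuous_fderiv_of_C1 hf).clm_apply continuous_const).integrable_of_hasCompactSupport
      (hc.fderiv_apply (𝕜 := ℝ) v)
  have h2 := integral_mul_fderiv_eq_neg_fderiv_mul_of_integrable (μ := (volume : Measure Plane))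
    (𝕜 := ℝ) (f := fun _ => (1 : ℝ)) (g := f) (v := v) (by simp) (by simpa using h1)
    (by simpa using hf.continuous.integrable_of_hasCompactSupport hc)
    (fun _ _ => differentiableAt_const _) (fun z _ => hf.differentiable (by norm_num) z)
  simpa using h2

end RotatedBubble

/-! ### The energy after inserting a bubble -/

section Planting

variable {l ρ : ℝ}

theorem abs_dmi_rotation_sub_le {n : Space} (hn : ‖n‖ = 1) (h2 : 0 ≤ n 2) (a b : Space)
    (i : Fin 3) : |rotation n a i * rotation n b 2 - a i * b 2| ≤
      12 * ‖n - e₃‖ * (‖a‖ * ‖b‖) := by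
  have e : rotation n a i * rotation n b 2 - a i * b 2 =
      (rotation n a - a) i * rotation n b 2 + a i * (rotation n b - b) 2 := by
    simp only [PiLp.sub_apply]; ring
  rw [e]
  have h1 : |(rotation n a - a) i * rotation n b 2| ≤ 6 * ‖n - e₃‖ * ‖a‖ * ‖b‖ := by
    rw [abs_mul]
    refine mul_le_mul ((abs_coord_le _ i).trans (norm_rotation_sub_le hn h2 a))
      ((abs_coord_le _ 2).trans (norm_rotation hn h2 b).le) (abs_nonneg _) (by positivity)
  have h3 : |a i * (rotation n b - b) 2| ≤ ‖a‖ * (6 * ‖n - e₃‖ * ‖b‖) := by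
    rw [abs_mul]
    exact mul_le_mul (abs_coord_le _ i) ((abs_coord_le _ 2).trans (norm_rotation_sub_le hn h2 b))
      (abs_nonneg _) (norm_nonneg _)
  calc _ ≤ _ := abs_add_le _ _
    _ ≤ 6 * ‖n - e₃‖ * ‖a‖ * ‖b‖ + ‖a‖ * (6 * ‖n - e₃‖ * ‖b‖) := add_le_add h1 h3
    _ = _ := by ring

/-- The energy density of a rotated bubble in a region where the original map equals `p`. The term
linear in `p` is a divergence. -/
theorem enDens_rotation_le {κ Q : ℝ} (hκ : 0 ≤ κ) (hQ : 1 ≤ Q) {n : Space} (hn : ‖n‖ = 1)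
    (h2 : 0 ≤ n 2) (p b : Space) (a a' : Plane →L[ℝ] Space)
    (ha : ∀ v, a' v = rotation n (a v)) :
    enDens κ Q (p + rotation n b) a' ≤ ∑ i : Fin 2, ‖a (bx i)‖ ^ 2
      - 2 * κ * (p 0 * a' (bx 0) 2 + p 1 * a' (bx 1) 2)
      - 2 * κ * (b 0 * a (bx 0) 2 + b 1 * a (bx 1) 2)
      + 24 * κ * ‖n - e₃‖ * (‖b‖ * ‖a (bx 0)‖ + ‖b‖ * ‖a (bx 1)‖)
      + (Q - 1) * (2 * ‖p‖ ^ 2 + 2 * ‖b‖ ^ 2) := by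
  have k0 := (abs_le.1 (abs_dmi_rotation_sub_le hn h2 b (a (bx 0)) 0)).1
  have k1 := (abs_le.1 (abs_dmi_rotation_sub_le hn h2 b (a (bx 1)) 1)).1
  have hs : (p 0 + rotation n b 0) ^ 2 + (p 1 + rotation n b 1) ^ 2 ≤
      2 * ‖p‖ ^ 2 + 2 * ‖b‖ ^ 2 := by
    rw [← norm_rotation hn h2 b, norm_sq_eq_sum p, norm_sq_eq_sum (rotation n b)]
    nlinarith [sq_nonneg (p 0 - rotation n b 0), sq_nonneg (p 1 - rotation n b 1),
      sq_nonneg (p 2), sq_nonneg (rotation n b 2)]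
  have hs' := mul_le_mul_of_nonneg_left hs (sub_nonneg.2 hQ)
  have k := mul_le_mul_of_nonneg_left (add_le_add k0 k1) (by positivity : 0 ≤ 2 * κ)
  have hsum : ∑ i : Fin 2, ‖a' (bx i)‖ ^ 2 = ∑ i : Fin 2, ‖a (bx i)‖ ^ 2 := by
    simp_rw [ha, norm_rotation hn h2]
  simp only [enDens, hsum, PiLp.add_apply]
  rw [ha (bx 0), ha (bx 1)]
  linarith

/-- The third component of the derivative of the rotated bubble has mean zero, which removes the
terms linear in `p` from the energy. -/
theorem integral_fderiv_rotatedBubble_apply (hl : 0 < l) (hρ : 0 < ρ) (n : Space) (x v : Plane) :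
    Integrable (fun z => fderiv ℝ (rotatedBubble l ρ n x) z v 2) volume ∧
    ∫ z, fderiv ℝ (rotatedBubble l ρ n x) z v 2 = 0 := by
  have hc := contDiff_rotatedBubble (ρ := ρ) (n := n) hl x
  have hf : ContDiff ℝ 1 (fun z => rotatedBubble l ρ n x z 2) :=
    (EuclideanSpace.proj (𝕜 := ℝ) (2 : Fin 3)).contDiff.comp hc
  have e : ∀ z, fderiv ℝ (fun z => rotatedBubble l ρ n x z 2) z v =
      fderiv ℝ (rotatedBubble l ρ n x) z v 2 := fun z => by
    have := ((EuclideanSpace.proj (𝕜 := ℝ) (2 : Fin 3)).hasFDerivAt.comp z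
      (hc.differentiable (by norm_num) z).hasFDerivAt).fderiv
    have h' : fderiv ℝ (fun z => rotatedBubble l ρ n x z 2) z = _ := this
    rw [h']; rfl
  have hs : HasCompactSupport (fun z => rotatedBubble l ρ n x z 2) := by
    refine HasCompactSupport.of_support_subset_isCompact (isCompact_closedBall x ρ) fun z hz => ?_
    by_contra hcon
    refine hz ?_
    have : z ∉ Metric.ball x ρ := fun h => hcon (Metric.ball_subset_closedBall h)
    simp [rotatedBubble, bubble_eq_zero hρ (sub_notMem this)]
  simp_rw [← e]
  exact ⟨((continuous_fderiv_of_C1 hf).clm_apply continuous_const).integrable_of_hasCompactSupport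
      (hs.fderiv_apply (𝕜 := ℝ) v), integral_fderiv_apply_eq_zero hf hs v⟩

/-- The energy of a map after a small rotated bubble has been inserted where it is constant. The
gain in the interaction term is linear in the size `l` of the bubble. -/
theorem exists_integral_enDens_add_bubble_le : ∃ C : ℝ, 0 < C ∧
    ∀ {Ω : Set Plane} {u : Plane → Space} {g : Plane → Plane →L[ℝ] Space} {κ Q l ρ : ℝ}
      {x : Plane} {p : Space}, IsOpen Ω → SphereMap Ω u g → 0 < κ → 1 ≤ Q → 0 < l → 4 * l ≤ ρ →
      Metric.closedBall x ρ ⊆ Ω → ‖p‖ ≤ 1 → (∀ z ∈ Metric.ball x ρ, u z = p ∧ g z = 0) →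
      ∫ z, enDens κ Q ((u + rotatedBubble l ρ (e₃ - p) x) z)
        ((g + fderiv ℝ (rotatedBubble l ρ (e₃ - p) x)) z) ≤
      (∫ z, enDens κ Q (u z) (g z)) + 8 * Real.pi + 256 * l ^ 2 / ρ ^ 2
        - 2 * κ * (l / 14 - C * ‖p‖ * l) + (Q - 1) * (8 * ‖p‖ ^ 2 * ρ ^ 2 + 64 * (l * ρ)) := by
  obtain ⟨C, hC0, hC⟩ := exists_integral_norm_mul_le
  refine ⟨24 * C, by positivity, ?_⟩
  intro Ω u g κ Q l ρ x p hΩ h hκ hQ hl hlρ hb hp hu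
  have hρ : 0 < ρ := by linarith
  set n := e₃ - p with hn
  have hn1 : ‖n‖ = 1 := by
    rw [hn, norm_sub_rev, ← (hu x (Metric.mem_ball_self hρ)).1]
    exact h.unit x
  have hn2 : 0 ≤ n 2 := by
    have h1 := (abs_le.1 ((abs_coord_le p 2).trans hp)).2
    have h2 : n 2 = 1 - p 2 := by simp [hn, e₃]
    linarith
  have hne : ‖n - e₃‖ = ‖p‖ := by rw [hn, sub_sub_cancel_left, norm_neg]
  set w := rotatedBubble l ρ n x with hw
  have hU : SphereMap Ω (u + w) (g + fderiv ℝ w) := (h.add_bubble hΩ hl hρ hb hp hu).1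
  set N : Fin 2 → Plane → ℝ := fun i z => ‖bubble l ρ z‖ * ‖fderiv ℝ (bubble l ρ) z (bx i)‖ with hN
  set A : Plane → ℝ := fun z => 2 * bubbleJac l ρ (‖z - x‖ ^ 2) + bubbleExcess l ρ (‖z - x‖ ^ 2)
    with hA
  set D : Plane → ℝ := fun z => p 0 * fderiv ℝ w z (bx 0) 2 + p 1 * fderiv ℝ w z (bx 1) 2 with hD
  set P : Plane → ℝ := fun z => N 0 (z - x) + N 1 (z - x) with hP
  set S : Plane → ℝ := fun z => 2 * (Metric.ball x ρ).indicator (fun _ => ‖p‖ ^ 2) z +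
    2 * ‖bubble l ρ (z - x)‖ ^ 2 with hS
  have hpt : ∀ z, enDens κ Q ((u + w) z) ((g + fderiv ℝ w) z) ≤ enDens κ Q (u z) (g z) + (A z
      - 2 * κ * D z - 2 * κ * bubbleDmi l ρ (z - x) + 24 * κ * ‖p‖ * P z + (Q - 1) * S z) := by
    intro z
    by_cases hz : z ∈ Metric.ball x ρ
    · have e := enDens_rotation_le hκ.le hQ hn1 hn2 p (bubble l ρ (z - x))
        (fderiv ℝ (bubble l ρ) (z - x)) (fderiv ℝ w z) (fderiv_rotatedBubble hl x z)
      have h0 : 0 ≤ enDens κ Q p 0 := by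
        have : 0 ≤ (Q - 1) * (p 0 ^ 2 + p 1 ^ 2) := mul_nonneg (by linarith) (by positivity)
        simpa [enDens] using this
      rw [Pi.add_apply, Pi.add_apply, (hu z hz).1, (hu z hz).2, zero_add]
      rw [sum_norm_sq_fderiv_bubble hl, hne] at e
      simp only [hS, Set.indicator_of_mem hz]
      exact e.trans (le_add_of_nonneg_left h0)
    · have e1 := bubble_eq_zero (l := l) hρ (sub_notMem hz)
      have e2 := fderiv_bubble_eq_zero hl hρ (sub_notMem hz)
      have e3 : fderiv ℝ w z = 0 := by
        ext1 v
        rw [hw, fderiv_rotatedBubble hl, e2]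
        simp
      have e4 : w z = 0 := by rw [hw, rotatedBubble, e1, map_zero]
      have e5 := bubbleExcess_eq_zero (l := l) hρ (sq_le_of_notMem hρ (sub_notMem hz))
      have e6 : bubbleJac l ρ (‖z - x‖ ^ 2) = 0 := by
        simp [bubbleJac, profile_eq_zero hρ (sq_le_of_notMem hρ (sub_notMem hz))]
      simp only [Pi.add_apply, hA, hD, hP, hS, hN, e1, e3, e4, e5, e6, bubbleDmi,
        Set.indicator_of_notMem hz]
      simp
  have iA1 : Integrable (fun z => 2 * bubbleJac l ρ (‖z - x‖ ^ 2)) volume :=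
    ((integrable_bubbleJac hl hρ).comp_sub_right x).const_mul 2
  have iA2 : Integrable (fun z => bubbleExcess l ρ (‖z - x‖ ^ 2)) volume :=
    (integrable_bubbleExcess hl hρ).comp_sub_right x
  have iA : Integrable A volume := iA1.add iA2
  have iD0 := integral_fderiv_rotatedBubble_apply hl hρ n x (bx 0)
  have iD1 := integral_fderiv_rotatedBubble_apply hl hρ n x (bx 1)
  have iD : Integrable D volume := (iD0.1.const_mul _).add (iD1.1.const_mul _)
  have iB : Integrable (fun z => bubbleDmi l ρ (z - x)) volume :=
    (integrable_bubbleDmi hl hρ).comp_sub_right x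
  have iN : ∀ i, Integrable (fun z => N i (z - x)) volume := fun i =>
    (hC hl (by linarith) i).1.comp_sub_right x
  have iP : Integrable P volume := (iN 0).add (iN 1)
  have iS1 : Integrable (fun z => 2 * (Metric.ball x ρ).indicator (fun _ => ‖p‖ ^ 2) z) volume :=
    (integrable_indicator_ball x ρ _).const_mul 2
  have iS2 : Integrable (fun z => 2 * ‖bubble l ρ (z - x)‖ ^ 2) volume :=
    ((integrable_norm_sq_bubble hl hρ).comp_sub_right x).const_mul 2
  have iS : Integrable S volume := iS1.add iS2
  have vA : ∫ z, A z ≤ 8 * Real.pi + 256 * l ^ 2 / ρ ^ 2 := by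
    rw [hA, integral_add iA1 iA2, integral_const_mul,
      integral_sub_right_eq_self (fun z => bubbleJac l ρ (‖z‖ ^ 2)), integral_bubbleJac hl hρ,
      integral_sub_right_eq_self (fun z => bubbleExcess l ρ (‖z‖ ^ 2))]
    linarith [integral_bubbleExcess_le hl hρ]
  have vD : ∫ z, D z = 0 := by
    rw [hD, integral_add (iD0.1.const_mul _) (iD1.1.const_mul _), integral_const_mul,
      integral_const_mul, iD0.2, iD1.2]
    simp
  have vB : l / 14 ≤ ∫ z, bubbleDmi l ρ (z - x) := by
    rw [integral_sub_right_eq_self]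
    exact le_integral_bubbleDmi hl hlρ
  have vP : ∫ z, P z ≤ 2 * C * l := by
    rw [hP, integral_add (iN 0) (iN 1), integral_sub_right_eq_self, integral_sub_right_eq_self]
    have := (hC hl (by linarith : l ≤ ρ) 0).2
    have := (hC hl (by linarith : l ≤ ρ) 1).2
    linarith
  have vS : ∫ z, S z ≤ 8 * ‖p‖ ^ 2 * ρ ^ 2 + 64 * (l * ρ) := by
    rw [hS, integral_add iS1 iS2, integral_const_mul, integral_const_mul,
      integral_sub_right_eq_self (fun z => ‖bubble l ρ z‖ ^ 2),
      integral_indicator Metric.isOpen_ball.measurableSet, setIntegral_const, smul_eq_mul,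
      volume_real_ball x hρ.le]
    have h1 := integral_norm_sq_bubble_le hl hρ
    have h2 := mul_le_mul_of_nonneg_right Real.pi_le_four
      (by positivity : 0 ≤ ρ ^ 2 * ‖p‖ ^ 2)
    linarith
  have iR1 : Integrable (fun z => A z - 2 * κ * D z) volume := iA.sub (iD.const_mul _)
  have iR2 : Integrable (fun z => A z - 2 * κ * D z - 2 * κ * bubbleDmi l ρ (z - x)) volume :=
    iR1.sub (iB.const_mul _)
  have iR3 : Integrable (fun z => A z - 2 * κ * D z - 2 * κ * bubbleDmi l ρ (z - x) +
    24 * κ * ‖p‖ * P z) volume := iR2.add (iP.const_mul _)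
  have iR4 : Integrable (fun z => A z - 2 * κ * D z - 2 * κ * bubbleDmi l ρ (z - x) +
    24 * κ * ‖p‖ * P z + (Q - 1) * S z) volume := iR3.add (iS.const_mul _)
  have iE := integrable_enDens h.w0 κ Q
  have key := integral_mono (integrable_enDens hU.w0 κ Q) (iE.add iR4) hpt
  simp only [Pi.add_apply] at key
  rw [integral_add iE iR4, integral_add iR3 (iS.const_mul _), integral_add iR2 (iP.const_mul _),
    integral_sub iR1 (iB.const_mul _), integral_sub iA (iD.const_mul _), integral_const_mul,
    integral_const_mul, integral_const_mul, integral_const_mul, vD] at key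
  have k1 := mul_le_mul_of_nonneg_left vB (by positivity : 0 ≤ 2 * κ)
  have k2 := mul_le_mul_of_nonneg_left vP (by positivity : 0 ≤ 24 * κ * ‖p‖)
  have k3 := mul_le_mul_of_nonneg_left vS (sub_nonneg.2 hQ)
  simp only [Pi.add_apply]
  linarith

end Planting

/-! ### Increasing the degree by one -/

section Increment

theorem lintegral_enorm_sq_eq {E : Type*} [NormedAddCommGroup E] {μ : Measure Plane}
    {f : Plane → E} (hf : MemLp f 2 μ) :
    ∫⁻ z, ‖f z‖ₑ ^ 2 ∂μ = ENNReal.ofReal (∫ z, ‖f z‖ ^ 2 ∂μ) := by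
  rw [integral_norm_sq_eq hf.1, ENNReal.ofReal_toReal, eLpNorm_two_sq]
  exact ENNReal.pow_ne_top hf.2.ne

/-- The energy density is controlled by the density in the smallness hypothesis; `κ² ≤ M` absorbs
the interaction term. -/
theorem abs_enDens_le {κ Q M : ℝ} (hκ : κ ^ 2 ≤ M) (hQ : 1 ≤ Q) (hM : Q - 1 ≤ M) (u : Space)
    (a : Plane →L[ℝ] Space) : |enDens κ Q u a| ≤ 4 * ‖a‖ ^ 2 + 2 * M * ‖u‖ ^ 2 := by
  have h1 : ∀ i, ‖a (bx i)‖ ^ 2 ≤ ‖a‖ ^ 2 := fun i => by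
    have := a.le_opNorm (bx i)
    rw [norm_bx, mul_one] at this
    gcongr
  have h2 : ∀ i, a (bx i) 2 ^ 2 ≤ ‖a‖ ^ 2 := fun i => by
    refine le_trans ?_ (h1 i)
    rw [← sq_abs]
    gcongr
    exact abs_coord_le _ 2
  have h3 : u 0 ^ 2 + u 1 ^ 2 ≤ ‖u‖ ^ 2 := by
    rw [norm_sq_eq_sum]; nlinarith [sq_nonneg (u 2)]
  have h4 : (Q - 1) * (u 0 ^ 2 + u 1 ^ 2) ≤ M * ‖u‖ ^ 2 :=
    mul_le_mul hM h3 (by positivity) (by linarith)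
  have h5 : 0 ≤ (Q - 1) * (u 0 ^ 2 + u 1 ^ 2) := mul_nonneg (by linarith) (by positivity)
  have h6 : κ ^ 2 * (u 0 ^ 2 + u 1 ^ 2) ≤ M * ‖u‖ ^ 2 :=
    mul_le_mul hκ h3 (by positivity) (by linarith)
  have a0 := h1 0
  have a1 := h1 1
  have b0 := h2 0
  have b1 := h2 1
  have n0 := sq_nonneg ‖a (bx 0)‖
  have n1 := sq_nonneg ‖a (bx 1)‖
  rw [enDens, Fin.sum_univ_two, abs_le]
  constructor
  · nlinarith [sq_nonneg (κ * u 0 - a (bx 0) 2), sq_nonneg (κ * u 1 - a (bx 1) 2)]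
  · nlinarith [sq_nonneg (κ * u 0 + a (bx 0) 2), sq_nonneg (κ * u 1 + a (bx 1) 2)]

/-- The energy change caused by modifying a map in a set `S`. -/
theorem integral_enDens_sub_le {Ω S : Set Plane} (hS : MeasurableSet S) {u u' : Plane → Space}
    {g g' : Plane → Plane →L[ℝ] Space} (h : W0 Ω u g) (h' : W0 Ω u' g')
    (heq : ∀ᵐ z, z ∉ S → u' z = u z ∧ g' z = g z) {κ Q M : ℝ} (hκ : κ ^ 2 ≤ M) (hQ : 1 ≤ Q)
    (hM : Q - 1 ≤ M) : ∫ z, enDens κ Q (u' z) (g' z) ≤ (∫ z, enDens κ Q (u z) (g z)) +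
      (4 * ((∫ z in S, ‖g' z‖ ^ 2) + ∫ z in S, ‖g z‖ ^ 2) +
        2 * M * ((∫ z in S, ‖u' z‖ ^ 2) + ∫ z in S, ‖u z‖ ^ 2)) := by
  have ig := h.memLp_deriv.integrable_norm_pow (p := 2) (by norm_num)
  have ig' := h'.memLp_deriv.integrable_norm_pow (p := 2) (by norm_num)
  have iu := h.memLp.integrable_norm_pow (p := 2) (by norm_num)
  have iu' := h'.memLp.integrable_norm_pow (p := 2) (by norm_num)
  set F : Plane → ℝ := fun z => 4 * (‖g' z‖ ^ 2 + ‖g z‖ ^ 2) + 2 * M * (‖u' z‖ ^ 2 + ‖u z‖ ^ 2)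
    with hF
  have iF : Integrable F volume := ((ig'.add ig).const_mul 4).add ((iu'.add iu).const_mul (2 * M))
  have i0 := integrable_enDens h κ Q
  have key : ∫ z, enDens κ Q (u' z) (g' z) ≤
      ∫ z, (enDens κ Q (u z) (g z) + S.indicator F z) := by
    refine integral_mono_ae (integrable_enDens h' κ Q) (i0.add (iF.indicator hS)) ?_
    filter_upwards [heq] with z hz
    by_cases hzS : z ∈ S
    · rw [Set.indicator_of_mem hzS]
      have e1 := (abs_le.1 (abs_enDens_le hκ hQ hM (u z) (g z))).1
      have e2 := (abs_le.1 (abs_enDens_le hκ hQ hM (u' z) (g' z))).2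
      simp only [hF]
      linarith
    · rw [Set.indicator_of_notMem hzS, (hz hzS).1, (hz hzS).2, add_zero]
  rw [integral_add i0 (iF.indicator hS), integral_indicator hS] at key
  refine key.trans (le_of_eq ?_)
  congr 1
  have i1 : Integrable (fun z => 4 * (‖g' z‖ ^ 2 + ‖g z‖ ^ 2)) volume := (ig'.add ig).const_mul 4
  have i2 : Integrable (fun z => 2 * M * (‖u' z‖ ^ 2 + ‖u z‖ ^ 2)) volume :=
    (iu'.add iu).const_mul (2 * M)
  rw [hF, integral_add i1.integrableOn i2.integrableOn, integral_const_mul, integral_const_mul,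
    integral_add ig'.integrableOn ig.integrableOn, integral_add iu'.integrableOn iu.integrableOn]

/-- The gain from the interaction term exceeds all other contributions to the energy change, which
are of order `κ ^ 2 * R ^ 2` with smaller constants. The bubble has size `c * κ * R ^ 2`. -/
theorem energy_budget {B C ε κ Q M R p q Y Gk Gg Uv Uu : ℝ} (hκ : 0 < κ) (hR : 0 < R)
    (hC : 0 < C) (hB : 0 < B) (hQM : Q - 1 ≤ M) (hM : 0 < M) {c : ℝ}
    (hc : c = 1 / (4096 * 28)) (hR2 : 896 * (Q - 1) * R ≤ κ)
    (hε : (24 * (C + 1) + 8) * ε ≤ c / 28) (hY : Y = 4 * ε * (κ ^ 2 * R ^ 2))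
    (hpB : p ≤ 1 / (56 * B)) (hpM : M * (p ^ 2 * R ^ 2) ≤ 4 * Y) (hG : Gg ≤ Y) (hU : M * Uu ≤ Y)
    (hk : Gk ≤ C * Gg) (hv : Uv ≤ C * Uu) (hq : q = c * κ * R ^ 2) :
    4 * (Gk + Gg) + 2 * M * (Uv + Uu) + 256 * q ^ 2 / (R / 4) ^ 2
      - 2 * κ * (q / 14 - B * p * q) + (Q - 1) * (8 * p ^ 2 * (R / 4) ^ 2 + 64 * (q * (R / 4)))
      < 0 := by
  have hc0 : 0 < c := by rw [hc]; positivity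
  set X : ℝ := κ ^ 2 * R ^ 2 with hX
  have hX0 : 0 < X := by positivity
  -- The gain is `c * X / 7`; the error from the rotation, the cutoff, and the flattening take at
  -- most `c * X / 28` each, and the anisotropy of the bubble takes `c * X / 56`.
  have t1 : 256 * q ^ 2 / (R / 4) ^ 2 = c * X / 28 := by
    have h1 : 4096 * c ^ 2 = c / 28 := by rw [hc]; norm_num
    have h2 : 256 * q ^ 2 / (R / 4) ^ 2 = 4096 * c ^ 2 * (κ ^ 2 * R ^ 2) := by
      rw [hq]
      field_simp
      norm_num
    rw [h2, h1, hX]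
    ring
  have t2 : c * X / 7 - c * X / 28 ≤ 2 * κ * (q / 14 - B * p * q) := by
    have h1 : B * p ≤ 1 / 56 := by
      rw [le_div_iff₀ (by positivity)] at hpB
      linarith
    have h3 : 2 * κ * (q / 14 - B * p * q) = c * X / 7 - 2 * (c * X) * (B * p) := by
      rw [hq, hX]; ring
    have h4 := mul_le_mul_of_nonneg_left h1 (by positivity : 0 ≤ 2 * (c * X))
    linarith
  have t3 : (Q - 1) * (8 * p ^ 2 * (R / 4) ^ 2 + 64 * (q * (R / 4))) ≤ 2 * Y + c * X / 56 := by
    have h1 : (Q - 1) * (p ^ 2 * R ^ 2) ≤ 4 * Y :=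
      (mul_le_mul_of_nonneg_right hQM (by positivity)).trans hpM
    have h2 := mul_le_mul_of_nonneg_left hR2 (by positivity : 0 ≤ c * κ * R ^ 2 / 56)
    have h3 : (Q - 1) * (8 * p ^ 2 * (R / 4) ^ 2 + 64 * (q * (R / 4))) =
        (Q - 1) * (p ^ 2 * R ^ 2) / 2 + c * κ * R ^ 2 / 56 * (896 * (Q - 1) * R) := by
      rw [hq]; ring
    have h4 : c * κ * R ^ 2 / 56 * κ = c * X / 56 := by rw [hX]; ring
    linarith
  have t4 : 4 * (Gk + Gg) + 2 * M * (Uv + Uu) ≤ 6 * (C + 1) * Y := by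
    have h1 := mul_le_mul_of_nonneg_left hv hM.le
    have h2 := mul_le_mul_of_nonneg_left hG (by positivity : 0 ≤ C + 1)
    have h3 := mul_le_mul_of_nonneg_left hU (by positivity : 0 ≤ C + 1)
    linarith
  have t5 : (6 * (C + 1) + 2) * Y ≤ c * X / 28 := by
    have := mul_le_mul_of_nonneg_right hε hX0.le
    rw [hY]
    linarith
  have t6 : 0 < c * X := by positivity
  linarith

/-- A sphere-valued map whose energy is small on a small disc can be modified there so that its
degree increases by one while its energy increases by less than `8π`. -/
theorem SphereMap.exists_increment : ∃ ε : ℝ, 0 < ε ∧ ∀ Ω : Set Plane, IsOpen Ω →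
    ∀ κ Q M : ℝ, 0 < κ → 1 ≤ Q → κ ^ 2 ≤ M → Q - 1 ≤ M →
    ∀ (u : Plane → Space) (g : Plane → Plane →L[ℝ] Space), SphereMap Ω u g → ∀ x ∈ Ω,
    (∀ r : ℝ, 0 < r → Metric.ball x r ⊆ Ω →
      ∫ z in Metric.ball x r, ((∑ i, ‖g z (bx i)‖ ^ 2) + M * ‖u z‖ ^ 2) ≤
        ε * κ ^ 2 * (Real.pi * r ^ 2)) →
    ∃ (u' : Plane → Space) (g' : Plane → Plane →L[ℝ] Space), SphereMap Ω u' g' ∧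
      degInt u' g' = degInt u g + 4 * Real.pi ∧
      ∫ z, enDens κ Q (u' z) (g' z) < (∫ z, enDens κ Q (u z) (g z)) + 8 * Real.pi := by
  obtain ⟨C, hC0, hC⟩ := exists_flatten
  obtain ⟨B, hB0, hB⟩ := exists_integral_enDens_add_bubble_le
  set c : ℝ := 1 / (4096 * 28) with hc
  have hc0 : 0 < c := by norm_num [hc]
  set ε : ℝ := min (min (1 / 16) ((1 / (56 * B)) ^ 2 / 16))
    (min ((1 / 2) ^ 20 / 4) (c / 28 / (24 * (C + 1) + 8))) with hε
  have hε0 : 0 < ε := by positivity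
  have hε1 : 16 * ε ≤ 1 := by
    have : ε ≤ 1 / 16 := (min_le_left _ _).trans (min_le_left _ _)
    linarith
  have hε2 : 16 * ε ≤ (1 / (56 * B)) ^ 2 := by
    have : ε ≤ (1 / (56 * B)) ^ 2 / 16 := (min_le_left _ _).trans (min_le_right _ _)
    linarith
  have hε3 : 4 * ε ≤ (1 / 2) ^ 20 := by
    have : ε ≤ (1 / 2) ^ 20 / 4 := (min_le_right _ _).trans (min_le_left _ _)
    linarith
  have hε4 : (24 * (C + 1) + 8) * ε ≤ c / 28 := by
    have : ε ≤ c / 28 / (24 * (C + 1) + 8) := (min_le_right _ _).trans (min_le_right _ _)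
    rwa [le_div_iff₀ (by positivity), mul_comm] at this
  refine ⟨ε, hε0, ?_⟩
  intro Ω hΩ κ Q M hκ hQ hκM hQM u g h x hx hsmall
  have hM0 : 0 < M := lt_of_lt_of_le (by positivity) hκM
  have hQ0 : 0 ≤ Q - 1 := by linarith
  obtain ⟨r, hr0, hr⟩ := Metric.nhds_basis_closedBall.mem_iff.1 (hΩ.mem_nhds hx)
  -- The last entry makes the anisotropy of the bubble small compared to the gain. It depends on
  -- `κ` and `Q`, unlike `ε`.
  set R : ℝ := min r (min (1 / κ) (κ / (896 * (Q - 1) + 1))) with hR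
  have hR0 : 0 < R := by positivity
  have hball : Metric.closedBall x R ⊆ Ω :=
    (Metric.closedBall_subset_closedBall (min_le_left _ _)).trans hr
  have hR1 : κ * R ≤ 1 := by
    have : R ≤ 1 / κ := (min_le_right _ _).trans (min_le_left _ _)
    rw [le_div_iff₀ hκ] at this
    linarith
  have hR2 : 896 * (Q - 1) * R ≤ κ := by
    have : R ≤ κ / (896 * (Q - 1) + 1) := (min_le_right _ _).trans (min_le_right _ _)
    rw [le_div_iff₀ (by positivity)] at this
    nlinarith
  set X : ℝ := κ ^ 2 * R ^ 2 with hX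
  have hX0 : 0 < X := by positivity
  have hX1 : X ≤ 1 := by
    have : X = (κ * R) ^ 2 := by rw [hX]; ring
    rw [this]
    exact pow_le_one₀ (by positivity) hR1
  set Y : ℝ := 4 * ε * X with hY
  have hY0 : 0 ≤ Y := by positivity
  have ig := h.w0.memLp_deriv.integrable_norm_pow (p := 2) (by norm_num)
  have igi : ∀ i, Integrable (fun z => ‖g z (bx i)‖ ^ 2) volume := fun i =>
    (memLp_deriv_apply h.w0 (bx i)).integrable_norm_pow (p := 2) (by norm_num)
  have iu := h.w0.memLp.integrable_norm_pow (p := 2) (by norm_num)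
  set S := Metric.ball x R with hS
  have hsum : (∫ z in S, ‖g z‖ ^ 2) + M * ∫ z in S, ‖u z‖ ^ 2 ≤ Y := by
    have h1 := hsmall R hR0 (Metric.ball_subset_closedBall.trans hball)
    have h2 : (∫ z in S, ‖g z‖ ^ 2) + M * ∫ z in S, ‖u z‖ ^ 2 ≤
        ∫ z in S, ((∑ i, ‖g z (bx i)‖ ^ 2) + M * ‖u z‖ ^ 2) := by
      rw [← integral_const_mul, ← integral_add ig.integrableOn (iu.const_mul M).integrableOn]
      refine setIntegral_mono (ig.add (iu.const_mul M)).integrableOn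
        ((integrable_finsetSum _ fun i _ => igi i).add (iu.const_mul M)).integrableOn fun z => ?_
      exact add_le_add_left (norm_sq_le_sum (g z)) _
    have h3 := mul_le_mul_of_nonneg_left Real.pi_le_four (by positivity : 0 ≤ ε * κ ^ 2 * R ^ 2)
    have h4 : Y = ε * κ ^ 2 * R ^ 2 * 4 := by rw [hY, hX]; ring
    linarith
  have hG0 : 0 ≤ ∫ z in S, ‖g z‖ ^ 2 := integral_nonneg fun z => by positivity
  have hU0 : 0 ≤ ∫ z in S, ‖u z‖ ^ 2 := integral_nonneg fun z => by positivity
  have hMU0 : 0 ≤ M * ∫ z in S, ‖u z‖ ^ 2 := by positivity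
  have eg := lintegral_enorm_sq_eq (μ := volume.restrict S) (h.w0.memLp_deriv.restrict S)
  have eu := lintegral_enorm_sq_eq (μ := volume.restrict S) (h.w0.memLp.restrict S)
  obtain ⟨v, k, p, hv, hdeg, hout, hin, hp, hk, hvu⟩ := hC Ω hΩ x R hR0 hball u g h (by
    rw [eg]
    refine ENNReal.ofReal_le_ofReal ?_
    nlinarith)
  have ek := lintegral_enorm_sq_eq (μ := volume.restrict S) (hv.w0.memLp_deriv.restrict S)
  have ev := lintegral_enorm_sq_eq (μ := volume.restrict S) (hv.w0.memLp.restrict S)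
  rw [eg, ek, ← ENNReal.ofReal_mul hC0.le, ENNReal.ofReal_le_ofReal_iff (by positivity)] at hk
  rw [eu, ev, ← ENNReal.ofReal_mul hC0.le, ENNReal.ofReal_le_ofReal_iff (by positivity)] at hvu
  have hpR : ‖p‖ ^ 2 * R ^ 2 ≤ 4 * ∫ z in S, ‖u z‖ ^ 2 := by
    rw [eu, ← ofReal_norm, ← ENNReal.ofReal_pow (norm_nonneg _),
      ← ENNReal.ofReal_mul (by positivity)] at hp
    have e4 : (4 : ℝ≥0∞) = ENNReal.ofReal 4 := by norm_num
    rw [e4, ← ENNReal.ofReal_mul (by norm_num), ENNReal.ofReal_le_ofReal_iff (by positivity)] at hp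
    exact hp
  have hpM : M * (‖p‖ ^ 2 * R ^ 2) ≤ 4 * Y := by
    have := mul_le_mul_of_nonneg_left hpR hM0.le
    linarith
  have hp2 : ‖p‖ ^ 2 ≤ 16 * ε := by
    have h1 : κ ^ 2 * (‖p‖ ^ 2 * R ^ 2) ≤ 4 * Y :=
      (mul_le_mul_of_nonneg_right hκM (by positivity)).trans hpM
    have h2 : X * ‖p‖ ^ 2 ≤ X * (16 * ε) := by rw [hY] at h1; rw [hX] at *; linarith
    exact le_of_mul_le_mul_left h2 hX0
  have hp1 : ‖p‖ ≤ 1 := by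
    have : ‖p‖ ^ 2 ≤ 1 ^ 2 := by linarith
    exact le_of_sq_le_sq this zero_le_one
  have hpB : ‖p‖ ≤ 1 / (56 * B) := le_of_sq_le_sq (hp2.trans hε2) (by positivity)
  have hflat := integral_enDens_sub_le Metric.isOpen_ball.measurableSet h.w0 hv.w0 hout hκM hQ hQM
  set l : ℝ := c * κ * R ^ 2 with hl
  have hl0 : 0 < l := by positivity
  have hlR : 4 * l ≤ R / 4 := by
    have : l = c * (κ * R) * R := by rw [hl]; ring
    have h2 : c * (κ * R) * R ≤ c * 1 * R := by gcongr
    rw [this]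
    have h3 : c ≤ 1 / 16 := by norm_num [hc]
    nlinarith
  have hb4 : Metric.closedBall x (R / 4) ⊆ Ω :=
    (Metric.closedBall_subset_closedBall (by linarith)).trans hball
  obtain ⟨hU, hUdeg⟩ := hv.add_bubble hΩ hl0 (by positivity : 0 < R / 4) hb4 hp1 hin
  have hE := hB hΩ hv hκ hQ hl0 hlR hb4 hp1 hin
  refine ⟨_, _, hU, by rw [hUdeg, hdeg], hE.trans_lt ?_⟩
  have hbudget := energy_budget hκ hR0 hC0 hB0 hQM hM0 hc hR2 hε4 hY hpB hpM
    (by linarith) (by linarith) hk hvu hl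
  linarith

/-- The condition `α ≤ 1 / 2` bounds `κ²` by the coefficient in the smallness hypothesis. -/
theorem sq_le_max_of_alpha_le {Ω : Set Plane} {κ Q : ℝ} (hl : 0 < dirichletEigenvalue Ω)
    (hκ : 0 < κ) (hQ : 1 ≤ Q) (hα : alpha Ω Q κ ≤ 1 / 2) :
    κ ^ 2 ≤ max (dirichletEigenvalue Ω) (Q - 1) := by
  set M := max (dirichletEigenvalue Ω) (Q - 1) with hM
  have h1 : dirichletEigenvalue Ω ≤ M := le_max_left _ _
  have h2 : Q - 1 ≤ M := le_max_right _ _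
  have hQ0 : 0 ≤ Q - 1 := by linarith
  have hs : 0 < √((Q - 1) ^ 2 + 4 * dirichletEigenvalue Ω * κ ^ 2) := by positivity
  rw [alpha, div_le_iff₀ (by positivity)] at hα
  -- If `M < κ ^ 2`, the square root is less than `3 * κ ^ 2`.
  by_contra! hcon
  have h3 : √((Q - 1) ^ 2 + 4 * dirichletEigenvalue Ω * κ ^ 2) < 3 * κ ^ 2 := by
    rw [Real.sqrt_lt' (by positivity)]
    have e1 : (Q - 1) ^ 2 ≤ (κ ^ 2) ^ 2 := by gcongr; linarith
    have e2 : 4 * dirichletEigenvalue Ω * κ ^ 2 ≤ 4 * κ ^ 2 * κ ^ 2 := by gcongr; linarith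
    nlinarith [pow_pos hκ 4]
  linarith

end Increment

end Skyrmion

end

theorem lemma3p3 :
    ∃ ε : ℝ, 0 < ε ∧
      ∀ Ω : Set Skyrmion.Plane, IsOpen Ω → Bornology.IsBounded Ω →
      ∀ κ Q : ℝ, 0 < κ → 1 ≤ Q → Skyrmion.alpha Ω Q κ ≤ 1 / 2 →
      ∀ d : ℕ, ∀ m ∈ Skyrmion.admissible Ω (d : ℤ),
        (∃ x ∈ Ω, ∀ r : ℝ, 0 < r → Metric.ball x r ⊆ Ω →
          1 / (Real.pi * r ^ 2) * ∫ y in Metric.ball x r,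
            (Skyrmion.gradSq Ω m y
              + max (Skyrmion.dirichletEigenvalue Ω) (Q - 1) * ‖m y + Skyrmion.e₃‖ ^ 2)
            ≤ ε * κ ^ 2) →
        ∃ mbar ∈ Skyrmion.admissible Ω ((d : ℤ) + 1),
          Skyrmion.energy Ω Q κ mbar < Skyrmion.energy Ω Q κ m + 8 * Real.pi := by
  obtain ⟨ε, hε0, hε⟩ := Skyrmion.SphereMap.exists_increment
  refine ⟨ε, hε0, ?_⟩
  intro Ω hΩ hb κ Q hκ hQ hα d m hm ⟨x, hx, hsmall⟩
  have hl := Skyrmion.dirichletEigenvalue_pos hΩ hb ⟨x, hx⟩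
  obtain ⟨u, g, hw, hunit, h1, h2⟩ := Skyrmion.exists_of_mem_admissible hΩ hm
  obtain ⟨hdeg, hen⟩ := Skyrmion.degInt_and_energy_of_ae hw h1 h2
  obtain ⟨u', g', hU, hUdeg, hUen⟩ := hε Ω hΩ κ Q _ hκ hQ
    (Skyrmion.sq_le_max_of_alpha_le hl hκ hQ hα) (le_max_right _ _) u g ⟨hw, hunit⟩ x hx
    fun r hr hball => by
      have h3 := hsmall r hr hball
      have hpos : 0 < Real.pi * r ^ 2 := by positivity
      rw [one_div, inv_mul_le_iff₀ hpos] at h3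
      refine le_of_eq_of_le (integral_congr_ae ?_) (h3.trans_eq (mul_comm _ _))
      have hr' := Measure.restrict_mono hball (le_refl (volume : Measure Skyrmion.Plane))
      filter_upwards [ae_mono hr' h1, ae_mono hr' (h2 0), ae_mono hr' (h2 1)] with z e1 e2 e3
      rw [Skyrmion.gradSq, Fin.sum_univ_two, Fin.sum_univ_two, e1, e2, e3]
  have hd : Skyrmion.degree Ω m = (d : ℤ) := hm.2.2.2
  have hd' : Skyrmion.degInt u' g' = 4 * Real.pi * ((d + 1 : ℤ) : ℝ) := by
    rw [hdeg, one_div, inv_mul_eq_iff_eq_mul₀ (by positivity)] at hd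
    rw [hUdeg, hd]
    push_cast
    ring
  obtain ⟨hadm, henergy⟩ := hU.mem_admissible hΩ hb hd'
  refine ⟨_, hadm, ?_⟩
  rw [henergy, hen]
  exact hUen
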